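/- All graphs are finite and simple and are considered up to isomorphism. A graph is \emph{1-planar} if it can be drawn in the plane so that each edge is crossed at most once, and a 1-planar graph with $n\ge 3$ vertices is \emph{optimal} if it has $4n-8$ edges. For $k\ge 3$, the \emph{extended wheel graph} $XW_{2k}$ consists of a cycle $v_1,\dots,v_{2k}$, all edges between vertices at distance two on the cycle, and two non-adjacent poles $p,q$, each joined to every $v_i$. Let $G$ be an optimal 1-planar graph. \emph{SR-reduction.} Let $x$ be a vertex whose neighbors are exactly six distinct vertices $x_1,\dots,x_6$, such that $x_1x_2,\,x_2x_3,\,x_3x_4,\,x_4x_5,\,x_5x_6,\,x_6x_1,\,x_1x_3,\,x_3x_5,\,x_5x_1$ are edges of $G$ and $x_1x_4,\,x_2x_4,\,x_6x_4$ are not. Then $G$ reduces by $SR$ to the graph obtained by deleting $x$ and the edge $x_3x_5$ and adding the edges $x_4x_1,\,x_4x_2,\,x_4x_6$. \emph{CR-reduction.} Let $x_1,\dots,x_4,v_1,\dots,v_4$ be distinct vertices such that (indices modulo $4$) the neighbors of $x_i$ are exactly the other three $x_j$ together with $v_{i-1},v_i,v_{i+1}$, the pairs $v_iv_{i+1}$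 are edges, and $v_1v_3$, $v_2v_4$ are not edges. Then $G$ reduces by $CR$ to the graph obtained by deleting $x_1,\dots,x_4$ and adding the edges $v_1v_3$ and $v_2v_4$. Write $G\to G'$ if $G$ reduces to $G'$ by $SR$ or by $CR$, and let $\to^*$ be the reflexive and transitive closure of $\to$. An optimal 1-planar graph $G$ is called an $SXW_{2k}$ (respectively, a $CXW_{2k}$) if it reduces to $XW_{2k}$ by a single SR-reduction (respectively, CR-reduction). \textbf{Lemma.} Let $G$ be a graph and $k$ an integer. \begin{itemize} \item If $k\ge 5$ and $G$ is an $SXW_{2k}$, then $G\to XW_{2k}$, and $G\to^* G_2$ for some $G_2$ which is an $SXW_{2k-2}$; moreover $G_2$ can be reached from $G$ by two SR-reductions. \item If $k\ge 4$ and $G$ is a $CXW_{2k}$, then $G\to XW_{2k}$, and $G\to^* G_2$ for some $G_2$ which is a $CXW_{2k-2}$; moreover $G_2$ can be reached from $G$ by two SR-reductions. \end{itemize} -/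

import Mathlib

universe u v

/-! Rotation systems and planarity. -/

/-- A rotation system: at every vertex, the darts leaving that vertex are arranged in one
cyclic order, `next d` being the successor of `d` around its tail. -/
structure RotationSystem {W : Type u} (H : SimpleGraph W) where
  next : Equiv.Perm H.Dart
  next_fst : ∀ d, (next d).fst = d.fst
  cyclic : ∀ d e : H.Dart, d.fst = e.fst → next.SameCycle d e

namespace RotationSystem

variable {W : Type u} {H : SimpleGraph W}

/-- The face-tracing permutation: traverse the dart, then turn to the next dart around its head. -/
def facePerm (ρ : RotationSystem H) : Equiv.Perm H.Dart :=
  (Function.Involutive.toPerm SimpleGraph.Dart.symm SimpleGraph.Dart.symm_involutive).trans ρ.next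

/-- The number of faces, summed over the connected components (each one embedded in its own
sphere).  An isolated vertex has no darts and has one face. -/
noncomputable def faceCount (ρ : RotationSystem H) : ℕ :=
  Nat.card (Quotient (Equiv.Perm.SameCycle.setoid ρ.facePerm)) +
    Nat.card {w : W // ∀ w', ¬ H.Adj w w'}

/-- A rotation system of a finite graph is planar if it has genus zero, that is, if Euler's
formula `|V| - |E| + |F| = 2` holds in every component.  Since the left-hand side is at most `2`
in each component, it suffices to ask for the sum over all components. -/
def IsPlanar (ρ : RotationSystem H) : Prop :=
  Nat.card W + ρ.faceCount = Nat.card H.edgeSet + 2 * Nat.card H.ConnectedComponent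

end RotationSystem

/-! 1-planar graphs. -/

/-- A choice of pairs of edges of `G` that cross, indexed by the crossing points `c : X`.  The
edges `edge c true` and `edge c false` cross at `c`, have no common endpoint, and every edge of `G`
takes part in at most one crossing. -/
structure CrossingSystem {V : Type u} (G : SimpleGraph V) (X : Type v) where
  edge : X → Bool → Sym2 V
  edge_mem : ∀ c b, edge c b ∈ G.edgeSet
  edge_inj : ∀ c b c' b', edge c b = edge c' b' → c = c' ∧ b = b'
  disjoint : ∀ c w, w ∈ edge c true → w ∉ edge c false

namespace CrossingSystem

variable {V : Type u} {G : SimpleGraph V} {X : Type v}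

/-- The planarization: the crossing points become vertices, each joined to the four endpoints of
the two edges that cross there; the uncrossed (planar) edges are kept. -/
def planarization (C : CrossingSystem G X) : SimpleGraph (V ⊕ X) where
  Adj a b :=
    match a, b with
    | .inl s, .inl t => G.Adj s t ∧ ∀ c i, C.edge c i ≠ s(s, t)
    | .inl s, .inr c => ∃ i, s ∈ C.edge c i
    | .inr c, .inl s => ∃ i, s ∈ C.edge c i
    | .inr _, .inr _ => False
  symm := ⟨by
    rintro (s | c) (t | c') h
    · exact ⟨h.1.symm, fun c i => by rw [Sym2.eq_swap]; exact h.2 c i⟩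
    · exact h
    · exact h
    · exact h⟩
  loopless := ⟨by
    rintro (s | c) h
    · exact G.loopless.irrefl s h.1
    · exact h⟩

/-- At every crossing point the half-edges of the two crossing edges alternate: the half-edge
opposite to the one leading to an endpoint `s` leads to the other endpoint `t` of the same edge. -/
def Alternates (C : CrossingSystem G X) (ρ : RotationSystem C.planarization) : Prop :=
  ∀ (c : X) (d : C.planarization.Dart), d.fst = Sum.inr c →
    ∃ (i : Bool) (s t : V), C.edge c i = s(s, t) ∧ d.snd = Sum.inl s ∧
      (ρ.next (ρ.next d)).snd = Sum.inl t

end CrossingSystem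

/-- A finite graph is 1-planar if it has a 1-planar embedding, given by a planar embedding of a
planarization in which every edge is crossed at most once. -/
def IsOnePlanar {V : Type u} (G : SimpleGraph V) : Prop :=
  Finite V ∧ ∃ (m : ℕ) (C : CrossingSystem G (Fin m)) (ρ : RotationSystem C.planarization),
    C.Alternates ρ ∧ ρ.IsPlanar

/-- A 1-planar graph with `n` vertices (`n ≥ 3`) is optimal if it has `4 n - 8` edges. -/
def IsOptimalOnePlanar {V : Type u} (G : SimpleGraph V) : Prop :=
  IsOnePlanar G ∧ 3 ≤ Nat.card V ∧ Nat.card G.edgeSet + 8 = 4 * Nat.card V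

/-! The reductions. -/

/-- `x` is a vertex of degree six whose neighbours `x₁, …, x₆`, together with `x`, match the crossed
star, which consists of the three kites `x x₁ x₂ x₃`, `x x₃ x₄ x₅`, `x x₅ x₆ x₁`; and none of the
blocking edges `x₂x₄`, `x₆x₄`, `x₁x₄` is present, so that `x` can be merged with `x₄`. -/
structure IsSRSite {V : Type u} (G : SimpleGraph V) (x x₁ x₂ x₃ x₄ x₅ x₆ : V) : Prop where
  nodup : [x₁, x₂, x₃, x₄, x₅, x₆].Nodup
  nbr : G.neighborSet x = {x₁, x₂, x₃, x₄, x₅, x₆}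
  adj₁₂ : G.Adj x₁ x₂
  adj₂₃ : G.Adj x₂ x₃
  adj₃₄ : G.Adj x₃ x₄
  adj₄₅ : G.Adj x₄ x₅
  adj₅₆ : G.Adj x₅ x₆
  adj₆₁ : G.Adj x₆ x₁
  adj₁₃ : G.Adj x₁ x₃
  adj₃₅ : G.Adj x₃ x₅
  adj₅₁ : G.Adj x₅ x₁
  not_adj₂₄ : ¬ G.Adj x₂ x₄
  not_adj₆₄ : ¬ G.Adj x₆ x₄
  not_adj₁₄ : ¬ G.Adj x₁ x₄

/-- The result of merging `x` with `x₄`: `x` is removed and the crossed star is replaced by the two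
kites `x₁ x₂ x₃ x₄` and `x₁ x₄ x₅ x₆`. -/
def srGraph {V : Type u} (G : SimpleGraph V) (x x₁ x₂ x₃ x₄ x₅ x₆ : V) :
    SimpleGraph ({x}ᶜ : Set V) :=
  (G.deleteEdges {s(x₃, x₅)} ⊔
    SimpleGraph.fromEdgeSet {s(x₄, x₁), s(x₄, x₂), s(x₄, x₆)}).induce {x}ᶜ

/-- `G → G'` by one feasible SR-reduction of the optimal 1-planar graph `G` (graphs are considered
up to isomorphism). -/
def SRReduces {V : Type u} {W : Type v} (G : SimpleGraph V) (G' : SimpleGraph W) : Prop :=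
  IsOptimalOnePlanar G ∧ ∃ x x₁ x₂ x₃ x₄ x₅ x₆ : V, IsSRSite G x x₁ x₂ x₃ x₄ x₅ x₆ ∧
    Nonempty (G' ≃g srGraph G x x₁ x₂ x₃ x₄ x₅ x₆)

/-- The vertices `x₁, …, x₄` of degree six and `v₁, …, v₄` match the crossed cube: the inner cycle
`x₁ x₂ x₃ x₄` forms a kite, the outer cycle is `v₁ v₂ v₃ v₄`, and the four quadrilaterals
`xᵢ xᵢ₊₁ vᵢ₊₁ vᵢ` form kites; and the blocking edges `v₁v₃` and `v₂v₄` are missing. -/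
structure IsCRSite {V : Type u} (G : SimpleGraph V) (x₁ x₂ x₃ x₄ v₁ v₂ v₃ v₄ : V) : Prop where
  nodup : [x₁, x₂, x₃, x₄, v₁, v₂, v₃, v₄].Nodup
  nbr₁ : G.neighborSet x₁ = {x₂, x₃, x₄, v₁, v₂, v₄}
  nbr₂ : G.neighborSet x₂ = {x₁, x₃, x₄, v₂, v₁, v₃}
  nbr₃ : G.neighborSet x₃ = {x₁, x₂, x₄, v₃, v₂, v₄}
  nbr₄ : G.neighborSet x₄ = {x₁, x₂, x₃, v₄, v₁, v₃}
  adj₁₂ : G.Adj v₁ v₂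
  adj₂₃ : G.Adj v₂ v₃
  adj₃₄ : G.Adj v₃ v₄
  adj₄₁ : G.Adj v₄ v₁
  not_adj₁₃ : ¬ G.Adj v₁ v₃
  not_adj₂₄ : ¬ G.Adj v₂ v₄

/-- The result of the crossed cube reduction: the inner cycle is removed and the outer cycle
becomes a kite. -/
def crGraph {V : Type u} (G : SimpleGraph V) (x₁ x₂ x₃ x₄ v₁ v₂ v₃ v₄ : V) :
    SimpleGraph ({x₁, x₂, x₃, x₄}ᶜ : Set V) :=
  (G ⊔ SimpleGraph.fromEdgeSet {s(v₁, v₃), s(v₂, v₄)}).induce {x₁, x₂, x₃, x₄}ᶜ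

/-- `G → G'` by one feasible CR-reduction of the optimal 1-planar graph `G`. -/
def CRReduces {V : Type u} {W : Type v} (G : SimpleGraph V) (G' : SimpleGraph W) : Prop :=
  IsOptimalOnePlanar G ∧ ∃ x₁ x₂ x₃ x₄ v₁ v₂ v₃ v₄ : V, IsCRSite G x₁ x₂ x₃ x₄ v₁ v₂ v₃ v₄ ∧
    Nonempty (G' ≃g crGraph G x₁ x₂ x₃ x₄ v₁ v₂ v₃ v₄)

/-- `G → G'`: one feasible reduction. -/
def Reduces {V : Type u} {W : Type v} (G : SimpleGraph V) (G' : SimpleGraph W) : Prop :=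
  SRReduces G G' ∨ CRReduces G G'

/-- `G →* G'`: the reflexive and transitive closure. -/
inductive ReducesMany {V : Type u} (G : SimpleGraph V) :
    {W : Type u} → SimpleGraph W → Prop
  | refl : ReducesMany G G
  | tail {W W' : Type u} {H : SimpleGraph W} {H' : SimpleGraph W'} :
      ReducesMany G H → Reduces H H' → ReducesMany G H'

/-! Extended wheel graphs. -/

/-- The extended wheel graph `XW_{2k}` (`k ≥ 3`): a cycle with `2k` vertices, edges between the
vertices at distance two on the cycle, and two non-adjacent poles, each joined to every vertex of
the cycle. -/
def extendedWheel (k : ℕ) : SimpleGraph (ZMod (2 * k) ⊕ Bool) where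
  Adj a b :=
    match a, b with
    | .inl i, .inl j => i ≠ j ∧ (j = i + 1 ∨ i = j + 1 ∨ j = i + 2 ∨ i = j + 2)
    | .inl _, .inr _ => True
    | .inr _, .inl _ => True
    | .inr _, .inr _ => False
  symm := ⟨by
    rintro (i | p) (j | q) h
    · exact ⟨h.1.symm, by tauto⟩
    · trivial
    · trivial
    · exact h⟩
  loopless := ⟨by
    rintro (i | p) h
    · exact h.1 rfl
    · exact h⟩

/-- `G` is an `SXW_{2k}`: an optimal 1-planar graph which an SR-reduction turns into `XW_{2k}`. -/
def IsSXW {V : Type u} (k : ℕ) (G : SimpleGraph V) : Prop :=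
  IsOptimalOnePlanar G ∧ SRReduces G (extendedWheel k)

/-- `G` is a `CXW_{2k}`: an optimal 1-planar graph which a CR-reduction turns into `XW_{2k}`. -/
def IsCXW {V : Type u} (k : ℕ) (G : SimpleGraph V) : Prop :=
  IsOptimalOnePlanar G ∧ CRReduces G (extendedWheel k)

/-! Kite drawings. -/

/-- Two corners at the same vertex that are consecutive in the rotation: the planar edge leaving
along `s` is the planar edge entering along `t`. -/
def CornerTurn {V : Type u} {F : Type v} (K : F → ZMod 4 → V) (s t : F × ZMod 4) : Prop :=
  K t.1 t.2 = K s.1 s.2 ∧ K t.1 (t.2 - 1) = K s.1 (s.2 + 1)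

/-- `K` lists the corners of the kites of an optimal 1-planar drawing of `G` in cyclic order:
consecutive corners are joined by uncrossed edges, opposite corners by crossed ones. -/
structure IsKiteDrawing {V : Type u} {F : Type v} (G : SimpleGraph V) (K : F → ZMod 4 → V) :
    Prop where
  adj_iff : ∀ a b, G.Adj a b ↔ ∃ c i, K c i = a ∧ (K c (i + 1) = b ∨ K c (i + 2) = b)
  side_inj : ∀ c i c' j, K c i = K c' j → K c (i + 1) = K c' (j + 1) → c = c' ∧ i = j
  diag_inj : ∀ c i c' j, K c i = K c' j → K c (i + 2) = K c' (j + 2) → c = c' ∧ i = j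
  side_ne_diag : ∀ c i c' j, K c i = K c' j → K c (i + 1) ≠ K c' (j + 2)
  rev : ∀ c i, ∃ c' j, K c' j = K c (i + 1) ∧ K c' (j + 1) = K c i
  cyclic : ∀ s t : F × ZMod 4, K s.1 s.2 = K t.1 t.2 → Relation.EqvGen (CornerTurn K) s t

namespace IsKiteDrawing

variable {V : Type u} {F : Type v} {G : SimpleGraph V} {K : F → ZMod 4 → V}

theorem adj_side (h : IsKiteDrawing G K) (c : F) (i : ZMod 4) : G.Adj (K c i) (K c (i + 1)) :=
  (h.adj_iff _ _).2 ⟨c, i, rfl, Or.inl rfl⟩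

theorem adj_diag (h : IsKiteDrawing G K) (c : F) (i : ZMod 4) : G.Adj (K c i) (K c (i + 2)) :=
  (h.adj_iff _ _).2 ⟨c, i, rfl, Or.inr rfl⟩

theorem adj_of_ne (h : IsKiteDrawing G K) (c : F) {i j : ZMod 4} (hij : i ≠ j) :
    G.Adj (K c i) (K c j) := by
  have : j = i + 1 ∨ j = i + 2 ∨ i = j + 1 := by
    revert i j; decide
  rcases this with rfl | rfl | rfl
  · exact h.adj_side c i
  · exact h.adj_diag c i
  · exact (h.adj_side c j).symm

theorem corner_injective (h : IsKiteDrawing G K) (c : F) : Function.Injective (K c) := by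
  intro i j hij
  by_contra hne
  exact (h.adj_of_ne c hne).ne hij

theorem prev_inj (h : IsKiteDrawing G K) {c c' : F} {i j : ZMod 4} (h₁ : K c i = K c' j)
    (h₂ : K c (i - 1) = K c' (j - 1)) : c = c' ∧ i = j := by
  obtain ⟨a, b⟩ := h.side_inj c (i - 1) c' (j - 1) h₂ (by simpa using h₁)
  exact ⟨a, by simpa using b⟩

theorem exists_turn (h : IsKiteDrawing G K) (s : F × ZMod 4) : ∃ t, CornerTurn K s t := by
  obtain ⟨c', j, h₁, h₂⟩ := h.rev s.1 s.2
  exact ⟨(c', j + 1), h₂, by simpa using h₁⟩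

theorem exists_turn_to (h : IsKiteDrawing G K) (t : F × ZMod 4) : ∃ s, CornerTurn K s t := by
  obtain ⟨c', j, h₁, h₂⟩ := h.rev t.1 (t.2 - 1)
  refine ⟨(c', j), ?_, h₂.symm⟩
  simpa using h₁.symm

theorem turn_right_unique (h : IsKiteDrawing G K) {s t t' : F × ZMod 4} (h₁ : CornerTurn K s t)
    (h₂ : CornerTurn K s t') : t = t' := by
  obtain ⟨a, b⟩ := h.prev_inj (h₁.1.trans h₂.1.symm) (h₁.2.trans h₂.2.symm)
  exact Prod.ext a b

theorem turn_left_unique (h : IsKiteDrawing G K) {s s' t : F × ZMod 4} (h₁ : CornerTurn K s t)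
    (h₂ : CornerTurn K s' t) : s = s' := by
  obtain ⟨a, b⟩ := h.side_inj _ _ _ _ (h₁.1.symm.trans h₂.1) (h₁.2.symm.trans h₂.2)
  exact Prod.ext a b

/-- The rotation of the corners around the vertices. -/
noncomputable def turn (h : IsKiteDrawing G K) : Equiv.Perm (F × ZMod 4) where
  toFun s := (h.exists_turn s).choose
  invFun t := (h.exists_turn_to t).choose
  left_inv s := h.turn_left_unique (h.exists_turn_to _).choose_spec (h.exists_turn s).choose_spec
  right_inv t := h.turn_right_unique (h.exists_turn _).choose_spec (h.exists_turn_to t).choose_spec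

theorem turn_spec (h : IsKiteDrawing G K) (s : F × ZMod 4) : CornerTurn K s (h.turn s) :=
  (h.exists_turn s).choose_spec

theorem turn_eq_iff (h : IsKiteDrawing G K) {s t : F × ZMod 4} :
    h.turn s = t ↔ CornerTurn K s t :=
  ⟨fun e => e ▸ h.turn_spec s, fun e => h.turn_right_unique (h.turn_spec s) e⟩

theorem sameCycle_turn (h : IsKiteDrawing G K) {s t : F × ZMod 4} (hst : K s.1 s.2 = K t.1 t.2) :
    h.turn.SameCycle s t := by
  have := h.cyclic s t hst
  clear hst
  induction this with
  | rel x y hxy =>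
    rw [← h.turn_eq_iff.2 hxy]
    exact Equiv.Perm.sameCycle_apply_right.2 (Equiv.Perm.SameCycle.refl _ _)
  | refl x => exact Equiv.Perm.SameCycle.refl _ _
  | symm x y _ ih => exact ih.symm
  | trans x y z _ _ ih₁ ih₂ => exact ih₁.trans ih₂

/-- The ends of an uncrossed edge have four common neighbours. -/
theorem exists_common_neighbors (h : IsKiteDrawing G K) (c : F) (i : ZMod 4) :
    ∃ l : List V, l.Nodup ∧ l.length = 4 ∧
      ∀ z ∈ l, G.Adj (K c i) z ∧ G.Adj (K c (i + 1)) z := by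
  obtain ⟨c', j, h₁, h₂⟩ := h.rev c i
  have d₁ : ∀ i : ZMod 4, i + 1 + 1 = i + 2 := by decide
  have d₂ : ∀ i : ZMod 4, i + 1 + 2 = i + 3 := by decide
  have d₃ : ∀ i : ZMod 4, i + 2 ≠ i + 3 ∧ i ≠ i + 1 + 1 ∧ i + 1 = i + 3 + 2 := by decide
  have d₅ : ∀ i : ZMod 4, i + 3 + 1 = i := by decide
  -- These are the remaining corners of the two kites along the edge. If two of them coincided, some
  -- edge would be both a side and a diagonal, or a diagonal of two kites.
  refine ⟨[K c (i + 2), K c (i + 3), K c' (j + 2), K c' (j + 3)], ?_, rfl, ?_⟩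
  · have n₁ : K c (i + 2) ≠ K c (i + 3) := (h.adj_of_ne c (d₃ i).1).ne
    have n₂ : K c' (j + 2) ≠ K c' (j + 3) := (h.adj_of_ne c' (d₃ j).1).ne
    have n₃ : K c (i + 2) ≠ K c' (j + 2) := by
      intro e
      refine h.side_ne_diag c' (j + 1) c i h₂ ?_
      rw [e, d₁]
    have n₄ : K c (i + 2) ≠ K c' (j + 3) := by
      intro e
      obtain ⟨rfl, rfl⟩ := h.diag_inj c i c' (j + 1) h₂.symm (by rw [e, d₂])
      exact (h.adj_of_ne c (d₃ j).2.1).ne h₁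
    have n₅ : K c (i + 3) ≠ K c' (j + 2) := by
      intro e
      obtain ⟨rfl, rfl⟩ := h.diag_inj c' j c (i + 1) h₁ (by rw [← e, d₂])
      exact (h.adj_of_ne _ (d₃ i).2.1).ne h₂.symm
    have n₆ : K c (i + 3) ≠ K c' (j + 3) := by
      intro e
      refine h.side_ne_diag c (i + 3) c' (j + 3) e ?_
      rw [d₅, ← h₂, ← (d₃ j).2.2]
    simp [n₁, n₂, n₃, n₄, n₅, n₆]
  · have a : ∀ i : ZMod 4, i ≠ i + 2 ∧ i ≠ i + 3 ∧ i + 1 ≠ i + 2 ∧ i + 1 ≠ i + 3 := by decide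
    intro z hz
    simp only [List.mem_cons, List.not_mem_nil, or_false] at hz
    rcases hz with rfl | rfl | rfl | rfl
    · exact ⟨h.adj_of_ne c (a i).1, h.adj_of_ne c (a i).2.2.1⟩
    · exact ⟨h.adj_of_ne c (a i).2.1, h.adj_of_ne c (a i).2.2.2⟩
    · rw [← h₁, ← h₂]
      exact ⟨h.adj_of_ne c' (a j).2.2.1, h.adj_of_ne c' (a j).1⟩
    · rw [← h₁, ← h₂]
      exact ⟨h.adj_of_ne c' (a j).2.2.2, h.adj_of_ne c' (a j).2.1⟩

/-- If the common neighbours of two adjacent vertices lie in a set with three elements, then the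
edge between them is crossed. -/
theorem side_ne_of_common_subset (h : IsKiteDrawing G K) {a b : V} {l : List V}
    (hl : l.length ≤ 3) (hab : ∀ z, G.Adj a z → G.Adj b z → z ∈ l) (c : F) (i : ZMod 4)
    (hc : K c i = a) : K c (i + 1) ≠ b := by
  classical
  rintro rfl
  subst hc
  obtain ⟨m, hm, hlen, hz⟩ := h.exists_common_neighbors c i
  have : m.Subperm l := hm.subperm (fun z hz' => hab z (hz z hz').1 (hz z hz').2)
  have := this.length_le
  omega

/-- A vertex, all of whose uncrossed edges lead to vertices in `l`, has degree at most twice the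
length of `l`. -/
theorem neighbors_length_le (h : IsKiteDrawing G K) {a : V} {l N : List V} (hN : N.Nodup)
    (hadj : ∀ z ∈ N, G.Adj a z) (hl : ∀ c i, K c i = a → K c (i + 1) ∈ l) :
    N.length ≤ 2 * l.length := by
  classical
  -- each planar neighbour determines the kite, hence its diagonal neighbour
  have key : ∀ w : V, ∃ w' : V, ∀ c i, K c i = a → K c (i + 1) = w → K c (i + 2) = w' := by
    intro w
    by_cases hw : ∃ c i, K c i = a ∧ K c (i + 1) = w
    · obtain ⟨c, i, h₁, h₂⟩ := hw
      refine ⟨K c (i + 2), fun c' j h₁' h₂' => ?_⟩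
      obtain ⟨rfl, rfl⟩ := h.side_inj c' j c i (h₁'.trans h₁.symm) (h₂'.trans h₂.symm)
      rfl
    · exact ⟨w, fun c i h₁ h₂ => absurd ⟨c, i, h₁, h₂⟩ hw⟩
  choose f hf using key
  have : N.Subperm (l ++ l.map f) := by
    refine hN.subperm fun z hz => ?_
    obtain ⟨c, i, h₁, h₂ | h₂⟩ := (h.adj_iff _ _).1 (hadj z hz)
    · exact List.mem_append_left _ (h₂ ▸ hl c i h₁)
    · refine List.mem_append_right _ (List.mem_map.2 ⟨_, hl c i h₁, ?_⟩)
      rw [← h₂, hf _ c i h₁ rfl]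
  have := this.length_le
  simp at this
  omega

/-- A kite drawing can be transported along an isomorphism and a renumbering of the kites. -/
theorem congr (h : IsKiteDrawing G K) {W : Type*} {F' : Type*} {G' : SimpleGraph W}
    (φ : G ≃g G') (e : F' ≃ F) : IsKiteDrawing G' (fun c i => φ (K (e c) i)) where
  adj_iff a b := by
    rw [← φ.symm.map_adj_iff, h.adj_iff]
    constructor
    · rintro ⟨c, i, h₁, h₂⟩
      refine ⟨e.symm c, i, by simp [h₁], ?_⟩
      rcases h₂ with h₂ | h₂
      · exact Or.inl (by simp [h₂])
      · exact Or.inr (by simp [h₂])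
    · rintro ⟨c, i, rfl, h₂⟩
      refine ⟨e c, i, by simp, ?_⟩
      rcases h₂ with rfl | rfl
      · exact Or.inl (by simp)
      · exact Or.inr (by simp)
  side_inj c i c' j h₁ h₂ := by
    obtain ⟨a, b⟩ := h.side_inj _ _ _ _ (φ.injective h₁) (φ.injective h₂)
    exact ⟨e.injective a, b⟩
  diag_inj c i c' j h₁ h₂ := by
    obtain ⟨a, b⟩ := h.diag_inj _ _ _ _ (φ.injective h₁) (φ.injective h₂)
    exact ⟨e.injective a, b⟩
  side_ne_diag c i c' j h₁ h₂ := h.side_ne_diag _ _ _ _ (φ.injective h₁) (φ.injective h₂)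
  rev c i := by
    obtain ⟨c', j, h₁, h₂⟩ := h.rev (e c) i
    exact ⟨e.symm c', j, by simp [h₁], by simp [h₂]⟩
  cyclic s t hst := by
    have key : ∀ x y, Relation.EqvGen (CornerTurn K) x y →
        Relation.EqvGen (CornerTurn fun c i => φ (K (e c) i)) (e.symm x.1, x.2) (e.symm y.1, y.2) := by
      intro x y hxy
      induction hxy with
      | rel x y hxy =>
        exact .rel _ _ ⟨by simpa using congrArg φ hxy.1, by simpa using congrArg φ hxy.2⟩
      | refl x => exact .refl _
      | symm x y _ ih => exact .symm _ _ ih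
      | trans x y z _ _ ih₁ ih₂ => exact .trans _ _ _ ih₁ ih₂
    simpa using key _ _ (h.cyclic (e s.1, s.2) (e t.1, t.2) (φ.injective hst))

end IsKiteDrawing

/-- `G` is a finite connected graph with at least three vertices and a kite drawing whose number of kites is
the one given by Euler's formula. -/
def HasKiteDrawing {V : Type u} (G : SimpleGraph V) : Prop :=
  Finite V ∧ G.Connected ∧ ∃ (m : ℕ) (K : Fin m → ZMod 4 → V),
    IsKiteDrawing G K ∧ Nat.card V = m + 2 ∧ 1 ≤ m

theorem HasKiteDrawing.congr {V : Type u} {W : Type v} {G : SimpleGraph V} {G' : SimpleGraph W}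
    (h : HasKiteDrawing G) (φ : G ≃g G') : HasKiteDrawing G' := by
  obtain ⟨hV, hc, m, K, hK, hm, h1⟩ := h
  exact ⟨Finite.of_equiv V φ.toEquiv, (φ.connected_iff).1 hc, m, _,
    hK.congr φ (Equiv.refl _), (Nat.card_congr φ.toEquiv).symm.trans hm, h1⟩

/-! From kite drawings to optimal 1-planar graphs. -/

theorem Equiv.Perm.SameCycle.eq_of_invariant {α : Type*} {β : Type*} {f : Equiv.Perm α} {g : α → β}
    (hg : ∀ x, g (f x) = g x) {x y : α} (h : f.SameCycle x y) : g x = g y := by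
  have hn : ∀ (n : ℕ) x, g ((f ^ n) x) = g x := by
    intro n
    induction n with
    | zero => intro x; rfl
    | succ n ih => intro x; rw [pow_succ', Equiv.Perm.mul_apply, hg, ih]
  obtain ⟨n, rfl⟩ := h
  obtain ⟨n, rfl | rfl⟩ := n.eq_nat_or_neg
  · rw [zpow_natCast, hn]
  · rw [← hn n ((f ^ (-(n : ℤ))) x), zpow_neg, zpow_natCast, ← Equiv.Perm.mul_apply, mul_inv_cancel,
      Equiv.Perm.one_apply]

theorem Equiv.Perm.SameCycle.permCongr {α : Type*} {β : Type*} (e : α ≃ β) {f : Equiv.Perm α} {x y : α}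
    (h : f.SameCycle x y) : (e.permCongr f).SameCycle (e x) (e y) := by
  obtain ⟨n, rfl⟩ := h
  refine ⟨n, ?_⟩
  have := map_zpow (Equiv.permCongrHom e) f n
  change e.permCongr (f ^ n) = (e.permCongr f) ^ n at this
  rw [← this]
  simp [Equiv.permCongr_apply]

theorem Equiv.Perm.sameCycle_apply_self {α : Type*} (f : Equiv.Perm α) (x : α) : f.SameCycle x (f x) :=
  Equiv.Perm.sameCycle_apply_right.2 (Equiv.Perm.SameCycle.refl _ _)

namespace IsKiteDrawing

variable {V : Type u} {m : ℕ} {G : SimpleGraph V} {K : Fin m → ZMod 4 → V}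

/-- The index of the first corner of a diagonal. -/
def diagStart (b : Bool) : ZMod 4 := if b then 0 else 1

/-- The two diagonals of every kite cross. -/
def crossingSystem (h : IsKiteDrawing G K) : CrossingSystem G (Fin m) where
  edge c b := s(K c (diagStart b), K c (diagStart b + 2))
  edge_mem c b := h.adj_diag c _
  edge_inj c b c' b' e := by
    have d : ∀ b b', diagStart b = diagStart b' → b = b' := by decide
    have d₁ : ∀ b b', diagStart b ≠ diagStart b' + 2 := by decide
    have d₂ : ∀ b, diagStart b + 2 + 2 = diagStart b := by decide
    rcases Sym2.eq_iff.1 e with ⟨h₁, h₂⟩ | ⟨h₁, h₂⟩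
    · obtain ⟨rfl, hb⟩ := h.diag_inj _ _ _ _ h₁ h₂
      exact ⟨rfl, d _ _ hb⟩
    · obtain ⟨rfl, hb⟩ := h.diag_inj c (diagStart b) c' (diagStart b' + 2) h₁ (by rw [h₂, d₂])
      exact absurd hb (d₁ _ _)
  disjoint c w h₁ h₂ := by
    simp only [diagStart, Sym2.mem_iff, if_true, Bool.false_eq_true, if_false] at h₁ h₂
    rcases h₁ with rfl | rfl <;> rcases h₂ with h₂ | h₂ <;>
      exact absurd (h.corner_injective c h₂) (by decide)

theorem mem_edge_iff (h : IsKiteDrawing G K) (c : Fin m) (s : V) :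
    (∃ b, s ∈ h.crossingSystem.edge c b) ↔ ∃ i, K c i = s := by
  constructor
  · rintro ⟨b, hb⟩
    rcases Sym2.mem_iff.1 hb with rfl | rfl
    · exact ⟨_, rfl⟩
    · exact ⟨_, rfl⟩
  · rintro ⟨i, rfl⟩
    have : ∃ b, i = diagStart b ∨ i = diagStart b + 2 := by revert i; decide
    obtain ⟨b, rfl | rfl⟩ := this
    · exact ⟨b, Sym2.mem_mk_left _ _⟩
    · exact ⟨b, Sym2.mem_mk_right _ _⟩

theorem edge_eq_diag (h : IsKiteDrawing G K) (c : Fin m) (i : ZMod 4) :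
    ∃ b, h.crossingSystem.edge c b = s(K c i, K c (i + 2)) := by
  have : ∃ b, i = diagStart b ∨ i = diagStart b + 2 := by revert i; decide
  have d₂ : ∀ b, diagStart b + 2 + 2 = diagStart b := by decide
  obtain ⟨b, rfl | rfl⟩ := this
  · exact ⟨b, rfl⟩
  · exact ⟨b, by rw [d₂, Sym2.eq_swap]; rfl⟩

theorem planarization_adj_iff (h : IsKiteDrawing G K) (s t : V) :
    h.crossingSystem.planarization.Adj (.inl s) (.inl t) ↔ ∃ c i, K c i = s ∧ K c (i + 1) = t := by
  constructor
  · rintro ⟨h₁, h₂⟩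
    obtain ⟨c, i, rfl, rfl | rfl⟩ := (h.adj_iff _ _).1 h₁
    · exact ⟨c, i, rfl, rfl⟩
    · obtain ⟨b, hb⟩ := h.edge_eq_diag c i
      exact absurd hb (h₂ c b)
  · rintro ⟨c, i, rfl, rfl⟩
    refine ⟨h.adj_side c i, fun c' b e => ?_⟩
    rcases Sym2.eq_iff.1 e with ⟨h₁, h₂⟩ | ⟨h₁, h₂⟩
    · exact h.side_ne_diag _ _ _ _ h₁.symm h₂.symm
    · have d₂ : ∀ b, diagStart b + 2 + 2 = diagStart b := by decide
      exact h.side_ne_diag c i c' (diagStart b + 2) h₂.symm (by rw [← h₁, d₂])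

/-- The dart from a corner to the crossing point. -/
def inDart (h : IsKiteDrawing G K) (s : Fin m × ZMod 4) : h.crossingSystem.planarization.Dart :=
  ⟨(.inl (K s.1 s.2), .inr s.1), (h.mem_edge_iff _ _).2 ⟨_, rfl⟩⟩

/-- The dart from the crossing point to a corner. -/
def outDart (h : IsKiteDrawing G K) (s : Fin m × ZMod 4) : h.crossingSystem.planarization.Dart :=
  ⟨(.inr s.1, .inl (K s.1 s.2)), (h.mem_edge_iff _ _).2 ⟨_, rfl⟩⟩

/-- The dart along a side of a kite. -/
def sideDart (h : IsKiteDrawing G K) (s : Fin m × ZMod 4) : h.crossingSystem.planarization.Dart :=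
  ⟨(.inl (K s.1 s.2), .inl (K s.1 (s.2 + 1))), (h.planarization_adj_iff _ _).2 ⟨_, _, rfl, rfl⟩⟩

/-- Every dart of the planarization is of one of three kinds. -/
noncomputable def dartEquiv (h : IsKiteDrawing G K) :
    (Fin m × ZMod 4) ⊕ (Fin m × ZMod 4) ⊕ (Fin m × ZMod 4) ≃ h.crossingSystem.planarization.Dart :=
  Equiv.ofBijective (Sum.elim h.inDart (Sum.elim h.outDart h.sideDart)) (by
    constructor
    · rintro (⟨c, i⟩ | ⟨c, i⟩ | ⟨c, i⟩) (⟨c', j⟩ | ⟨c', j⟩ | ⟨c', j⟩) e <;>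
        have e₁ := congrArg (fun d => d.fst) e <;> have e₂ := congrArg (fun d => d.snd) e <;>
        simp [inDart, outDart, sideDart] at e₁ e₂ ⊢
      · subst e₂; exact ⟨rfl, h.corner_injective c e₁⟩
      · subst e₁; exact ⟨rfl, h.corner_injective c e₂⟩
      · exact h.side_inj _ _ _ _ e₁ e₂
    · rintro ⟨⟨s | c, t | c'⟩, hd⟩
      · obtain ⟨c, i, rfl, rfl⟩ := (h.planarization_adj_iff _ _).1 hd
        exact ⟨.inr (.inr (c, i)), rfl⟩
      · obtain ⟨i, rfl⟩ := (h.mem_edge_iff _ _).1 hd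
        exact ⟨.inl (c', i), rfl⟩
      · obtain ⟨i, rfl⟩ := (h.mem_edge_iff _ _).1 hd
        exact ⟨.inr (.inl (c, i)), rfl⟩
      · exact hd.elim)

/-- The rotation on the index set of the darts. -/
noncomputable def indexRotation (h : IsKiteDrawing G K) :
    Equiv.Perm ((Fin m × ZMod 4) ⊕ (Fin m × ZMod 4) ⊕ (Fin m × ZMod 4)) where
  -- Around a vertex, the dart into a kite is followed by the side that leaves the same corner, and
  -- this by the dart into the next kite. Around a crossing point the corners are met in decreasing
  -- order.
  toFun
    | .inl s => .inr (.inr s)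
    | .inr (.inl s) => .inr (.inl (s.1, s.2 - 1))
    | .inr (.inr s) => .inl (h.turn s)
  invFun
    | .inl s => .inr (.inr (h.turn.symm s))
    | .inr (.inl s) => .inr (.inl (s.1, s.2 + 1))
    | .inr (.inr s) => .inl s
  left_inv := by rintro (s | s | s) <;> simp
  right_inv := by rintro (s | s | s) <;> simp

theorem indexRotation_sameCycle_in (h : IsKiteDrawing G K) {s t : Fin m × ZMod 4}
    (hst : K s.1 s.2 = K t.1 t.2) : h.indexRotation.SameCycle (.inl s) (.inl t) := by
  obtain ⟨n, rfl⟩ := (h.sameCycle_turn hst).exists_nat_pow_eq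
  clear hst
  induction n with
  | zero => exact .refl _ _
  | succ n ih =>
    refine ih.trans ?_
    rw [pow_succ']
    exact (Equiv.Perm.sameCycle_apply_self _ _).trans (Equiv.Perm.sameCycle_apply_self _ _)

theorem indexRotation_sameCycle_out (h : IsKiteDrawing G K) (c : Fin m) (i j : ZMod 4) :
    h.indexRotation.SameCycle (.inr (.inl (c, i))) (.inr (.inl (c, j))) := by
  have step : ∀ i, h.indexRotation.SameCycle (.inr (.inl (c, i))) (.inr (.inl (c, i - 1))) :=
    fun i => Equiv.Perm.sameCycle_apply_self h.indexRotation (.inr (.inl (c, i)))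
  have : j = i ∨ j = i - 1 ∨ j = i - 1 - 1 ∨ j = i - 1 - 1 - 1 := by revert i j; decide
  rcases this with rfl | rfl | rfl | rfl
  · exact .refl _ _
  · exact step _
  · exact (step _).trans (step _)
  · exact ((step _).trans (step _)).trans (step _)

/-- The rotation system of a kite drawing. -/
noncomputable def rotationSystem (h : IsKiteDrawing G K) :
    RotationSystem h.crossingSystem.planarization where
  next := h.dartEquiv.permCongr h.indexRotation
  next_fst d := by
    obtain ⟨x, rfl⟩ := h.dartEquiv.surjective d
    rw [Equiv.permCongr_apply, Equiv.symm_apply_apply]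
    rcases x with s | s | s
    · rfl
    · rfl
    · exact congrArg Sum.inl (h.turn_spec s).1
  cyclic d e hde := by
    obtain ⟨x, rfl⟩ := h.dartEquiv.surjective d
    obtain ⟨y, rfl⟩ := h.dartEquiv.surjective e
    refine Equiv.Perm.SameCycle.permCongr _ ?_
    have side : ∀ s, h.indexRotation.SameCycle (.inl s) (.inr (.inr s)) := fun s =>
      Equiv.Perm.sameCycle_apply_self h.indexRotation (.inl s)
    rcases x with s | s | s <;> rcases y with t | t | t
    · exact h.indexRotation_sameCycle_in (Sum.inl_injective hde)
    · exact absurd hde Sum.inl_ne_inr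
    · exact (h.indexRotation_sameCycle_in (Sum.inl_injective hde)).trans (side t)
    · exact absurd hde Sum.inr_ne_inl
    · obtain ⟨c, i⟩ := s
      obtain ⟨c', j⟩ := t
      obtain rfl : c = c' := Sum.inr_injective hde
      exact h.indexRotation_sameCycle_out _ _ _
    · exact absurd hde Sum.inr_ne_inl
    · exact (side s).symm.trans (h.indexRotation_sameCycle_in (Sum.inl_injective hde))
    · exact absurd hde Sum.inl_ne_inr
    · exact (side s).symm.trans ((h.indexRotation_sameCycle_in (Sum.inl_injective hde)).trans (side t))

theorem next_inDart (h : IsKiteDrawing G K) (s) :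
    h.rotationSystem.next (h.inDart s) = h.sideDart s := by
  change h.dartEquiv (h.indexRotation (h.dartEquiv.symm (h.dartEquiv (.inl s)))) = _
  rw [Equiv.symm_apply_apply]; rfl

theorem next_outDart (h : IsKiteDrawing G K) (s) :
    h.rotationSystem.next (h.outDart s) = h.outDart (s.1, s.2 - 1) := by
  change h.dartEquiv (h.indexRotation (h.dartEquiv.symm (h.dartEquiv (.inr (.inl s))))) = _
  rw [Equiv.symm_apply_apply]; rfl

theorem next_sideDart (h : IsKiteDrawing G K) (s) :
    h.rotationSystem.next (h.sideDart s) = h.inDart (h.turn s) := by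
  change h.dartEquiv (h.indexRotation (h.dartEquiv.symm (h.dartEquiv (.inr (.inr s))))) = _
  rw [Equiv.symm_apply_apply]; rfl

/-- Every face is the triangle spanned by a crossing point and one side of its kite. This lemma and
the next two give its three steps: in at corner `i + 1`, out at corner `i`, along the side back to
corner `i + 1`. -/
theorem facePerm_inDart (h : IsKiteDrawing G K) (s) :
    h.rotationSystem.facePerm (h.inDart s) = h.outDart (s.1, s.2 - 1) :=
  h.next_outDart s

theorem facePerm_outDart (h : IsKiteDrawing G K) (s) :
    h.rotationSystem.facePerm (h.outDart s) = h.sideDart s :=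
  h.next_inDart s

theorem facePerm_sideDart (h : IsKiteDrawing G K) (s) :
    h.rotationSystem.facePerm (h.sideDart s) = h.inDart (s.1, s.2 + 1) := by
  -- The side leaving the corner before `(s.1, s.2 + 1)` in the rotation is the side `s` traversed
  -- backwards.
  set t := h.turn.symm (s.1, s.2 + 1) with ht
  have hts : h.turn t = (s.1, s.2 + 1) := by simp [ht]
  have e : (h.sideDart s).symm = h.sideDart t := by
    have hsp := h.turn_spec t
    rw [hts] at hsp
    obtain ⟨h₁, h₂⟩ := hsp
    simp only [add_sub_cancel_right] at h₁ h₂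
    apply SimpleGraph.Dart.ext
    exact Prod.ext (congrArg Sum.inl h₁) (congrArg Sum.inl h₂)
  change h.rotationSystem.next (h.sideDart s).symm = _
  rw [e, next_sideDart, hts]

theorem alternates (h : IsKiteDrawing G K) : h.crossingSystem.Alternates h.rotationSystem := by
  intro c d hd
  obtain ⟨x, rfl⟩ := h.dartEquiv.surjective d
  rcases x with s | s | s
  · exact absurd hd Sum.inl_ne_inr
  · obtain ⟨c', i⟩ := s
    obtain rfl : c' = c := Sum.inr_injective hd
    obtain ⟨b, hb⟩ := h.edge_eq_diag c' i
    refine ⟨b, _, _, hb, rfl, ?_⟩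
    change (h.rotationSystem.next (h.rotationSystem.next (h.outDart (c', i)))).snd = _
    rw [next_outDart, next_outDart]
    have : ∀ i : ZMod 4, i - 1 - 1 = i + 2 := by decide
    change Sum.inl (K c' (i - 1 - 1)) = _
    rw [this]
  · exact absurd hd Sum.inl_ne_inr

/-- The faces of the planarization correspond to the sides of the kites. -/
theorem card_faces (h : IsKiteDrawing G K) :
    Nat.card (Quotient (Equiv.Perm.SameCycle.setoid h.rotationSystem.facePerm)) = 4 * m := by
  -- Each triangle contains exactly one dart into a crossing point, and `g` names it. The shift by
  -- one reflects that the dart in at corner `i + 1` shares its face with the dart out and the side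
  -- at corner `i`.
  let g : (Fin m × ZMod 4) ⊕ (Fin m × ZMod 4) ⊕ (Fin m × ZMod 4) → Fin m × ZMod 4 :=
    Sum.elim id (Sum.elim (fun s => (s.1, s.2 + 1)) (fun s => (s.1, s.2 + 1)))
  have hg : ∀ d, g (h.dartEquiv.symm (h.rotationSystem.facePerm d)) = g (h.dartEquiv.symm d) := by
    intro d
    obtain ⟨x, rfl⟩ := h.dartEquiv.surjective d
    rcases x with s | s | s
    · have := h.facePerm_inDart s
      change h.rotationSystem.facePerm (h.dartEquiv (.inl s)) =
        h.dartEquiv (.inr (.inl (s.1, s.2 - 1))) at this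
      rw [this, Equiv.symm_apply_apply, Equiv.symm_apply_apply]
      simp [g]
    · have := h.facePerm_outDart s
      change h.rotationSystem.facePerm (h.dartEquiv (.inr (.inl s))) =
        h.dartEquiv (.inr (.inr s)) at this
      rw [this, Equiv.symm_apply_apply, Equiv.symm_apply_apply]
      simp [g]
    · have := h.facePerm_sideDart s
      change h.rotationSystem.facePerm (h.dartEquiv (.inr (.inr s))) =
        h.dartEquiv (.inl (s.1, s.2 + 1)) at this
      rw [this, Equiv.symm_apply_apply, Equiv.symm_apply_apply]
      simp [g]
  let q : Fin m × ZMod 4 → Quotient (Equiv.Perm.SameCycle.setoid h.rotationSystem.facePerm) :=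
    fun s => Quotient.mk _ (h.inDart s)
  have hq : Function.Bijective q := by
    constructor
    · intro s t hst
      have := Equiv.Perm.SameCycle.eq_of_invariant (g := fun d => g (h.dartEquiv.symm d)) hg
        (Quotient.exact hst)
      change g (h.dartEquiv.symm (h.dartEquiv (.inl s))) =
        g (h.dartEquiv.symm (h.dartEquiv (.inl t))) at this
      rwa [Equiv.symm_apply_apply, Equiv.symm_apply_apply] at this
    · intro x
      induction x using Quotient.inductionOn with | _ d =>
      obtain ⟨x, rfl⟩ := h.dartEquiv.surjective d
      have o : ∀ s : Fin m × ZMod 4, h.rotationSystem.facePerm.SameCycle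
          (h.inDart (s.1, s.2 + 1)) (h.outDart s) := by
        intro s
        have := Equiv.Perm.sameCycle_apply_self h.rotationSystem.facePerm (h.inDart (s.1, s.2 + 1))
        rwa [facePerm_inDart, add_sub_cancel_right] at this
      rcases x with s | s | s
      · exact ⟨s, rfl⟩
      · exact ⟨(s.1, s.2 + 1), Quotient.sound (o s)⟩
      · refine ⟨(s.1, s.2 + 1), Quotient.sound ((o s).trans ?_)⟩
        have := Equiv.Perm.sameCycle_apply_self h.rotationSystem.facePerm (h.outDart s)
        rwa [facePerm_outDart] at this
  rw [← Nat.card_congr (Equiv.ofBijective q hq)]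
  simp [mul_comm]

theorem two_mul_card_edgeSet {W : Type*} [Finite W] (H : SimpleGraph W) :
    2 * Nat.card H.edgeSet = Nat.card H.Dart := by
  classical
  have := Fintype.ofFinite W
  rw [Nat.card_eq_fintype_card, Nat.card_eq_fintype_card, H.dart_card_eq_twice_card_edges,
    SimpleGraph.edgeFinset_card]

theorem card_planarization_edgeSet [Finite V] (h : IsKiteDrawing G K) :
    Nat.card h.crossingSystem.planarization.edgeSet = 6 * m := by
  have e := two_mul_card_edgeSet h.crossingSystem.planarization
  rw [← Nat.card_congr h.dartEquiv, Nat.card_sum, Nat.card_sum, Nat.card_prod, Nat.card_zmod,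
    Nat.card_fin] at e
  omega

/-- The darts of `G` are the sides and diagonals of the kites. -/
noncomputable def graphDartEquiv (h : IsKiteDrawing G K) :
    (Fin m × ZMod 4) ⊕ (Fin m × ZMod 4) ≃ G.Dart :=
  Equiv.ofBijective (Sum.elim (fun s => ⟨(K s.1 s.2, K s.1 (s.2 + 1)), h.adj_side _ _⟩)
      (fun s => ⟨(K s.1 s.2, K s.1 (s.2 + 2)), h.adj_diag _ _⟩)) (by
    constructor
    · rintro (⟨c, i⟩ | ⟨c, i⟩) (⟨c', j⟩ | ⟨c', j⟩) e <;>
        have e₁ := congrArg (fun d => d.fst) e <;> have e₂ := congrArg (fun d => d.snd) e <;>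
        simp at e₁ e₂ ⊢
      · exact h.side_inj _ _ _ _ e₁ e₂
      · exact h.side_ne_diag _ _ _ _ e₁ e₂
      · exact h.side_ne_diag _ _ _ _ e₁.symm e₂.symm
      · exact h.diag_inj _ _ _ _ e₁ e₂
    · rintro ⟨⟨s, t⟩, hd⟩
      obtain ⟨c, i, rfl, rfl | rfl⟩ := (h.adj_iff _ _).1 hd
      · exact ⟨.inl (c, i), rfl⟩
      · exact ⟨.inr (c, i), rfl⟩)

theorem card_edgeSet [Finite V] (h : IsKiteDrawing G K) : Nat.card G.edgeSet = 4 * m := by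
  have e := two_mul_card_edgeSet G
  rw [← Nat.card_congr h.graphDartEquiv, Nat.card_sum, Nat.card_prod, Nat.card_zmod,
    Nat.card_fin] at e
  omega

theorem planarization_connected (h : IsKiteDrawing G K) (hG : G.Connected) :
    h.crossingSystem.planarization.Connected := by
  have hout : ∀ c i, h.crossingSystem.planarization.Adj (.inr c) (.inl (K c i)) := fun c i =>
    (h.outDart (c, i)).adj
  have hadj : ∀ a b, G.Adj a b →
      h.crossingSystem.planarization.Reachable (.inl a) (.inl b) := by
    intro a b hab
    obtain ⟨c, i, rfl, rfl | rfl⟩ := (h.adj_iff _ _).1 hab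
    · exact (hout c i).symm.reachable.trans (hout c _).reachable
    · exact (hout c i).symm.reachable.trans (hout c _).reachable
  have hreal : ∀ a b, h.crossingSystem.planarization.Reachable (.inl a) (.inl b) := by
    intro a b
    obtain ⟨w⟩ := hG.preconnected a b
    induction w with
    | nil => exact .refl _
    | cons hab _ ih => exact (hadj _ _ hab).trans ih
  have hpre : h.crossingSystem.planarization.Preconnected := by
    have : ∀ x, ∃ a, h.crossingSystem.planarization.Reachable x (.inl a) := by
      rintro (a | c)
      · exact ⟨a, .refl _⟩
      · exact ⟨_, (hout c 0).reachable⟩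
    intro x y
    obtain ⟨a, ha⟩ := this x
    obtain ⟨b, hb⟩ := this y
    exact ha.trans ((hreal a b).trans hb.symm)
  have := hG.nonempty
  exact ⟨hpre⟩

end IsKiteDrawing

/-- The planarization is connected with `(m + 2) + m` vertices, `6 m` edges and `4 m` faces, so its
Euler characteristic is two. The graph itself has `4 m = 4 (m + 2) - 8` edges. -/
theorem HasKiteDrawing.isOptimalOnePlanar {V : Type u} {G : SimpleGraph V}
    (hG : HasKiteDrawing G) : IsOptimalOnePlanar G := by
  obtain ⟨hV, hconn, m, K, h, hm, h1⟩ := hG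
  have hcard := h.card_edgeSet
  refine ⟨⟨hV, m, h.crossingSystem, h.rotationSystem, h.alternates, ?_⟩, by omega, by omega⟩
  have hc := h.planarization_connected hconn
  have hcomp : Nat.card h.crossingSystem.planarization.ConnectedComponent = 1 := by
    have := hc.preconnected.subsingleton_connectedComponent
    obtain ⟨x⟩ := hc.nonempty
    have : Nonempty h.crossingSystem.planarization.ConnectedComponent :=
      ⟨SimpleGraph.connectedComponentMk _ x⟩
    rw [Nat.card_eq_one_iff_unique]
    exact ⟨inferInstance, inferInstance⟩
  have hiso : Nat.card {w : V ⊕ Fin m // ∀ w', ¬ h.crossingSystem.planarization.Adj w w'} = 0 := by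
    rw [Nat.card_eq_zero]
    left
    refine ⟨fun ⟨w, hw⟩ => ?_⟩
    have : Nontrivial (V ⊕ Fin m) := by
      rw [← Finite.one_lt_card_iff_nontrivial, Nat.card_sum]
      simp; omega
    obtain ⟨w', hw'⟩ := hc.preconnected.exists_adj_of_nontrivial w
    exact hw w' hw'
  unfold RotationSystem.IsPlanar RotationSystem.faceCount
  rw [h.card_faces, hcomp, hiso, h.card_planarization_edgeSet, Nat.card_sum, hm]
  simp
  omega

/-! Optimal 1-planar graphs have kite drawings. -/

/-- The number of cycles of a permutation without short cycles, in which of two consecutive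
elements one is marked, and the case of equality. -/
theorem card_cycles_bounds {D : Type*} [Finite D] (f : Equiv.Perm D) (p : D → Prop)
    (h₁ : ∀ d, f d ≠ d) (h₂ : ∀ d, f (f d) ≠ d) (hp : ∀ d, p d ∨ p (f d)) :
    3 * Nat.card (Quotient (Equiv.Perm.SameCycle.setoid f)) ≤ Nat.card D ∧
    2 * Nat.card (Quotient (Equiv.Perm.SameCycle.setoid f)) ≤ Nat.card {d // p d} ∧
    (Nat.card D = 3 * Nat.card (Quotient (Equiv.Perm.SameCycle.setoid f)) →
      Nat.card {d // p d} = 2 * Nat.card (Quotient (Equiv.Perm.SameCycle.setoid f)) →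
      ∀ d, f (f (f d)) = d ∧ ¬ (p d ∧ p (f d) ∧ p (f (f d)))) := by
  classical
  have := Fintype.ofFinite D
  let q : D → Quotient (Equiv.Perm.SameCycle.setoid f) := Quotient.mk _
  let A := fun o => Finset.univ.filter fun d => q d = o
  let B := fun o => (Finset.univ.filter p).filter fun d => q d = o
  have hq : ∀ d, q (f d) = q d := fun d =>
    Quotient.sound (Equiv.Perm.sameCycle_apply_self f d).symm
  have hsub : ∀ d, ({d, f d, f (f d)} : Finset D) ⊆ A (q d) := by
    intro d x hx
    simp only [Finset.mem_insert, Finset.mem_singleton] at hx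
    rcases hx with rfl | rfl | rfl <;> simp [A, hq]
  have hthree : ∀ d, ({d, f d, f (f d)} : Finset D).card = 3 := by
    intro d
    rw [Finset.card_eq_three]
    exact ⟨d, f d, f (f d), (h₁ d).symm, (h₂ d).symm, (h₁ _).symm, rfl⟩
  have hA : ∀ o, 3 ≤ (A o).card := by
    intro o
    induction o using Quotient.inductionOn with | _ d =>
    rw [← hthree d]
    exact Finset.card_le_card (hsub d)
  have hB : ∀ o, 2 ≤ (B o).card := by
    intro o
    induction o using Quotient.inductionOn with | _ d =>
    obtain ⟨d', hd', hpd⟩ : ∃ d', q d' = q d ∧ p d' := by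
      rcases hp d with h | h
      · exact ⟨d, rfl, h⟩
      · exact ⟨f d, hq d, h⟩
    obtain ⟨e, he, hpe, hne⟩ : ∃ e, q e = q d ∧ p e ∧ d' ≠ e := by
      rcases hp (f d') with h | h
      · exact ⟨f d', by rw [hq, hd'], h, (h₁ _).symm⟩
      · exact ⟨f (f d'), by rw [hq, hq, hd'], h, (h₂ _).symm⟩
    rw [← Finset.card_pair hne]
    refine Finset.card_le_card fun x hx => ?_
    simp only [Finset.mem_insert, Finset.mem_singleton] at hx
    rcases hx with rfl | rfl
    · exact Finset.mem_filter.2 ⟨by simpa using hpd, hd'⟩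
    · exact Finset.mem_filter.2 ⟨by simpa using hpe, he⟩
  have sA : Nat.card D = ∑ o, (A o).card := by
    rw [Nat.card_eq_fintype_card]
    exact Finset.card_eq_sum_card_fiberwise (fun _ _ => Finset.mem_coe.2 (Finset.mem_univ _))
  have sB : Nat.card {d // p d} = ∑ o, (B o).card := by
    rw [Nat.card_eq_fintype_card, Fintype.card_subtype]
    exact Finset.card_eq_sum_card_fiberwise (fun _ _ => Finset.mem_coe.2 (Finset.mem_univ _))
  have s3 : ∀ n : ℕ, n * Nat.card (Quotient (Equiv.Perm.SameCycle.setoid f)) =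
      ∑ _o : Quotient (Equiv.Perm.SameCycle.setoid f), n := by
    intro n
    rw [Nat.card_eq_fintype_card, Finset.sum_const, Finset.card_univ, smul_eq_mul, mul_comm]
  rw [sA, sB, s3, s3]
  refine ⟨Finset.sum_le_sum fun o _ => hA o, Finset.sum_le_sum fun o _ => hB o, fun eA eB d => ?_⟩
  -- Equality of the sums forces equality of every summand: each cycle has exactly three elements,
  -- two of them marked.
  have eA' := (Finset.sum_eq_sum_iff_of_le fun o _ => hA o).1 eA.symm (q d) (Finset.mem_univ _)
  have eB' := (Finset.sum_eq_sum_iff_of_le fun o _ => hB o).1 eB.symm (q d) (Finset.mem_univ _)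
  have hfib := Finset.eq_of_subset_of_card_le (hsub d) (by rw [hthree, ← eA'])
  constructor
  · have : f (f (f d)) ∈ ({d, f d, f (f d)} : Finset D) := by
      rw [hfib]; simp [A, hq]
    simp only [Finset.mem_insert, Finset.mem_singleton] at this
    rcases this with h | h | h
    · exact h
    · exact absurd (f.injective h) (h₂ d)
    · exact absurd h (h₁ _)
  · rintro ⟨a, b, c⟩
    have : ({d, f d, f (f d)} : Finset D) ⊆ B (q d) := by
      intro x hx
      simp only [Finset.mem_insert, Finset.mem_singleton] at hx
      rcases hx with rfl | rfl | rfl <;> simp [B, hq, a, b, c]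
    have := Finset.card_le_card this
    rw [hthree, ← eB'] at this
    omega

theorem finite_dart {W : Type*} [Finite W] (H : SimpleGraph W) : Finite H.Dart :=
  Finite.of_injective (fun d : H.Dart => d.toProd) fun _ _ h => SimpleGraph.Dart.ext _ _ h

/-! ### Counting the darts of the planarization. -/

namespace CrossingSystem

variable {V : Type u} {G : SimpleGraph V} {m : ℕ}

theorem index_unique (C : CrossingSystem G (Fin m)) {c : Fin m} {i j : Bool} {s : V}
    (hi : s ∈ C.edge c i) (hj : s ∈ C.edge c j) : i = j := by
  cases i <;> cases j
  · rfl
  · exact absurd hi (C.disjoint c s hj)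
  · exact absurd hj (C.disjoint c s hi)
  · rfl

/-- The vertex of the planarization to which the dart `(v, a)` of `G` leads first. -/
theorem exists_target (C : CrossingSystem G (Fin m)) (d : G.Dart) :
    ∃ w, C.planarization.Adj (.inl d.fst) w ∧
      (w = .inl d.snd ∨ ∃ c i, w = .inr c ∧ C.edge c i = s(d.fst, d.snd)) := by
  by_cases h : ∃ c i, C.edge c i = s(d.fst, d.snd)
  · obtain ⟨c, i, hc⟩ := h
    exact ⟨.inr c, ⟨i, hc ▸ Sym2.mem_mk_left _ _⟩, Or.inr ⟨c, i, rfl, hc⟩⟩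
  · push Not at h
    exact ⟨.inl d.snd, ⟨d.adj, h⟩, Or.inl rfl⟩

/-- The two edges that cross at a point share no endpoint, so at most one of them starts at `v`; the
first point reached from `v` therefore determines the edge. -/
theorem target_inj (C : CrossingSystem G (Fin m)) {v a b : V} {w : V ⊕ Fin m}
    (ha : w = .inl a ∨ ∃ c i, w = .inr c ∧ C.edge c i = s(v, a))
    (hb : w = .inl b ∨ ∃ c i, w = .inr c ∧ C.edge c i = s(v, b)) : a = b := by
  rcases ha with rfl | ⟨c, i, rfl, hc⟩
  · rcases hb with hb | ⟨c, i, hb, -⟩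
    · exact Sum.inl_injective hb
    · exact absurd hb Sum.inl_ne_inr
  · rcases hb with hb | ⟨c', j, hb, hc'⟩
    · exact absurd hb Sum.inr_ne_inl
    · obtain rfl := Sum.inr_injective hb
      obtain rfl := C.index_unique (hc ▸ Sym2.mem_mk_left v a) (hc' ▸ Sym2.mem_mk_left v b)
      exact Sym2.congr_right.1 (hc.symm.trans hc')

/-- Inserting crossing points changes where a dart leaving a vertex first arrives, but neither
merges nor creates darts at that vertex. -/
theorem card_real_darts (C : CrossingSystem G (Fin m)) :
    Nat.card {d : C.planarization.Dart // ∃ v, d.fst = .inl v} = Nat.card G.Dart := by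
  choose w hw hw' using C.exists_target
  refine (Nat.card_congr (Equiv.ofBijective
    (fun d : G.Dart => (⟨⟨(.inl d.fst, w d), hw d⟩, _, rfl⟩ :
      {d : C.planarization.Dart // ∃ v, d.fst = .inl v})) ⟨?_, ?_⟩)).symm
  · intro d e hde
    have h₁ : d.fst = e.fst := Sum.inl_injective (congrArg (fun x => x.1.fst) hde)
    have h₂ : w d = w e := congrArg (fun x => x.1.snd) hde
    have h₃ := hw' d
    rw [h₁, h₂] at h₃
    exact SimpleGraph.Dart.ext _ _ (Prod.ext h₁ (C.target_inj h₃ (hw' e)))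
  · rintro ⟨⟨⟨a, b⟩, hab⟩, v, rfl : a = .inl v⟩
    rcases b with a | c
    · refine ⟨⟨(v, a), hab.1⟩, Subtype.ext (SimpleGraph.Dart.ext _ _ (Prod.ext rfl ?_))⟩
      rcases hw' ⟨(v, a), hab.1⟩ with h | ⟨c, i, -, h⟩
      · exact h
      · exact absurd h (hab.2 c i)
    · obtain ⟨i, hi⟩ := hab
      obtain ⟨a, ha⟩ := Sym2.mem_iff_exists.1 hi
      have hva : G.Adj v a := by
        have := C.edge_mem c i
        rwa [ha] at this
      refine ⟨⟨(v, a), hva⟩, Subtype.ext (SimpleGraph.Dart.ext _ _ (Prod.ext rfl ?_))⟩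
      rcases hw' ⟨(v, a), hva⟩ with h | ⟨c', j, h, h'⟩
      · have := hw ⟨(v, a), hva⟩
        rw [h] at this
        exact absurd ha (this.2 c i)
      · obtain ⟨rfl, -⟩ := C.edge_inj c' j c i (h'.trans ha.symm)
        exact h

theorem card_crossing_darts (C : CrossingSystem G (Fin m)) :
    Nat.card {d : C.planarization.Dart // ¬ ∃ v, d.fst = .inl v} = 4 * m := by
  have hout : ∀ c i, ∃ p : Bool → V, C.edge c i = s(p false, p true) := by
    intro c i
    induction h : C.edge c i using Sym2.ind with | _ x y =>
    exact ⟨fun b => if b then y else x, rfl⟩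
  choose p hp using hout
  have hmem : ∀ c i b, p c i b ∈ C.edge c i := by
    intro c i b
    rw [hp]
    cases b
    · exact Sym2.mem_mk_left _ _
    · exact Sym2.mem_mk_right _ _
  have hne : ∀ c i, p c i false ≠ p c i true := by
    intro c i
    have := C.edge_mem c i
    rw [hp] at this
    exact SimpleGraph.Adj.ne this
  have : Nat.card (Fin m × Bool × Bool) = 4 * m := by
    simp [mul_comm]
  rw [← this]
  refine (Nat.card_congr (Equiv.ofBijective
    (fun x : Fin m × Bool × Bool => (⟨⟨(.inr x.1, .inl (p x.1 x.2.1 x.2.2)), ⟨_, hmem _ _ _⟩⟩,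
      fun ⟨_, hv⟩ => Sum.inr_ne_inl hv⟩ :
      {d : C.planarization.Dart // ¬ ∃ v, d.fst = .inl v})) ⟨?_, ?_⟩)).symm
  · rintro ⟨c, i, b⟩ ⟨c', j, b'⟩ h
    obtain rfl : c = c' := Sum.inr_injective (congrArg (fun x => x.1.fst) h)
    have h₂ : p c i b = p c j b' := Sum.inl_injective (congrArg (fun x => x.1.snd) h)
    obtain rfl := C.index_unique (hmem c i b) (h₂ ▸ hmem c j b')
    have : b = b' := by
      cases b <;> cases b'
      · rfl
      · exact absurd h₂ (hne _ _)
      · exact absurd h₂.symm (hne _ _)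
      · rfl
    rw [this]
  · rintro ⟨⟨⟨a, b⟩, hab⟩, hv⟩
    rcases a with v | c
    · exact absurd ⟨v, rfl⟩ hv
    · rcases b with s | c'
      · obtain ⟨i, hi⟩ := hab
        have := hi
        rw [hp, Sym2.mem_iff] at this
        rcases this with rfl | rfl
        · exact ⟨(c, i, false), rfl⟩
        · exact ⟨(c, i, true), rfl⟩
      · exact hab.elim

theorem two_mul_card_planarization_edgeSet [Finite V] (C : CrossingSystem G (Fin m)) :
    2 * Nat.card C.planarization.edgeSet = 2 * Nat.card G.edgeSet + 4 * m := by
  have := finite_dart C.planarization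
  rw [IsKiteDrawing.two_mul_card_edgeSet, IsKiteDrawing.two_mul_card_edgeSet,
    ← C.card_real_darts, ← C.card_crossing_darts, ← Nat.card_sum]
  classical
  exact (Nat.card_congr (Equiv.sumCompl _)).symm

theorem exists_two_neighbors (C : CrossingSystem G (Fin m))
    (hdeg : ∀ v, ∃ a b, a ≠ b ∧ G.Adj v a ∧ G.Adj v b) (x : V ⊕ Fin m) :
    ∃ y z, y ≠ z ∧ C.planarization.Adj x y ∧ C.planarization.Adj x z := by
  rcases x with v | c
  · obtain ⟨a, b, hab, ha, hb⟩ := hdeg v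
    obtain ⟨y, hy, hy'⟩ := C.exists_target ⟨(v, a), ha⟩
    obtain ⟨z, hz, hz'⟩ := C.exists_target ⟨(v, b), hb⟩
    refine ⟨y, z, ?_, hy, hz⟩
    rintro rfl
    exact hab (C.target_inj hy' hz')
  · induction h : C.edge c true using Sym2.ind with | _ s t =>
    have he := C.edge_mem c true
    rw [h] at he
    refine ⟨.inl s, .inl t, fun e => SimpleGraph.Adj.ne he (Sum.inl_injective e), ⟨true, ?_⟩, ⟨true, ?_⟩⟩
    · rw [h]; exact Sym2.mem_mk_left _ _
    · rw [h]; exact Sym2.mem_mk_right _ _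

end CrossingSystem

namespace RotationSystem

variable {W : Type u} {H : SimpleGraph W} (ρ : RotationSystem H)

theorem facePerm_apply (d : H.Dart) : ρ.facePerm d = ρ.next d.symm := rfl

theorem facePerm_fst (d : H.Dart) : (ρ.facePerm d).fst = d.snd := ρ.next_fst d.symm

theorem facePerm_ne (d : H.Dart) : ρ.facePerm d ≠ d := by
  intro h
  have := ρ.facePerm_fst d
  rw [h] at this
  exact d.fst_ne_snd this

theorem next_ne (hH : ∀ x, ∃ y z, y ≠ z ∧ H.Adj x y ∧ H.Adj x z) (d : H.Dart) : ρ.next d ≠ d := by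
  intro h
  have key : ∀ e : H.Dart, e.fst = d.fst → e = d := by
    intro e he
    have := (Equiv.Perm.SameCycle.symm (ρ.cyclic e d he))
    exact (this.eq_of_left h).symm
  obtain ⟨y, z, hyz, hy, hz⟩ := hH d.fst
  have h₁ := key ⟨(d.fst, y), hy⟩ rfl
  have h₂ := key ⟨(d.fst, z), hz⟩ rfl
  exact hyz (congrArg (fun d => d.snd) (h₁.trans h₂.symm))

/-- A face of length two would traverse an edge back and forth. The rotation would then fix a dart,
which happens only at a vertex of degree one. -/
theorem facePerm_facePerm_ne (hH : ∀ x, ∃ y z, y ≠ z ∧ H.Adj x y ∧ H.Adj x z) (d : H.Dart) :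
    ρ.facePerm (ρ.facePerm d) ≠ d := by
  intro h
  have h₁ := ρ.facePerm_fst d
  have h₂ := ρ.facePerm_fst (ρ.facePerm d)
  rw [h] at h₂
  have : ρ.facePerm d = d.symm := SimpleGraph.Dart.ext _ _ (Prod.ext h₁ h₂.symm)
  exact ρ.next_ne hH d.symm this

end RotationSystem

/-- A planar rotation system of the planarization of an optimal 1-planar graph: all faces are
triangles, and exactly one of the three corners of each face is a crossing point. -/
structure IsTriangular {V : Type u} {G : SimpleGraph V} {m : ℕ} (C : CrossingSystem G (Fin m))
    (ρ : RotationSystem C.planarization) : Prop where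
  cube : ∀ d, ρ.facePerm (ρ.facePerm (ρ.facePerm d)) = d
  crossing : ∀ d v w, d.fst = .inl v → d.snd = .inl w → ∃ c, (ρ.facePerm d).snd = .inr c

/-- Let `n`, `e`, `F` and `κ` be the numbers of vertices and edges of `G` and of faces and
components of the planarization. A face has at least three darts, and at least two of them start at
vertices of `G`, because crossing points are never adjacent. Hence `3 F ≤ 2 e + 4 m` and `F ≤ e`.
With Euler's formula `n + m + F = e + 2 m + 2 κ` and `e = 4 n - 8` this becomes `n - 8 + 6 κ ≤ m ≤ n
- 2 κ`. Since `κ ≥ 1`, it follows that `κ = 1` and `m = n - 2`, and both face bounds are attained.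
-/
theorem isTriangular_of_isPlanar {V : Type u} {G : SimpleGraph V} {m : ℕ} [Finite V] [Nonempty V]
    (C : CrossingSystem G (Fin m)) (ρ : RotationSystem C.planarization) (hP : ρ.IsPlanar)
    (hdeg : ∀ v, ∃ a b, a ≠ b ∧ G.Adj v a ∧ G.Adj v b)
    (hcard : Nat.card G.edgeSet + 8 = 4 * Nat.card V) :
    IsTriangular C ρ ∧ Nat.card V = m + 2 ∧ C.planarization.Connected := by
  have hH := C.exists_two_neighbors hdeg
  have := finite_dart C.planarization
  obtain ⟨b₁, b₂, b₃⟩ := card_cycles_bounds ρ.facePerm (fun d => ∃ v, d.fst = .inl v)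
    ρ.facePerm_ne (ρ.facePerm_facePerm_ne hH) (by
      rintro ⟨⟨v | c, y⟩, hd⟩
      · exact Or.inl ⟨v, rfl⟩
      · rcases y with w | c'
        · exact Or.inr ⟨w, ρ.facePerm_fst _⟩
        · exact hd.elim)
  have hE := C.two_mul_card_planarization_edgeSet
  have hD := IsKiteDrawing.two_mul_card_edgeSet C.planarization
  have hG := IsKiteDrawing.two_mul_card_edgeSet G
  have hR := C.card_real_darts
  have hiso : Nat.card {w : V ⊕ Fin m // ∀ w', ¬ C.planarization.Adj w w'} = 0 := by
    rw [Nat.card_eq_zero]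
    left
    refine ⟨fun ⟨w, hw⟩ => ?_⟩
    obtain ⟨y, _, _, hy, _⟩ := hH w
    exact hw y hy
  have hc : 1 ≤ Nat.card C.planarization.ConnectedComponent := by
    obtain ⟨v⟩ := ‹Nonempty V›
    have : Nonempty C.planarization.ConnectedComponent :=
      ⟨SimpleGraph.connectedComponentMk _ (.inl v)⟩
    exact Nat.card_pos
  unfold RotationSystem.IsPlanar RotationSystem.faceCount at hP
  rw [hiso, Nat.card_sum, Nat.card_fin] at hP
  have b₃ := b₃ (by omega) (by omega)
  refine ⟨⟨fun d => (b₃ d).1, fun d v w hv hw => ?_⟩, by omega, ?_⟩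
  · rcases h : (ρ.facePerm d).snd with x | c
    · exact absurd ⟨⟨v, hv⟩, ⟨w, (ρ.facePerm_fst d).trans hw⟩,
        ⟨x, (ρ.facePerm_fst _).trans h⟩⟩ (b₃ d).2
    · exact ⟨c, rfl⟩
  · have h1 : Nat.card C.planarization.ConnectedComponent = 1 := by omega
    have := (Nat.card_eq_one_iff_unique.1 h1).1
    exact ⟨fun _ _ => SimpleGraph.ConnectedComponent.exact (Subsingleton.elim _ _)⟩

/-! ### Reading the kites off the triangular faces. -/

namespace CrossingSystem

variable {V : Type u} {G : SimpleGraph V} {m : ℕ} {C : CrossingSystem G (Fin m)}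
  {ρ : RotationSystem C.planarization}

/-- A walk may pass through a crossing point, but the vertices around such a point are pairwise
equal or adjacent in `G`. For the induction, the ends of the walk are replaced by arbitrary vertices
of `G` equal or adjacent to them. -/
theorem connected_of_planarization (C : CrossingSystem G (Fin m)) [Nonempty V]
    (hdiag : ∀ c s t, (∃ i, s ∈ C.edge c i) → (∃ i, t ∈ C.edge c i) → s = t ∨ G.Adj s t)
    (h : C.planarization.Connected) : G.Connected := by
  have key : ∀ x y : V ⊕ Fin m, C.planarization.Walk x y → ∀ s t,
      (x = .inl s ∨ C.planarization.Adj x (.inl s)) →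
      (y = .inl t ∨ C.planarization.Adj y (.inl t)) → G.Reachable s t := by
    have hd : ∀ c s t, C.planarization.Adj (.inr c) (.inl s) →
        C.planarization.Adj (.inr c) (.inl t) → G.Reachable s t := by
      intro c s t hs ht
      rcases hdiag c s t hs ht with rfl | h
      · exact .refl _
      · exact h.reachable
    have base : ∀ x s t, (x = .inl s ∨ C.planarization.Adj x (.inl s)) →
        (x = .inl t ∨ C.planarization.Adj x (.inl t)) → G.Reachable s t := by
      rintro (v | c) s t hs ht
      · have e : ∀ s, ((.inl v : V ⊕ Fin m) = .inl s ∨ C.planarization.Adj (.inl v) (.inl s)) →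
            G.Reachable v s := by
          rintro s (h | h)
          · rw [Sum.inl_injective h]
          · exact h.1.reachable
        exact (e s hs).symm.trans (e t ht)
      · rcases hs with hs | hs
        · exact absurd hs Sum.inr_ne_inl
        rcases ht with ht | ht
        · exact absurd ht Sum.inr_ne_inl
        exact hd c s t hs ht
    intro x y w
    induction w with
    | nil => exact base _
    | @cons x y z hxy _ ih =>
      intro s t hs ht
      rcases y with v | c
      · exact (base x s v hs (Or.inr hxy)).trans (ih v t (Or.inl rfl) ht)
      · rcases x with v | c'
        · exact (base _ s v hs (Or.inl rfl)).trans (ih v t (Or.inr hxy.symm) ht)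
        · exact hxy.elim
  refine ⟨fun s t => ?_⟩
  obtain ⟨w⟩ := h.preconnected (.inl s) (.inl t)
  exact key _ _ w s t (Or.inl rfl) (Or.inl rfl)

/-- Two steps around a crossing point lead to the other end of the same edge, so four steps lead
back. -/
theorem next_pow_four (hA : C.Alternates ρ) {c : Fin m} {d : C.planarization.Dart}
    (hd : d.fst = .inr c) : ρ.next (ρ.next (ρ.next (ρ.next d))) = d := by
  obtain ⟨i, s, t, h₁, h₂, h₃⟩ := hA c d hd
  have hd₂ : (ρ.next (ρ.next d)).fst = .inr c := by rw [ρ.next_fst, ρ.next_fst, hd]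
  obtain ⟨j, s', t', h₁', h₂', h₃'⟩ := hA c _ hd₂
  obtain rfl : t = s' := Sum.inl_injective (h₃.symm.trans h₂')
  obtain rfl := C.index_unique (h₁ ▸ Sym2.mem_mk_right s t) (h₁' ▸ Sym2.mem_mk_left t t')
  have : s = t' := by
    rw [h₁, Sym2.eq_swap] at h₁'
    exact Sym2.congr_right.1 h₁'
  refine SimpleGraph.Dart.ext _ _ (Prod.ext ?_ ?_)
  · rw [ρ.next_fst, ρ.next_fst, hd₂, hd]
  · rw [h₃', h₂, this]

theorem exists_crossing_dart (C : CrossingSystem G (Fin m)) (c : Fin m) :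
    ∃ d : C.planarization.Dart, d.fst = .inr c := by
  induction h : C.edge c true using Sym2.ind with | _ s t =>
  exact ⟨⟨(.inr c, .inl s), ⟨true, h ▸ Sym2.mem_mk_left _ _⟩⟩, rfl⟩

/-- A numbering of the darts leaving a crossing point, against the rotation. -/
theorem exists_corner_darts [Finite V] (hA : C.Alternates ρ) :
    ∃ (K : Fin m → ZMod 4 → V) (o : Fin m → ZMod 4 → C.planarization.Dart),
      (∀ c i, (o c i).toProd = (.inr c, .inl (K c i))) ∧ (∀ c i, ρ.next (o c (i + 1)) = o c i) ∧
      ∀ c d, d.fst = .inr c → ∃ i, d = o c i := by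
  have := finite_dart C.planarization
  choose b hb using C.exists_crossing_dart
  let o : Fin m → ZMod 4 → C.planarization.Dart := fun c i => (ρ.next⁻¹ ^ i.val) (b c)
  have hs : ∀ c i, ρ.next (o c (i + 1)) = o c i := by
    intro c i
    have h4 := next_pow_four hA (hb c)
    have inv : ∀ x, ρ.next (ρ.next⁻¹ x) = x := fun x => ρ.next.apply_symm_apply x
    have inv' : ∀ x, ρ.next⁻¹ (ρ.next x) = x := fun x => ρ.next.symm_apply_apply x
    fin_cases i
    · exact inv _
    · exact inv _
    · exact inv _
    -- The wrap-around from `3` to `0`; only here does the rotation need to have order four.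
    · change ρ.next (b c) = ρ.next⁻¹ (ρ.next⁻¹ (ρ.next⁻¹ (b c)))
      rw [← inv' (ρ.next (b c)), ← inv' (ρ.next (ρ.next (b c))),
        ← inv' (ρ.next (ρ.next (ρ.next (b c)))), h4]
  have hfst : ∀ c i, (o c i).fst = .inr c := by
    intro c i
    change ((ρ.next⁻¹ ^ i.val) (b c)).fst = _
    induction i.val with
    | zero => exact hb c
    | succ n ih =>
      rw [pow_succ', Equiv.Perm.mul_apply, ← ih]
      have := ρ.next_fst (ρ.next⁻¹ ((ρ.next⁻¹ ^ n) (b c)))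
      rw [← this]
      exact congrArg (fun d => d.fst) (ρ.next.apply_symm_apply _)
  have hsnd : ∀ c i, ∃ v, (o c i).snd = .inl v := by
    intro c i
    rcases h : (o c i).snd with v | c'
    · exact ⟨v, rfl⟩
    · have := (o c i).adj
      rw [hfst, h] at this
      exact this.elim
  choose K hK using hsnd
  refine ⟨K, o, fun c i => Prod.ext (hfst c i) (hK c i), hs, fun c d hd => ?_⟩
  obtain ⟨n, rfl⟩ := (ρ.cyclic (b c) d ((hb c).trans hd.symm)).exists_nat_pow_eq
  clear hd
  induction n with
  | zero => exact ⟨0, rfl⟩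
  | succ n ih =>
    obtain ⟨i, hi⟩ := ih
    refine ⟨i - 1, ?_⟩
    rw [pow_succ', Equiv.Perm.mul_apply, hi, ← hs c (i - 1), sub_add_cancel]

/-- The four triangles around a crossing point form its kite: the edge `e c i` opposite to the
crossing joins consecutive corners and is uncrossed, while opposite corners are the ends of a
crossing edge. No uncrossed edge is missed, since the face along it has a crossing point as its
third corner. -/
theorem exists_isKiteDrawing [Finite V] (hT : IsTriangular C ρ) (hA : C.Alternates ρ) :
    ∃ K : Fin m → ZMod 4 → V, IsKiteDrawing G K ∧
      ∀ c s, (∃ i, s ∈ C.edge c i) → ∃ j, K c j = s := by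
  have := finite_dart C.planarization
  obtain ⟨K, o, ho, hs, hsurj⟩ := exists_corner_darts hA
  have d₁ : ∀ i : ZMod 4, i + 2 = i + 1 + 1 := by decide
  have d₂ : ∀ i : ZMod 4, i + 2 + 2 = i := by decide
  let ι : Fin m → ZMod 4 → C.planarization.Dart := fun c i => (o c i).symm
  let e : Fin m → ZMod 4 → C.planarization.Dart := fun c i => ρ.next (ι c i)
  have hι : ∀ c i, (ι c i).toProd = (.inl (K c i), .inr c) := fun c i => by
    change (o c i).toProd.swap = _
    rw [ho]; rfl
  have fι : ∀ c i, ρ.facePerm (ι c (i + 1)) = o c i := fun c i => by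
    rw [ρ.facePerm_apply, SimpleGraph.Dart.symm_symm, hs]
  have fo : ∀ c i, ρ.facePerm (o c i) = e c i := fun c i => rfl
  have fe : ∀ c i, ρ.facePerm (e c i) = ι c (i + 1) := fun c i => by
    rw [← fo, ← fι, hT.cube]
  have he : ∀ c i, (e c i).toProd = (.inl (K c i), .inl (K c (i + 1))) := fun c i => by
    refine Prod.ext ?_ ?_
    · exact (ρ.next_fst _).trans (by rw [hι])
    · rw [← ρ.facePerm_fst, fe, hι]
  have eadj : ∀ c i, C.planarization.Adj (.inl (K c i)) (.inl (K c (i + 1))) := fun c i => by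
    have := (e c i).adj
    rwa [he] at this
  have real : ∀ (d : C.planarization.Dart) v w, d.toProd = (.inl v, .inl w) →
      ∃ c i, d = e c i := by
    intro d v w hd
    obtain ⟨c, hc⟩ := hT.crossing d v w (congrArg Prod.fst hd) (congrArg Prod.snd hd)
    obtain ⟨i, hi⟩ := hsurj c (ρ.facePerm (ρ.facePerm d)) ((ρ.facePerm_fst _).trans hc)
    refine ⟨c, i, ?_⟩
    rw [← fo, ← hi, hT.cube]
  have diag : ∀ c i, ∃ b, C.edge c b = s(K c i, K c (i + 2)) := by
    intro c i
    obtain ⟨b, s, t, h₁, h₂, h₃⟩ := hA c (o c (i + 2)) (by rw [ho])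
    rw [ho] at h₂
    rw [d₁, hs, hs, ho] at h₃
    obtain rfl := Sum.inl_injective h₂
    obtain rfl := Sum.inl_injective h₃
    exact ⟨b, by rw [h₁, Sym2.eq_swap]⟩
  have gdiag : ∀ c i, G.Adj (K c i) (K c (i + 2)) := by
    intro c i
    obtain ⟨b, hb⟩ := diag c i
    have := C.edge_mem c b
    rwa [hb] at this
  have inj : ∀ c i j, K c i = K c j → i = j := by
    intro c i j hij
    have : j = i ∨ j = i + 1 ∨ j = i + 2 ∨ i = j + 1 := by
      clear hij; revert i j; decide
    rcases this with rfl | rfl | rfl | rfl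
    · rfl
    · exact absurd (congrArg Sum.inl hij) (eadj c i).ne
    · exact absurd hij (gdiag c i).ne
    · exact absurd (congrArg Sum.inl hij.symm) (eadj c j).ne
  have mem : ∀ c s, (∃ i, s ∈ C.edge c i) → ∃ j, K c j = s := by
    intro c s h
    obtain ⟨j, hj⟩ := hsurj c ⟨(.inr c, .inl s), h⟩ rfl
    have := ho c j
    rw [← hj] at this
    exact ⟨j, (Sum.inl_injective (congrArg Prod.snd this)).symm⟩
  have diag_of_edge : ∀ c b s t, C.edge c b = s(s, t) → ∃ i, K c i = s ∧ K c (i + 2) = t := by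
    intro c b s t h
    obtain ⟨i, rfl⟩ := mem c s ⟨b, h ▸ Sym2.mem_mk_left _ _⟩
    refine ⟨i, rfl, ?_⟩
    obtain ⟨b', hb'⟩ := diag c i
    obtain rfl := C.index_unique (h ▸ Sym2.mem_mk_left _ _) (hb' ▸ Sym2.mem_mk_left _ _)
    exact Sym2.congr_right.1 (hb'.symm.trans h)
  have side_inj : ∀ c i c' j, K c i = K c' j → K c (i + 1) = K c' (j + 1) → c = c' ∧ i = j := by
    intro c i c' j h₁ h₂
    have : e c i = e c' j := SimpleGraph.Dart.ext _ _ (by rw [he, he, h₁, h₂])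
    have := congrArg ρ.facePerm this
    rw [fe, fe] at this
    have := congrArg (fun d => d.snd) this
    simp only [hι] at this
    obtain rfl := Sum.inr_injective this
    exact ⟨rfl, inj c _ _ h₁⟩
  have turn : ∀ c i, ∃ c' j, CornerTurn K (c, i) (c', j) ∧ ρ.next (e c i) = ι c' j := by
    intro c i
    obtain ⟨c', j, hj⟩ := real (e c i).symm (K c (i + 1)) (K c i) (by
      change (e c i).toProd.swap = _
      rw [he]; rfl)
    have hj' : (e c i).toProd.swap = (e c' j).toProd := congrArg (fun d => d.toProd) hj
    rw [he, he] at hj'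
    refine ⟨c', j + 1, ⟨?_, ?_⟩, ?_⟩
    · exact (Sum.inl_injective (congrArg Prod.snd hj')).symm
    · change K c' (j + 1 - 1) = _
      rw [add_sub_cancel_right]
      exact (Sum.inl_injective (congrArg Prod.fst hj')).symm
    · rw [← fe, ← hj, ρ.facePerm_apply, SimpleGraph.Dart.symm_symm]
  refine ⟨K, ⟨fun a b => ⟨fun hab => ?_, ?_⟩, side_inj, ?_, ?_, ?_, ?_⟩, mem⟩
  · by_cases h : ∃ c i, C.edge c i = s(a, b)
    · obtain ⟨c, i, h⟩ := h
      obtain ⟨j, h₁, h₂⟩ := diag_of_edge c i a b h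
      exact ⟨c, j, h₁, Or.inr h₂⟩
    · push Not at h
      obtain ⟨c, i, hd⟩ := real ⟨(.inl a, .inl b), ⟨hab, h⟩⟩ a b rfl
      have := he c i
      rw [← hd] at this
      exact ⟨c, i, (Sum.inl_injective (congrArg Prod.fst this)).symm,
        Or.inl (Sum.inl_injective (congrArg Prod.snd this)).symm⟩
  · rintro ⟨c, i, rfl, rfl | rfl⟩
    · exact (eadj c i).1
    · exact gdiag c i
  · intro c i c' j h₁ h₂
    obtain ⟨b, hb⟩ := diag c i
    obtain ⟨b', hb'⟩ := diag c' j
    obtain ⟨rfl, -⟩ := C.edge_inj c b c' b' (by rw [hb, hb', h₁, h₂])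
    exact ⟨rfl, inj c _ _ h₁⟩
  · intro c i c' j h₁ h₂
    obtain ⟨b, hb⟩ := diag c' j
    exact (eadj c i).2 c' b (by rw [hb, h₁, h₂])
  · intro c i
    obtain ⟨c', j, ⟨h₁, h₂⟩, -⟩ := turn c i
    exact ⟨c', j - 1, h₂, by simpa using h₁⟩
  -- Around a vertex of `G`, darts into kites alternate with uncrossed edges. Two steps of the
  -- rotation are one turn between corners, which explains the induction in steps of two; an odd
  -- number of steps is impossible.
  · have key : ∀ n : ℕ, ∀ s t : Fin m × ZMod 4, (ρ.next ^ n) (ι s.1 s.2) = ι t.1 t.2 →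
        Relation.EqvGen (CornerTurn K) s t := by
      intro n
      induction n using Nat.twoStepInduction with
      | zero =>
        rintro ⟨c, i⟩ ⟨c', j⟩ h
        have h : (ι c i).toProd = (ι c' j).toProd := congrArg (fun d => d.toProd) h
        rw [hι, hι] at h
        obtain rfl : c = c' := Sum.inr_injective (congrArg Prod.snd h)
        obtain rfl := inj c i j (Sum.inl_injective (congrArg Prod.fst h))
        exact .refl _
      | one =>
        rintro ⟨c, i⟩ ⟨c', j⟩ h
        have h : (e c i).toProd = (ι c' j).toProd := congrArg (fun d => d.toProd) h
        rw [hι, he] at h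
        exact absurd (congrArg Prod.snd h) Sum.inl_ne_inr
      | more n ih _ =>
        rintro ⟨c, i⟩ t h
        obtain ⟨c', j, ht, hn⟩ := turn c i
        refine .trans _ (c', j) _ (.rel _ _ ht) (ih (c', j) t ?_)
        rw [pow_add, Equiv.Perm.mul_apply] at h
        change (ρ.next ^ n) (ρ.next (e c i)) = _ at h
        rwa [hn] at h
    intro s t hst
    obtain ⟨n, hn⟩ := (ρ.cyclic (ι s.1 s.2) (ι t.1 t.2) (by rw [hι, hι, hst])).exists_nat_pow_eq
    exact key n s t hn

end CrossingSystem

theorem IsOptimalOnePlanar.hasKiteDrawing {V : Type u} {G : SimpleGraph V}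
    (h : IsOptimalOnePlanar G) (hdeg : ∀ v, ∃ a b, a ≠ b ∧ G.Adj v a ∧ G.Adj v b) :
    HasKiteDrawing G := by
  obtain ⟨⟨hV, m, C, ρ, hA, hP⟩, h3, hcard⟩ := h
  have : Nonempty V := by
    by_contra hne
    rw [not_nonempty_iff] at hne
    simp at h3
  obtain ⟨hT, hm, hconn⟩ := isTriangular_of_isPlanar C ρ hP hdeg hcard
  obtain ⟨K, hK, hmem⟩ := CrossingSystem.exists_isKiteDrawing hT hA
  refine ⟨hV, C.connected_of_planarization (fun c s t hs ht => ?_) hconn, m, K, hK, hm, by omega⟩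
  obtain ⟨i, rfl⟩ := hmem c s hs
  obtain ⟨j, rfl⟩ := hmem c t ht
  by_cases hij : i = j
  · exact Or.inl (by rw [hij])
  · exact Or.inr (hK.adj_of_ne c hij)

/-! Merging the two opposite corners of a kite. -/

/-- The graph obtained from `G` by moving all edges from `x` to `x₄` and removing the edge
`x₃x₅`. -/
def mergeGraph {V : Type u} (G : SimpleGraph V) (x x₃ x₄ x₅ : V) : SimpleGraph V where
  Adj a b := (G.Adj a b ∧ a ≠ x ∧ b ≠ x ∧ s(a, b) ≠ s(x₃, x₅)) ∨
    (a = x₄ ∧ b ≠ x₄ ∧ G.Adj x b) ∨ (b = x₄ ∧ a ≠ x₄ ∧ G.Adj x a)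
  symm := ⟨by
    rintro a b (⟨h₁, h₂, h₃, h₄⟩ | h | h)
    · exact Or.inl ⟨h₁.symm, h₃, h₂, by rwa [Sym2.eq_swap]⟩
    · exact Or.inr (Or.inr h)
    · exact Or.inr (Or.inl h)⟩
  loopless := ⟨by
    rintro a (⟨h, -⟩ | ⟨h, h', -⟩ | ⟨h, h', -⟩)
    · exact h.ne rfl
    · exact h' h
    · exact h' h⟩

namespace IsKiteDrawing

variable {V : Type u} {F : Type v} {G : SimpleGraph V} {K : F → ZMod 4 → V}

/-- Adjacency can be checked on unordered pairs of corners, because a side read backwards is a side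
of the kite across it by `rev`. -/
theorem of_pairs
    (adj_iff : ∀ a b, G.Adj a b ↔ ∃ c j k, j ≠ k ∧ K c j = a ∧ K c k = b)
    (side_inj : ∀ c i c' j, K c i = K c' j → K c (i + 1) = K c' (j + 1) → c = c' ∧ i = j)
    (diag_inj : ∀ c i c' j, K c i = K c' j → K c (i + 2) = K c' (j + 2) → c = c' ∧ i = j)
    (side_ne_diag : ∀ c i c' j, K c i = K c' j → K c (i + 1) ≠ K c' (j + 2))
    (rev : ∀ c i, ∃ c' j, K c' j = K c (i + 1) ∧ K c' (j + 1) = K c i)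
    (cyclic : ∀ s t : F × ZMod 4, K s.1 s.2 = K t.1 t.2 → Relation.EqvGen (CornerTurn K) s t) :
    IsKiteDrawing G K where
  adj_iff a b := by
    rw [adj_iff]
    constructor
    · rintro ⟨c, j, k, hjk, rfl, rfl⟩
      have : k = j + 1 ∨ k = j + 2 ∨ j = k + 1 := by revert j k; decide
      rcases this with rfl | rfl | rfl
      · exact ⟨c, j, rfl, Or.inl rfl⟩
      · exact ⟨c, j, rfl, Or.inr rfl⟩
      · obtain ⟨c', l, h₁, h₂⟩ := rev c k
        exact ⟨c', l, h₁, Or.inl h₂⟩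
    · have e : ∀ i : ZMod 4, i ≠ i + 1 ∧ i ≠ i + 2 := by decide
      rintro ⟨c, i, rfl, rfl | rfl⟩
      · exact ⟨c, i, _, (e i).1, rfl, rfl⟩
      · exact ⟨c, i, _, (e i).2, rfl, rfl⟩
  side_inj := side_inj
  diag_inj := diag_inj
  side_ne_diag := side_ne_diag
  rev := rev
  cyclic := cyclic

theorem exists_pair (h : IsKiteDrawing G K) {a b : V} (hab : G.Adj a b) :
    ∃ c j k, j ≠ k ∧ K c j = a ∧ K c k = b := by
  have e : ∀ i : ZMod 4, i ≠ i + 1 ∧ i ≠ i + 2 := by decide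
  obtain ⟨c, i, rfl, rfl | rfl⟩ := (h.adj_iff a b).1 hab
  · exact ⟨c, i, _, (e i).1, rfl, rfl⟩
  · exact ⟨c, i, _, (e i).2, rfl, rfl⟩

theorem induce (h : IsKiteDrawing G K) {S : Set V} (hS : ∀ c i, K c i ∈ S) :
    IsKiteDrawing (G.induce S) (fun c i => (⟨K c i, hS c i⟩ : S)) where
  adj_iff a b := by
    simp only [SimpleGraph.comap_adj, Function.Embedding.subtype_apply, Subtype.ext_iff]
    exact h.adj_iff a b
  side_inj c i c' j h₁ h₂ := h.side_inj c i c' j (congrArg Subtype.val h₁) (congrArg Subtype.val h₂)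
  diag_inj c i c' j h₁ h₂ := h.diag_inj c i c' j (congrArg Subtype.val h₁) (congrArg Subtype.val h₂)
  side_ne_diag c i c' j h₁ h₂ :=
    h.side_ne_diag c i c' j (congrArg Subtype.val h₁) (congrArg Subtype.val h₂)
  rev c i := by
    obtain ⟨c', j, h₁, h₂⟩ := h.rev c i
    exact ⟨c', j, Subtype.ext h₁, Subtype.ext h₂⟩
  cyclic s t hst := by
    have := h.cyclic s t (congrArg Subtype.val hst)
    clear hst
    induction this with
    | rel a b hab => exact .rel _ _ ⟨Subtype.ext hab.1, Subtype.ext hab.2⟩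
    | refl a => exact .refl _
    | symm a b _ ih => exact .symm _ _ ih
    | trans a b c _ _ ih₁ ih₂ => exact .trans _ _ _ ih₁ ih₂

/-- The diagonals of a kite belong to no other kite. -/
theorem eq_of_diag (h : IsKiteDrawing G K) {c f : F} {i j k : ZMod 4} (hjk : j ≠ k)
    (h₁ : K c j = K f i) (h₂ : K c k = K f (i + 2)) : c = f ∧ j = i ∧ k = i + 2 := by
  have : k = j + 1 ∨ k = j + 2 ∨ j = k + 1 := by
    clear h₁ h₂; revert j k; decide
  have e : i + 2 + 2 = i := by clear h₁ h₂; revert i; decide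
  rcases this with rfl | rfl | rfl
  · exact absurd h₂ (h.side_ne_diag _ _ _ _ h₁)
  · obtain ⟨rfl, rfl⟩ := h.diag_inj _ _ _ _ h₁ h₂
    exact ⟨rfl, rfl, rfl⟩
  · exact absurd (h₁.trans (congrArg (K f) e.symm)) (h.side_ne_diag _ _ _ _ h₂)

/-- A side of a kite is traversed in the opposite direction by the other kite containing it. -/
theorem eq_of_side (h : IsKiteDrawing G K) {c f : F} {i j k : ZMod 4} (hc : c ≠ f) (hjk : j ≠ k)
    (h₁ : K c j = K f i) (h₂ : K c k = K f (i + 1)) : j = k + 1 := by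
  have : k = j + 1 ∨ k = j + 2 ∨ j = k + 1 := by
    clear h₁ h₂; revert j k; decide
  rcases this with rfl | rfl | rfl
  · exact absurd (h.side_inj _ _ _ _ h₁ h₂).1 hc
  · exact absurd h₂.symm (h.side_ne_diag _ _ _ _ h₁.symm)
  · rfl

theorem exists_rev_ne (h : IsKiteDrawing G K) (f : F) (i : ZMod 4) :
    ∃ c j, c ≠ f ∧ K c j = K f (i + 1) ∧ K c (j + 1) = K f i := by
  obtain ⟨c, j, h₁, h₂⟩ := h.rev f i
  refine ⟨c, j, ?_, h₁, h₂⟩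
  rintro rfl
  have e₁ := h.corner_injective c h₁
  have e₂ := h.corner_injective c h₂
  subst e₁
  revert e₂
  have : ∀ i : ZMod 4, i + 1 + 1 ≠ i := by decide
  exact this i

/-- A kite has only one corner at a vertex, so a turn inside `f` would fix that corner and identify
its two neighbouring corners `i + 1` and `i - 1`. -/
theorem turn_mem (h : IsKiteDrawing G K) {f : F} {s : F × ZMod 4} (hs : s.1 = f)
    (ht : (h.turn s).1 = f) : False := by
  obtain ⟨h₁, h₂⟩ := h.turn_spec s
  rw [hs, ht] at h₁ h₂
  have e₁ := h.corner_injective f h₁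
  have e₂ := h.corner_injective f h₂
  rw [e₁] at e₂
  generalize s.2 = i at e₂
  revert i; decide

section Merge

variable {f : F} {i : ZMod 4}

open Classical in
/-- The kites that remain after the corners `i` and `i + 2` of the kite `f` are merged. -/
noncomputable def mergeKites (K : F → ZMod 4 → V) (f : F) (i : ZMod 4) :
    {c // c ≠ f} → ZMod 4 → V :=
  fun c j => if K c j = K f i then K f (i + 2) else K c j

theorem mergeKites_of_eq {c : {c // c ≠ f}} {j : ZMod 4} (h : K c j = K f i) :
    mergeKites K f i c j = K f (i + 2) := if_pos h

theorem mergeKites_of_ne {c : {c // c ≠ f}} {j : ZMod 4} (h : K c j ≠ K f i) :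
    mergeKites K f i c j = K c j := if_neg h

theorem mergeKites_of_eq_target {c : {c // c ≠ f}} {j : ZMod 4} (h : K c j = K f (i + 2)) :
    mergeKites K f i c j = K f (i + 2) := by
  unfold mergeKites
  split_ifs
  · rfl
  · exact h

theorem mergeKites_congr {c c' : {c // c ≠ f}} {j j' : ZMod 4} (h : K c j = K c' j') :
    mergeKites K f i c j = mergeKites K f i c' j' := by
  unfold mergeKites
  rw [h]

theorem mergeKites_cases {c c' : {c // c ≠ f}} {j j' : ZMod 4}
    (h : mergeKites K f i c j = mergeKites K f i c' j') :
    K c j = K c' j' ∨ (K c j = K f i ∧ K c' j' = K f (i + 2)) ∨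
      (K c j = K f (i + 2) ∧ K c' j' = K f i) := by
  unfold mergeKites at h
  split_ifs at h with h₁ h₂ h₂
  · exact Or.inl (h₁.trans h₂.symm)
  · exact Or.inr (Or.inl ⟨h₁, h.symm⟩)
  · exact Or.inr (Or.inr ⟨h, h₂⟩)
  · exact Or.inl h

/-- Pairs of corners that become equal by merging. -/
theorem mergeKites_pair (hK : IsKiteDrawing G K)
    (hcommon : ∀ w, G.Adj (K f i) w → G.Adj (K f (i + 2)) w → w = K f (i + 1) ∨ w = K f (i + 3))
    {c c' : {c // c ≠ f}} {j k j' k' : ZMod 4} (hjk : j ≠ k) (hjk' : j' ≠ k')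
    (h₁ : mergeKites K f i c j = mergeKites K f i c' j')
    (h₂ : mergeKites K f i c k = mergeKites K f i c' k') :
    (K c j = K c' j' ∧ K c k = K c' k') ∨ (j = k + 1 ∧ k' = j' + 1) ∨ (k = j + 1 ∧ j' = k' + 1) := by
  have d₁ : i + 2 = i + 1 + 1 := by clear h₁ h₂ hcommon; revert i; decide
  have d₂ : i + 3 = i + 2 + 1 := by clear h₁ h₂ hcommon; revert i; decide
  have d₃ : i + 3 + 1 = i := by clear h₁ h₂ hcommon; revert i; decide
  -- the two mixed cases, for one pair of corners
  have mixed : ∀ {c c' : {c // c ≠ f}} {j k j' k' : ZMod 4}, j ≠ k → j' ≠ k' →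
      K c j = K f i → K c' j' = K f (i + 2) → K c k = K c' k' →
      (j = k + 1 ∧ k' = j' + 1) ∨ (k = j + 1 ∧ j' = k' + 1) := by
    intro c c' j k j' k' hjk hjk' hj hj' hk
    have a₁ : G.Adj (K f i) (K c k) := hj ▸ hK.adj_of_ne c.1 hjk
    have a₂ : G.Adj (K f (i + 2)) (K c k) := hj' ▸ hk ▸ hK.adj_of_ne c'.1 hjk'
    -- The common end is a corner of `f`, so both pairs are sides of `f`. Other kites traverse them
    -- against `f`, and `f` passes one towards and the other away from the common end; hence the
    -- orientations are opposite.
    rcases hcommon _ a₁ a₂ with h | h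
    · refine Or.inl ⟨hK.eq_of_side c.2 hjk hj h, ?_⟩
      refine hK.eq_of_side (i := i + 1) c'.2 hjk'.symm (hk.symm.trans h) ?_
      rw [hj', d₁]
    · refine Or.inr ⟨?_, ?_⟩
      · refine hK.eq_of_side (i := i + 3) c.2 hjk.symm h ?_
        rw [hj, d₃]
      · refine hK.eq_of_side (i := i + 2) c'.2 hjk' hj' ?_
        rw [← hk, h, d₂]
  have hno : ∀ {c : {c // c ≠ f}} {j k : ZMod 4}, j ≠ k → K c j = K f i → K c k = K f (i + 2) →
      False := fun {c} {j k} hjk h h' => c.2 (hK.eq_of_diag hjk h h').1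
  rcases mergeKites_cases h₁ with e₁ | ⟨e₁, e₁'⟩ | ⟨e₁, e₁'⟩ <;>
    rcases mergeKites_cases h₂ with e₂ | ⟨e₂, e₂'⟩ | ⟨e₂, e₂'⟩
  · exact Or.inl ⟨e₁, e₂⟩
  · have := mixed hjk.symm hjk'.symm e₂ e₂' e₁
    tauto
  · have := mixed hjk'.symm hjk.symm e₂' e₂ e₁.symm
    tauto
  · exact Or.inr (mixed hjk hjk' e₁ e₁' e₂)
  · exact absurd (hK.corner_injective _ (e₁.trans e₂.symm)) hjk
  · exact (hno hjk e₁ e₂).elim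
  · have := mixed hjk' hjk e₁' e₁ e₂.symm
    tauto
  · exact (hno hjk.symm e₂ e₁).elim
  · exact absurd (hK.corner_injective _ (e₁.trans e₂.symm)) hjk

/-- Removing the corner of `f` from the rotation at a vertex leaves a path that ends at its
predecessor, so the other corners there stay linked. The paths at the two merged corners are joined
end to end: the predecessor of corner `i` is left along an edge to corner `i + 3`, and along an edge
from there the successor of corner `i + 2` is entered. -/
theorem mergeKites_cyclic [Finite F] (hK : IsKiteDrawing G K) (s t : {c // c ≠ f} × ZMod 4)
    (hst : mergeKites K f i s.1 s.2 = mergeKites K f i t.1 t.2) :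
    Relation.EqvGen (CornerTurn (mergeKites K f i)) s t := by
  have step : ∀ (s t : F × ZMod 4) (hs : s.1 ≠ f) (ht : t.1 ≠ f), CornerTurn K s t →
      Relation.EqvGen (CornerTurn (mergeKites K f i)) (⟨s.1, hs⟩, s.2) (⟨t.1, ht⟩, t.2) :=
    fun s t hs ht h => .rel _ _ ⟨mergeKites_congr h.1, mergeKites_congr h.2⟩
  -- corners are connected to the predecessor of the corner of `f` at the same vertex
  have toPred : ∀ (s e : F × ZMod 4) (hs : s.1 ≠ f), e.1 = f → K s.1 s.2 = K e.1 e.2 →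
      ∃ (g : F × ZMod 4) (hg : g.1 ≠ f), CornerTurn K g e ∧
        Relation.EqvGen (CornerTurn (mergeKites K f i)) (⟨s.1, hs⟩, s.2) (⟨g.1, hg⟩, g.2) := by
    intro s e hs he hse
    obtain ⟨n, hn⟩ := (hK.sameCycle_turn hse).exists_nat_pow_eq
    clear hse
    induction n generalizing s with
    | zero =>
      have hn : s = e := hn
      exact absurd (hn ▸ he) hs
    | succ n ih =>
      rw [pow_succ, Equiv.Perm.mul_apply] at hn
      have ht := hK.turn_spec s
      by_cases hf : (hK.turn s).1 = f
      · refine ⟨s, hs, ?_, .refl _⟩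
        have : hK.turn s = e := by
          have hinv : ∀ n : ℕ, ∀ x : F × ZMod 4,
              K ((hK.turn ^ n) x).1 ((hK.turn ^ n) x).2 = K x.1 x.2 := by
            intro n
            induction n with
            | zero => intro x; rfl
            | succ n ih =>
              intro x
              rw [pow_succ, Equiv.Perm.mul_apply, ih, (hK.turn_spec x).1]
          have := hinv n (hK.turn s)
          rw [hn, he, hf] at this
          exact Prod.ext (hf.trans he.symm) (hK.corner_injective f this).symm
        rwa [← this]
      · obtain ⟨g, hg, h₁, h₂⟩ := ih _ hf hn
        exact ⟨g, hg, h₁, .trans _ _ _ (step _ _ hs hf ht) h₂⟩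
  have same : ∀ (s t : F × ZMod 4) (hs : s.1 ≠ f) (ht : t.1 ≠ f), K s.1 s.2 = K t.1 t.2 →
      Relation.EqvGen (CornerTurn (mergeKites K f i)) (⟨s.1, hs⟩, s.2) (⟨t.1, ht⟩, t.2) := by
    intro s t hs ht hst
    by_cases hu : ∃ j, K f j = K s.1 s.2
    · obtain ⟨j, hj⟩ := hu
      obtain ⟨g, hg, h₁, h₂⟩ := toPred s (f, j) hs rfl hj.symm
      obtain ⟨g', hg', h₁', h₂'⟩ := toPred t (f, j) ht rfl (hst.symm.trans hj.symm)
      obtain rfl := hK.turn_left_unique h₁ h₁'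
      exact .trans _ _ _ h₂ (.symm _ _ h₂')
    · obtain ⟨n, hn⟩ := (hK.sameCycle_turn hst).exists_nat_pow_eq
      clear hst
      induction n generalizing s with
      | zero =>
        have hn : s = t := hn
        subst hn
        exact .refl _
      | succ n ih =>
        rw [pow_succ, Equiv.Perm.mul_apply] at hn
        have hsp := hK.turn_spec s
        have hf : (hK.turn s).1 ≠ f := fun e => hu ⟨(hK.turn s).2, by rw [← e]; exact hsp.1⟩
        exact .trans _ _ _ (step _ _ hs hf hsp) (ih _ hf (by rwa [hsp.1]) hn)
  have mixed : ∀ (s t : F × ZMod 4) (hs : s.1 ≠ f) (ht : t.1 ≠ f), K s.1 s.2 = K f i →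
      K t.1 t.2 = K f (i + 2) →
      Relation.EqvGen (CornerTurn (mergeKites K f i)) (⟨s.1, hs⟩, s.2) (⟨t.1, ht⟩, t.2) := by
    intro s t hs ht es et
    obtain ⟨g, hg, h₁, h₂⟩ := toPred s (f, i) hs rfl es
    have hf : (hK.turn (f, i + 2)).1 ≠ f := fun e => hK.turn_mem rfl e
    have hsp := hK.turn_spec (f, i + 2)
    refine .trans _ _ _ h₂ (.trans _ (⟨_, hf⟩, (hK.turn (f, i + 2)).2) _ (.rel _ _ ⟨?_, ?_⟩) ?_)
    · rw [mergeKites_of_eq_target hsp.1, mergeKites_of_eq h₁.1.symm]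
    · refine mergeKites_congr ?_
      rw [hsp.2, ← h₁.2]
      change K f (i + 2 + 1) = K f (i - 1)
      congr 1
      clear * -
      revert i; decide
    · exact same _ _ hf ht (hsp.1.trans et.symm)
  obtain ⟨⟨s, hs⟩, j⟩ := s
  obtain ⟨⟨t, ht⟩, k⟩ := t
  rcases mergeKites_cases hst with h | ⟨h, h'⟩ | ⟨h, h'⟩
  · exact same (s, j) (t, k) hs ht h
  · exact mixed (s, j) (t, k) hs ht h h'
  · exact .symm _ _ (mixed (t, k) (s, j) ht hs h' h)

/-- Contracting `f` glues its sides in two pairs, each at one of the unmerged corners. The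
hypothesis on common neighbours ensures that no further edges become parallel. -/
theorem merge [Finite F] (hK : IsKiteDrawing G K)
    (hcommon : ∀ w, G.Adj (K f i) w → G.Adj (K f (i + 2)) w → w = K f (i + 1) ∨ w = K f (i + 3)) :
    IsKiteDrawing (mergeGraph G (K f i) (K f (i + 1)) (K f (i + 2)) (K f (i + 3)))
      (mergeKites K f i) := by
  have d₀ : ∀ i : ZMod 4, i ≠ i + 2 ∧ i + 1 ≠ i + 2 ∧ i + 3 ≠ i + 2 ∧ i ≠ i + 1 ∧ i ≠ i + 3 := by
    decide
  have d₁ : ∀ i : ZMod 4, i + 1 + 1 = i + 2 ∧ i + 2 + 1 = i + 3 ∧ i + 3 + 1 = i ∧ i + 1 + 2 = i + 3 :=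
    by decide
  have hne : K f i ≠ K f (i + 2) := (hK.adj_diag f i).ne
  have hno : ∀ {c : {c // c ≠ f}} {j k : ZMod 4}, j ≠ k → K c j = K f i → K c k ≠ K f (i + 2) :=
    fun {c} {j k} hjk h h' => c.2 (hK.eq_of_diag hjk h h').1
  have cases_f : ∀ j : ZMod 4, j = i ∨ j = i + 1 ∨ j = i + 2 ∨ j = i + 3 := by
    clear * -; revert i; decide
  refine of_pairs ?_ ?_ ?_ ?_ ?_ (mergeKites_cyclic hK)
  · intro a b
    constructor
    · -- the sides of `f` at `x₄` also lie on other kites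
      have side₃ : ∃ (c : {c // c ≠ f}) (j k : ZMod 4), j ≠ k ∧
          mergeKites K f i c j = K f (i + 2) ∧ mergeKites K f i c k = K f (i + 1) := by
        obtain ⟨c, j, hc, h₁, h₂⟩ := hK.exists_rev_ne f (i + 1)
        rw [(d₁ i).1] at h₁
        refine ⟨⟨c, hc⟩, j, j + 1, (d₀ j).2.2.2.1, mergeKites_of_eq_target h₁, ?_⟩
        rw [mergeKites_of_ne, h₂]
        change K c (j + 1) ≠ _
        rw [h₂]
        exact (hK.adj_side f i).ne'
      have side₅ : ∃ (c : {c // c ≠ f}) (j k : ZMod 4), j ≠ k ∧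
          mergeKites K f i c j = K f (i + 2) ∧ mergeKites K f i c k = K f (i + 3) := by
        obtain ⟨c, j, hc, h₁, h₂⟩ := hK.exists_rev_ne f (i + 2)
        rw [(d₁ i).2.1] at h₁
        refine ⟨⟨c, hc⟩, j + 1, j, (d₀ j).2.2.2.1.symm, mergeKites_of_eq_target h₂, ?_⟩
        rw [mergeKites_of_ne, h₁]
        change K c _ ≠ _
        rw [h₁]
        exact (hK.adj_of_ne f (d₀ i).2.2.2.2).ne'
      have flip : ∀ {a b}, (∃ (c : {c // c ≠ f}) (j k : ZMod 4), j ≠ k ∧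
          mergeKites K f i c j = a ∧ mergeKites K f i c k = b) →
          (∃ (c : {c // c ≠ f}) (j k : ZMod 4), j ≠ k ∧
          mergeKites K f i c j = b ∧ mergeKites K f i c k = a) := by
        rintro a b ⟨c, j, k, h, h', h''⟩
        exact ⟨c, k, j, h.symm, h'', h'⟩
      have new : ∀ b, b ≠ K f (i + 2) → G.Adj (K f i) b → ∃ (c : {c // c ≠ f}) (j k : ZMod 4),
          j ≠ k ∧ mergeKites K f i c j = K f (i + 2) ∧ mergeKites K f i c k = b := by
        intro b hb h
        obtain ⟨c, j, k, hjk, h₁, rfl⟩ := hK.exists_pair h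
        by_cases hc : c = f
        · subst hc
          obtain rfl := hK.corner_injective c h₁
          rcases cases_f k with rfl | rfl | rfl | rfl
          · exact absurd rfl hjk
          · exact side₃
          · exact absurd rfl hb
          · exact side₅
        · exact ⟨⟨c, hc⟩, j, k, hjk, mergeKites_of_eq h₁, mergeKites_of_ne h.ne'⟩
      rintro (⟨h, ha, hb, hab⟩ | ⟨rfl, hb, h⟩ | ⟨rfl, ha, h⟩)
      · obtain ⟨c, j, k, hjk, rfl, rfl⟩ := hK.exists_pair h
        by_cases hc : c = f
        · subst hc
          rcases cases_f j with rfl | rfl | rfl | rfl <;> rcases cases_f k with rfl | rfl | rfl | rfl <;>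
            first
            | exact absurd rfl ha
            | exact absurd rfl hb
            | exact absurd rfl hjk
            | exact absurd rfl hab
            | exact absurd Sym2.eq_swap hab
            | exact side₃
            | exact side₅
            | exact flip side₃
            | exact flip side₅
        · exact ⟨⟨c, hc⟩, j, k, hjk, mergeKites_of_ne ha, mergeKites_of_ne hb⟩
      · exact new b hb h
      · exact flip (new a ha h)
    · rintro ⟨c, j, k, hjk, rfl, rfl⟩
      by_cases hj : K c j = K f i
      · have hk : K c k ≠ K f i := fun e => hjk (hK.corner_injective _ (hj.trans e.symm))
        refine Or.inr (Or.inl ⟨mergeKites_of_eq hj, ?_, ?_⟩)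
        · rw [mergeKites_of_ne hk]; exact hno hjk hj
        · rw [mergeKites_of_ne hk, ← hj]; exact hK.adj_of_ne _ hjk
      · by_cases hk : K c k = K f i
        · refine Or.inr (Or.inr ⟨mergeKites_of_eq hk, ?_, ?_⟩)
          · rw [mergeKites_of_ne hj]; exact hno hjk.symm hk
          · rw [mergeKites_of_ne hj, ← hk]; exact hK.adj_of_ne _ hjk.symm
        · rw [mergeKites_of_ne hj, mergeKites_of_ne hk]
          refine Or.inl ⟨hK.adj_of_ne _ hjk, hj, hk, fun e => ?_⟩
          rcases Sym2.eq_iff.1 e with ⟨e₁, e₂⟩ | ⟨e₁, e₂⟩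
          · exact c.2 (hK.eq_of_diag (i := i + 1) hjk e₁ (by rw [e₂, (d₁ i).2.2.2])).1
          · exact c.2 (hK.eq_of_diag (i := i + 1) hjk.symm e₂ (by rw [e₁, (d₁ i).2.2.2])).1
  · intro c j c' j' h₁ h₂
    rcases mergeKites_pair hK hcommon (d₀ j).2.2.2.1 (d₀ j').2.2.2.1 h₁ h₂ with
      ⟨e₁, e₂⟩ | ⟨e, -⟩ | ⟨-, e⟩
    · obtain ⟨a, b⟩ := hK.side_inj _ _ _ _ e₁ e₂
      exact ⟨Subtype.ext a, b⟩
    · exfalso; clear * - e; revert j; decide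
    · exfalso; clear * - e; revert j'; decide
  · intro c j c' j' h₁ h₂
    rcases mergeKites_pair hK hcommon (d₀ j).1 (d₀ j').1 h₁ h₂ with
      ⟨e₁, e₂⟩ | ⟨e, -⟩ | ⟨e, -⟩
    · obtain ⟨a, b⟩ := hK.diag_inj _ _ _ _ e₁ e₂
      exact ⟨Subtype.ext a, b⟩
    · exfalso; clear * - e; revert j; decide
    · exfalso; clear * - e; revert j; decide
  · intro c j c' j' h₁ h₂
    rcases mergeKites_pair hK hcommon (d₀ j).2.2.2.1 (d₀ j').1 h₁ h₂ with
      ⟨e₁, e₂⟩ | ⟨e, -⟩ | ⟨-, e⟩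
    · exact hK.side_ne_diag _ _ _ _ e₁ e₂
    · exfalso; clear * - e; revert j; decide
    · exfalso; clear * - e; revert j'; decide
  · intro c j
    obtain ⟨c', l, h₁, h₂⟩ := hK.rev c j
    -- If `f` lies across the side, the kite beyond the partner of that side in the gluing takes its
    -- place.
    by_cases hc : c' = f
    · subst hc
      rcases cases_f l with rfl | rfl | rfl | rfl
      · obtain ⟨c'', n, hc, e₁, e₂⟩ := hK.exists_rev_ne c' (l + 1)
        rw [(d₁ l).1] at e₁
        refine ⟨⟨c'', hc⟩, _, ?_, mergeKites_congr (e₂.trans h₂)⟩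
        rw [mergeKites_of_eq_target e₁, mergeKites_of_eq h₁.symm]
      · obtain ⟨c'', l, hc, e₁, e₂⟩ := hK.exists_rev_ne c' i
        rw [(d₁ i).1] at h₂
        refine ⟨⟨c'', hc⟩, _, mergeKites_congr (e₁.trans h₁), ?_⟩
        rw [mergeKites_of_eq e₂, mergeKites_of_eq_target h₂.symm]
      · obtain ⟨c'', l, hc, e₁, e₂⟩ := hK.exists_rev_ne c' (i + 3)
        rw [(d₁ i).2.2.1] at e₁
        rw [(d₁ i).2.1] at h₂
        refine ⟨⟨c'', hc⟩, _, ?_, mergeKites_congr (e₂.trans h₂)⟩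
        rw [mergeKites_of_eq e₁, mergeKites_of_eq_target h₁.symm]
      · obtain ⟨c'', l, hc, e₁, e₂⟩ := hK.exists_rev_ne c' (i + 2)
        rw [(d₁ i).2.1] at e₁
        rw [(d₁ i).2.2.1] at h₂
        refine ⟨⟨c'', hc⟩, _, mergeKites_congr (e₁.trans h₁), ?_⟩
        rw [mergeKites_of_eq_target e₂, mergeKites_of_eq h₂.symm]
    · exact ⟨⟨c', hc⟩, l, mergeKites_congr h₁, mergeKites_congr h₂⟩

end Merge

end IsKiteDrawing

/-! SR-reductions preserve kite drawings. -/

theorem mergeGraph_comm {V : Type u} (G : SimpleGraph V) (x x₃ x₄ x₅ : V) :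
    mergeGraph G x x₃ x₄ x₅ = mergeGraph G x x₅ x₄ x₃ := by
  ext a b
  simp only [mergeGraph, Sym2.eq_swap (a := x₃) (b := x₅)]

/-- Merging two opposite corners of a kite preserves connectedness. -/
theorem mergeGraph_connected {V : Type u} {G : SimpleGraph V} {x x₃ x₄ x₅ : V}
    (hG : G.Connected) (hx : G.Adj x x₄) (hx₃ : G.Adj x x₃) (hx₅ : G.Adj x x₅)
    (hx₃₄ : G.Adj x₃ x₄) (hx₅₄ : G.Adj x₅ x₄) :
    ((mergeGraph G x x₃ x₄ x₅).induce {x}ᶜ).Connected := by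
  classical
  set H := (mergeGraph G x x₃ x₄ x₅).induce {x}ᶜ with hH
  have hne : x₄ ∈ ({x}ᶜ : Set V) := hx.ne'
  have n₃ : x₃ ∈ ({x}ᶜ : Set V) := hx₃.ne'
  have n₅ : x₅ ∈ ({x}ᶜ : Set V) := hx₅.ne'
  have hadj : ∀ a b : ({x}ᶜ : Set V), (mergeGraph G x x₃ x₄ x₅).Adj a b → H.Reachable a b :=
    fun a b h => SimpleGraph.Adj.reachable h
  have hs : ∀ a, a ≠ x₃ → a ≠ x₅ → ∀ b, s(b, a) ≠ s(x₃, x₅) := by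
    intro a h h' b e
    rcases Sym2.eq_iff.1 e with ⟨-, e⟩ | ⟨-, e⟩
    · exact h' e
    · exact h e
  have r₃ := hadj ⟨x₃, n₃⟩ ⟨x₄, hne⟩
    (Or.inl ⟨hx₃₄, hx₃.ne', hx.ne', hs _ hx₃₄.ne' hx₅₄.ne' _⟩)
  have r₅ := hadj ⟨x₅, n₅⟩ ⟨x₄, hne⟩
    (Or.inl ⟨hx₅₄, hx₅.ne', hx.ne', hs _ hx₃₄.ne' hx₅₄.ne' _⟩)
  have old : ∀ a b (ha : a ∈ ({x}ᶜ : Set V)) (hb : b ∈ ({x}ᶜ : Set V)), G.Adj a b →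
      H.Reachable ⟨a, ha⟩ ⟨b, hb⟩ := by
    intro a b ha hb h
    by_cases he : s(a, b) = s(x₃, x₅)
    · rcases Sym2.eq_iff.1 he with ⟨rfl, rfl⟩ | ⟨rfl, rfl⟩
      · exact r₃.trans r₅.symm
      · exact r₅.trans r₃.symm
    · exact hadj ⟨a, ha⟩ ⟨b, hb⟩ (Or.inl ⟨h, ha, hb, he⟩)
  have new : ∀ b (hb : b ∈ ({x}ᶜ : Set V)), G.Adj x b → H.Reachable ⟨x₄, hne⟩ ⟨b, hb⟩ := by
    intro b hb h
    by_cases hb' : b = x₄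
    · subst hb'
      exact .refl _
    · exact hadj ⟨x₄, hne⟩ ⟨b, hb⟩ (Or.inr (Or.inl ⟨rfl, hb', h⟩))
  let π : V → ({x}ᶜ : Set V) := fun a => if h : a = x then ⟨x₄, hne⟩ else ⟨a, h⟩
  have π_pos : π x = ⟨x₄, hne⟩ := dif_pos rfl
  have π_neg : ∀ a (h : a ∈ ({x}ᶜ : Set V)), π a = ⟨a, h⟩ := fun a h => dif_neg h
  have key : ∀ a b, G.Adj a b → H.Reachable (π a) (π b) := by
    intro a b h
    by_cases ha : a = x
    · subst ha
      have hb : b ∈ ({a}ᶜ : Set V) := h.ne'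
      rw [π_pos, π_neg b hb]
      exact new b hb h
    · by_cases hb : b = x
      · subst hb
        rw [π_pos, π_neg a ha]
        exact (new a ha h.symm).symm
      · rw [π_neg a ha, π_neg b hb]
        exact old a b ha hb h
  have walk : ∀ u v : V, G.Walk u v → H.Reachable (π u) (π v) := by
    intro u v w
    induction w with
    | nil => exact .refl _
    | cons h _ ih => exact (key _ _ h).trans ih
  have : Nonempty ({x}ᶜ : Set V) := ⟨⟨_, hne⟩⟩
  refine ⟨fun a b => ?_⟩
  obtain ⟨w⟩ := hG.preconnected a b
  have := walk _ _ w
  rwa [π_neg a a.2, π_neg b b.2] at this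

/-- An uncrossed edge has four common neighbours, so with only two of them `x x₄` must be a
diagonal. The other corners of its kite are common neighbours too, hence they are `x₃` and `x₅` in
some order. -/
theorem HasKiteDrawing.merge {V : Type u} {G : SimpleGraph V} {x x₃ x₄ x₅ : V}
    (hG : HasKiteDrawing G) (hx : G.Adj x x₄)
    (hx₃ : G.Adj x x₃) (hx₅ : G.Adj x x₅) (hx₃₄ : G.Adj x₃ x₄) (hx₅₄ : G.Adj x₅ x₄)
    (hcommon : ∀ w, G.Adj x w → G.Adj x₄ w → w = x₃ ∨ w = x₅) :
    HasKiteDrawing ((mergeGraph G x x₃ x₄ x₅).induce {x}ᶜ) := by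
  obtain ⟨hV, hconn, m, K, hK, hm, h1⟩ := hG
  -- the edge `x x₄` is crossed
  obtain ⟨f, i, hi, hi₂⟩ : ∃ f i, K f i = x ∧ K f (i + 2) = x₄ := by
    obtain ⟨f, i, hi, h | h⟩ := (hK.adj_iff _ _).1 hx
    · exact absurd h (hK.side_ne_of_common_subset (l := [x₃, x₅]) (by simp)
        (by simpa using hcommon) f i hi)
    · exact ⟨f, i, hi, h⟩
  have d : ∀ i : ZMod 4, i ≠ i + 1 ∧ i ≠ i + 3 ∧ i + 2 ≠ i + 1 ∧ i + 2 ≠ i + 3 ∧ i + 1 ≠ i + 3 := by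
    decide
  have c₁ := hcommon (K f (i + 1)) (hi ▸ hK.adj_of_ne f (d i).1) (hi₂ ▸ hK.adj_of_ne f (d i).2.2.1)
  have c₃ := hcommon (K f (i + 3)) (hi ▸ hK.adj_of_ne f (d i).2.1) (hi₂ ▸ hK.adj_of_ne f (d i).2.2.2.1)
  have c₁₃ := (hK.adj_of_ne f (d i).2.2.2.2).ne
  subst hi hi₂
  have hcommon' : ∀ w, G.Adj (K f i) w → G.Adj (K f (i + 2)) w →
      w = K f (i + 1) ∨ w = K f (i + 3) := by
    intro w h h'
    have := hcommon w h h'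
    grind
  have hmerge : mergeGraph G (K f i) x₃ (K f (i + 2)) x₅ =
      mergeGraph G (K f i) (K f (i + 1)) (K f (i + 2)) (K f (i + 3)) := by
    rcases c₁ with h | h <;> rcases c₃ with h' | h'
    · exact absurd (h.trans h'.symm) c₁₃
    · rw [h, h']
    · rw [h, h', mergeGraph_comm]
    · exact absurd (h.trans h'.symm) c₁₃
  have hM := hK.merge hcommon'
  rw [← hmerge] at hM
  have hS : ∀ c j, IsKiteDrawing.mergeKites K f i c j ∈ ({K f i}ᶜ : Set V) := by
    intro c j
    unfold IsKiteDrawing.mergeKites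
    split_ifs with h
    · exact hx.ne'
    · exact h
  have hI := hM.induce hS
  obtain ⟨c₀, j₀, hc₀, -, -⟩ := hK.exists_rev_ne f i
  -- A second kite lies across a side of `f`, so at least one kite survives.
  have hm2 : 2 ≤ m := by
    have h₁ := c₀.isLt
    have h₂ := f.isLt
    have : c₀.val ≠ f.val := fun h => hc₀ (Fin.ext h)
    omega
  have hF : Nat.card {c : Fin m // c ≠ f} = m - 1 := by
    rw [Nat.card_eq_fintype_card, Fintype.card_subtype_compl]
    simp
  refine ⟨inferInstance, ?_, m - 1, _, hI.congr (SimpleGraph.Iso.refl) (Finite.equivFinOfCardEq hF).symm,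
    ?_, by omega⟩
  · exact mergeGraph_connected hconn hx hx₃ hx₅ hx₃₄ hx₅₄
  · classical
    have := Fintype.ofFinite V
    rw [Nat.card_eq_fintype_card] at hm
    have : Nat.card ({K f i}ᶜ : Set V) = Fintype.card V - 1 := by
      rw [Nat.card_eq_fintype_card, Fintype.card_compl_set]
      simp
    omega

namespace IsSRSite

variable {V : Type u} {G : SimpleGraph V} {x x₁ x₂ x₃ x₄ x₅ x₆ : V}

theorem adj_iff (h : IsSRSite G x x₁ x₂ x₃ x₄ x₅ x₆) (w : V) :
    G.Adj x w ↔ w = x₁ ∨ w = x₂ ∨ w = x₃ ∨ w = x₄ ∨ w = x₅ ∨ w = x₆ := by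
  rw [← SimpleGraph.mem_neighborSet, h.nbr]
  rfl

/-- The result of an SR-reduction is obtained by merging `x` and `x₄`. -/
theorem srGraph_eq (h : IsSRSite G x x₁ x₂ x₃ x₄ x₅ x₆) :
    srGraph G x x₁ x₂ x₃ x₄ x₅ x₆ = (mergeGraph G x x₃ x₄ x₅).induce {x}ᶜ := by
  have hn := h.nodup
  have h₄₃ := h.adj₃₄.symm
  have h₄₅ := h.adj₄₅
  have h₃₄ := h.adj₃₄
  have h₅₄ := h.adj₄₅.symm
  have h14 := h.not_adj₁₄
  simp only [List.nodup_cons, List.mem_cons, List.not_mem_nil, or_false, not_or] at hn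
  ext ⟨a, ha⟩ ⟨b, hb⟩
  have ha : a ≠ x := ha
  have hb : b ≠ x := hb
  simp only [srGraph, mergeGraph, SimpleGraph.comap_adj, Function.Embedding.subtype_apply,
    SimpleGraph.sup_adj, SimpleGraph.deleteEdges_adj, SimpleGraph.fromEdgeSet_adj,
    Set.mem_singleton_iff, Set.mem_insert_iff, h.adj_iff, Sym2.eq_iff]
  grind

/-- The three forbidden edges at `x₄` leave `x₃` and `x₅` as the only common neighbours of `x` and
`x₄`. -/
theorem hasKiteDrawing (h : IsSRSite G x x₁ x₂ x₃ x₄ x₅ x₆) (hG : HasKiteDrawing G) :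
    HasKiteDrawing (srGraph G x x₁ x₂ x₃ x₄ x₅ x₆) := by
  rw [h.srGraph_eq]
  refine hG.merge ?_ ?_ ?_ h.adj₃₄ h.adj₄₅.symm ?_
  · simp [h.adj_iff]
  · simp [h.adj_iff]
  · simp [h.adj_iff]
  · intro w h₁ h₂
    rcases (h.adj_iff w).1 h₁ with rfl | rfl | rfl | rfl | rfl | rfl
    · exact absurd h₂.symm h.not_adj₁₄
    · exact absurd h₂.symm h.not_adj₂₄
    · exact Or.inl rfl
    · exact absurd h₂ G.irrefl
    · exact Or.inr rfl
    · exact absurd h₂.symm h.not_adj₆₄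

theorem map {W : Type v} {G' : SimpleGraph W} (h : IsSRSite G x x₁ x₂ x₃ x₄ x₅ x₆) (φ : G ≃g G') :
    IsSRSite G' (φ x) (φ x₁) (φ x₂) (φ x₃) (φ x₄) (φ x₅) (φ x₆) where
  nodup := by simpa using List.Nodup.map φ.injective h.nodup
  nbr := by
    ext w
    obtain ⟨w, rfl⟩ := φ.surjective w
    rw [SimpleGraph.mem_neighborSet, φ.map_adj_iff, h.adj_iff]
    simp
  adj₁₂ := φ.map_adj_iff.2 h.adj₁₂
  adj₂₃ := φ.map_adj_iff.2 h.adj₂₃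
  adj₃₄ := φ.map_adj_iff.2 h.adj₃₄
  adj₄₅ := φ.map_adj_iff.2 h.adj₄₅
  adj₅₆ := φ.map_adj_iff.2 h.adj₅₆
  adj₆₁ := φ.map_adj_iff.2 h.adj₆₁
  adj₁₃ := φ.map_adj_iff.2 h.adj₁₃
  adj₃₅ := φ.map_adj_iff.2 h.adj₃₅
  adj₅₁ := φ.map_adj_iff.2 h.adj₅₁
  not_adj₂₄ := fun e => h.not_adj₂₄ (φ.map_adj_iff.1 e)
  not_adj₆₄ := fun e => h.not_adj₆₄ (φ.map_adj_iff.1 e)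
  not_adj₁₄ := fun e => h.not_adj₁₄ (φ.map_adj_iff.1 e)

end IsSRSite

/-- Isomorphic graphs have isomorphic SR-reductions. -/
theorem nonempty_srGraph_iso {V : Type u} {W : Type v} {G : SimpleGraph V} {G' : SimpleGraph W}
    (φ : G ≃g G') (x x₁ x₂ x₃ x₄ x₅ x₆ : V) :
    Nonempty (srGraph G x x₁ x₂ x₃ x₄ x₅ x₆ ≃g
      srGraph G' (φ x) (φ x₁) (φ x₂) (φ x₃) (φ x₄) (φ x₅) (φ x₆)) := by
  refine ⟨⟨φ.toEquiv.subtypeEquiv fun a => ?_, fun {a b} => ?_⟩⟩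
  · simp
  · obtain ⟨a, ha⟩ := a
    obtain ⟨b, hb⟩ := b
    simp only [srGraph, SimpleGraph.comap_adj, Function.Embedding.subtype_apply,
      SimpleGraph.sup_adj, SimpleGraph.deleteEdges_adj, SimpleGraph.fromEdgeSet_adj,
      Equiv.subtypeEquiv_apply, Set.mem_singleton_iff, Set.mem_insert_iff, Sym2.eq_iff]
    rw [show φ.toEquiv a = φ a from rfl, show φ.toEquiv b = φ b from rfl, φ.map_adj_iff]
    simp only [ne_eq, φ.injective.eq_iff]

/-! Graphs given by a relation between natural numbers. -/

/-- The graph on the numbers satisfying `P` in which distinct numbers related by `R` are adjacent. -/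
def relGraph (P : ℕ → Prop) (R : ℕ → ℕ → Prop) : SimpleGraph {a // P a} where
  Adj a b := a.1 ≠ b.1 ∧ (R a b ∨ R b a)
  symm := ⟨fun _ _ h => ⟨h.1.symm, h.2.symm⟩⟩
  loopless := ⟨fun _ h => h.1 rfl⟩

theorem relGraph_adj {P : ℕ → Prop} {R : ℕ → ℕ → Prop} (a b : {a // P a}) :
    (relGraph P R).Adj a b ↔ a.1 ≠ b.1 ∧ (R a b ∨ R b a) := Iff.rfl

theorem nonempty_relGraph_iso {W : Type u} (H : SimpleGraph W) {P : ℕ → Prop} {R : ℕ → ℕ → Prop}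
    (h : ℕ → W) (inj : ∀ a b, P a → P b → h a = h b → a = b) (surj : ∀ w, ∃ a, P a ∧ h a = w)
    (adj : ∀ a b, P a → P b → (H.Adj (h a) (h b) ↔ a ≠ b ∧ (R a b ∨ R b a))) :
    Nonempty (relGraph P R ≃g H) := by
  refine ⟨⟨Equiv.ofBijective (fun a => h a.1) ⟨fun a b e => Subtype.ext (inj _ _ a.2 b.2 e),
    fun w => ?_⟩, fun {a b} => adj _ _ a.2 b.2⟩⟩
  obtain ⟨a, ha, rfl⟩ := surj w
  exact ⟨⟨a, ha⟩, rfl⟩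

theorem nonempty_relGraph_iso_relGraph {P P' : ℕ → Prop} {R R' : ℕ → ℕ → Prop} (h : ℕ → ℕ)
    (maps : ∀ a, P a → P' (h a))
    (inj : ∀ a b, P a → P b → h a = h b → a = b) (surj : ∀ w, P' w → ∃ a, P a ∧ h a = w)
    (adj : ∀ a b, P a → P b → (h a ≠ h b ∧ (R' (h a) (h b) ∨ R' (h b) (h a)) ↔
      a ≠ b ∧ (R a b ∨ R b a))) :
    Nonempty (relGraph P R ≃g relGraph P' R') := by
  refine ⟨⟨Equiv.ofBijective (fun a => ⟨h a.1, maps _ a.2⟩)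
    ⟨fun a b e => Subtype.ext (inj _ _ a.2 b.2 (congrArg Subtype.val e)),
    fun w => ?_⟩, fun {a b} => adj _ _ a.2 b.2⟩⟩
  obtain ⟨a, ha, e⟩ := surj w.1 w.2
  exact ⟨⟨a, ha⟩, Subtype.ext e⟩

/-- The effect of an SR-reduction on the relation. -/
def srRel (R : ℕ → ℕ → Prop) (x₁ x₂ x₃ x₄ x₅ x₆ a b : ℕ) : Prop :=
  (R a b ∧ ¬ (a = x₃ ∧ b = x₅) ∧ ¬ (a = x₅ ∧ b = x₃)) ∨ (a = x₄ ∧ (b = x₁ ∨ b = x₂ ∨ b = x₆))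

theorem nonempty_srGraph_relGraph_iso {P : ℕ → Prop} {R : ℕ → ℕ → Prop}
    (x x₁ x₂ x₃ x₄ x₅ x₆ : {a // P a}) :
    Nonempty (relGraph (fun a => P a ∧ a ≠ x) (srRel R x₁ x₂ x₃ x₄ x₅ x₆) ≃g
      srGraph (relGraph P R) x x₁ x₂ x₃ x₄ x₅ x₆) := by
  refine ⟨⟨Equiv.ofBijective
    (fun a => (⟨⟨a.1, a.2.1⟩, fun e => a.2.2 (congrArg Subtype.val e)⟩ : ({x}ᶜ : Set {a // P a})))
    ⟨fun a b e => ?_, fun w => ⟨⟨w.1.1, w.1.2, fun e => w.2 (Subtype.ext e)⟩, rfl⟩⟩, fun {a b} => ?_⟩⟩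
  · exact Subtype.ext (congrArg (fun y => y.1.1) e)
  · obtain ⟨a, ha, ha'⟩ := a
    obtain ⟨b, hb, hb'⟩ := b
    simp only [srGraph, srRel, relGraph_adj, SimpleGraph.comap_adj,
      Function.Embedding.subtype_apply,
      SimpleGraph.sup_adj, SimpleGraph.deleteEdges_adj, SimpleGraph.fromEdgeSet_adj,
      Set.mem_singleton_iff, Set.mem_insert_iff, Sym2.eq_iff, Subtype.ext_iff, ne_eq]
    grind

theorem isSRSite_relGraph {P : ℕ → Prop} {R : ℕ → ℕ → Prop} (x x₁ x₂ x₃ x₄ x₅ x₆ : {a // P a})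
    (nodup : [x₁.1, x₂.1, x₃.1, x₄.1, x₅.1, x₆.1].Nodup)
    (nbr : ∀ w, P w → (x.1 ≠ w ∧ (R x w ∨ R w x) ↔
      w = x₁ ∨ w = x₂ ∨ w = x₃ ∨ w = x₄ ∨ w = x₅ ∨ w = x₆))
    (adj : ∀ a b, (a = x₁.1 ∧ b = x₂.1 ∨ a = x₂.1 ∧ b = x₃.1 ∨ a = x₃.1 ∧ b = x₄.1 ∨
      a = x₄.1 ∧ b = x₅.1 ∨ a = x₅.1 ∧ b = x₆.1 ∨ a = x₆.1 ∧ b = x₁.1 ∨ a = x₁.1 ∧ b = x₃.1 ∨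
      a = x₃.1 ∧ b = x₅.1 ∨ a = x₅.1 ∧ b = x₁.1) → a ≠ b ∧ (R a b ∨ R b a))
    (not_adj : ∀ a, (a = x₁.1 ∨ a = x₂.1 ∨ a = x₆.1) → ¬ R a x₄ ∧ ¬ R x₄ a) :
    IsSRSite (relGraph P R) x x₁ x₂ x₃ x₄ x₅ x₆ where
  nodup := List.Nodup.of_map Subtype.val nodup
  nbr := by
    ext ⟨w, hw⟩
    simp only [SimpleGraph.mem_neighborSet, relGraph_adj, nbr w hw, Set.mem_insert_iff,
      Set.mem_singleton_iff, Subtype.ext_iff]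
  adj₁₂ := adj _ _ (by simp)
  adj₂₃ := adj _ _ (by simp)
  adj₃₄ := adj _ _ (by simp)
  adj₄₅ := adj _ _ (by simp)
  adj₅₆ := adj _ _ (by simp)
  adj₆₁ := adj _ _ (by simp)
  adj₁₃ := adj _ _ (by simp)
  adj₃₅ := adj _ _ (by simp)
  adj₅₁ := adj _ _ (by simp)
  not_adj₂₄ h := by have := not_adj x₂.1 (by simp); rw [relGraph_adj] at h; tauto
  not_adj₆₄ h := by have := not_adj x₆.1 (by simp); rw [relGraph_adj] at h; tauto
  not_adj₁₄ h := by have := not_adj x₁.1 (by simp); rw [relGraph_adj] at h; tauto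

/-- One SR-reduction of a graph with a kite drawing. -/
theorem exists_srReduces {V : Type u} {G : SimpleGraph V} (hG : HasKiteDrawing G) {P : ℕ → Prop}
    {R : ℕ → ℕ → Prop} (ψ : relGraph P R ≃g G) {x x₁ x₂ x₃ x₄ x₅ x₆ : {a // P a}}
    (hs : IsSRSite (relGraph P R) x x₁ x₂ x₃ x₄ x₅ x₆) :
    ∃ (W : Type u) (G' : SimpleGraph W), SRReduces G G' ∧ HasKiteDrawing G' ∧
      Nonempty (relGraph (fun a => P a ∧ a ≠ x) (srRel R x₁ x₂ x₃ x₄ x₅ x₆) ≃g G') := by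
  have hs' := hs.map ψ
  obtain ⟨e⟩ := nonempty_srGraph_iso ψ x x₁ x₂ x₃ x₄ x₅ x₆
  obtain ⟨e'⟩ := nonempty_srGraph_relGraph_iso (R := R) x x₁ x₂ x₃ x₄ x₅ x₆
  exact ⟨_, _, ⟨hG.isOptimalOnePlanar, _, _, _, _, _, _, _, hs', ⟨SimpleGraph.Iso.refl⟩⟩,
    hs'.hasKiteDrawing hG, ⟨e'.trans e⟩⟩

/-! Numberings of the extended wheel graph. -/

/-- The adjacency of the extended wheel graph, where the poles are `0` and `1` and the cycle is
formed by the `N` numbers from `c` on. -/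
def wheelRel (c N a b : ℕ) : Prop :=
  (a ≤ 1 ∧ c ≤ b) ∨ (c ≤ a ∧ c ≤ b ∧ (b = a + 1 ∨ b = a + 2 ∨ a + N = b + 1 ∨ a + N = b + 2))

/-- The numbers of the vertices of the extended wheel graph. -/
def wheelDom (c N a : ℕ) : Prop := a ≤ 1 ∨ (c ≤ a ∧ a < c + N)

/-- A numbering of the extended wheel graph, in which the number `o` belongs to the cycle
vertex `i`. -/
def wheelLabel (k : ℕ) (i : ZMod (2 * k)) (b : Bool) (o a : ℕ) : ZMod (2 * k) ⊕ Bool :=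
  if a = 0 then .inr b else if a = 1 then .inr (!b) else .inl (i + a - o)

theorem natCast_eq_natCast_of_lt {N u v : ℕ} (h₁ : u < v + 2 * N) (h₂ : v < u + 2 * N) :
    (u : ZMod N) = v ↔ u = v ∨ u = v + N ∨ v = u + N := by
  rw [ZMod.natCast_eq_natCast_iff, Nat.modEq_iff_dvd]
  constructor
  · rintro ⟨c, hc⟩
    have hN : 0 < (N : ℤ) := by omega
    have c₁ : c < 2 := by
      by_contra h
      have : (N : ℤ) * 2 ≤ N * c := by gcongr; omega
      omega
    have c₂ : -2 < c := by
      by_contra h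
      have : (N : ℤ) * c ≤ N * (-2) := by gcongr; omega
      omega
    obtain rfl | rfl | rfl : c = -1 ∨ c = 0 ∨ c = 1 := by omega
    all_goals omega
  · rintro (rfl | rfl | rfl)
    · simp
    · exact ⟨-1, by push_cast; ring⟩
    · exact ⟨1, by push_cast; ring⟩

section WheelLabel

variable {k : ℕ} {i : ZMod (2 * k)} {b : Bool} {o c : ℕ}

theorem wheelLabel_cycle {a : ℕ} (ha : 2 ≤ a) : wheelLabel k i b o a = .inl (i + a - o) := by
  rw [wheelLabel, if_neg (by omega), if_neg (by omega)]

theorem wheelLabel_zero : wheelLabel k i b o 0 = .inr b := rfl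

theorem wheelLabel_one : wheelLabel k i b o 1 = .inr (!b) := rfl

theorem wheelLabel_inj (hk : 1 ≤ k) {a a' : ℕ} (ha : wheelDom c (2 * k) a)
    (ha' : wheelDom c (2 * k) a') (h : wheelLabel k i b o a = wheelLabel k i b o a') : a = a' := by
  unfold wheelDom at ha ha'
  by_cases h₁ : 2 ≤ a <;> by_cases h₂ : 2 ≤ a'
  · rw [wheelLabel_cycle h₁, wheelLabel_cycle h₂] at h
    have : (a : ZMod (2 * k)) = a' := by
      have := Sum.inl_injective h
      simpa using this
    rw [natCast_eq_natCast_of_lt (by omega) (by omega)] at this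
    omega
  · rw [wheelLabel_cycle h₁] at h
    obtain rfl | rfl : a' = 0 ∨ a' = 1 := by omega
    all_goals simp [wheelLabel] at h
  · rw [wheelLabel_cycle h₂] at h
    obtain rfl | rfl : a = 0 ∨ a = 1 := by omega
    all_goals simp [wheelLabel] at h
  · obtain rfl | rfl : a = 0 ∨ a = 1 := by omega
    all_goals
      obtain rfl | rfl : a' = 0 ∨ a' = 1 := by omega
      all_goals simp [wheelLabel] at h ⊢

theorem wheelLabel_surj (hc : 2 ≤ c) (hk : 1 ≤ k) (y : ZMod (2 * k) ⊕ Bool) :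
    ∃ a, wheelDom c (2 * k) a ∧ wheelLabel k i b o a = y := by
  rcases y with j | b'
  · have : NeZero (2 * k) := ⟨by omega⟩
    let z : ZMod (2 * k) := j - i + o - c
    refine ⟨c + z.val, Or.inr ⟨by omega, ?_⟩, ?_⟩
    · have := ZMod.val_lt z
      omega
    · rw [wheelLabel_cycle (by omega)]
      push_cast
      rw [ZMod.natCast_zmod_val]
      simp only [z]
      congr 1
      ring
  · by_cases h : b' = b
    · exact ⟨0, Or.inl (by omega), by simp [wheelLabel, h]⟩
    · refine ⟨1, Or.inl (by omega), ?_⟩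
      cases b <;> cases b' <;> simp [wheelLabel] at h ⊢

/-- The numbers of cycle vertices lie in one interval of length `2 k`, so each congruence modulo `2
k` becomes an equation with at most one wrap-around, that is, linear arithmetic. -/
theorem wheelLabel_adj (hc : 2 ≤ c) (hk : 2 ≤ k) {a a' : ℕ} (ha : wheelDom c (2 * k) a)
    (ha' : wheelDom c (2 * k) a') :
    (extendedWheel k).Adj (wheelLabel k i b o a) (wheelLabel k i b o a') ↔
      a ≠ a' ∧ (wheelRel c (2 * k) a a' ∨ wheelRel c (2 * k) a' a) := by
  unfold wheelDom at ha ha'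
  unfold wheelRel
  by_cases h₁ : 2 ≤ a <;> by_cases h₂ : 2 ≤ a'
  · rw [wheelLabel_cycle h₁, wheelLabel_cycle h₂]
    change (_ ≠ _ ∧ _) ↔ _
    have e : ∀ (u v n : ℕ), (i + (u : ZMod (2 * k)) - o = i + v - o + (n : ℕ)) ↔
        (u : ZMod (2 * k)) = ((v + n : ℕ) : ZMod (2 * k)) := by
      intro u v n
      push_cast
      constructor
      · intro h
        linear_combination h
      · intro h
        linear_combination h
    have e₀ := e a a' 0
    have e₁ := e a a' 1
    have e₂ := e a a' 2
    have e₁' := e a' a 1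
    have e₂' := e a' a 2
    rw [natCast_eq_natCast_of_lt (by omega) (by omega)] at e₀ e₁ e₂ e₁' e₂'
    push_cast at e₀ e₁ e₂ e₁' e₂'
    rw [add_zero] at e₀
    rw [ne_eq, e₀, e₁, e₂, e₁', e₂']
    have ha : c ≤ a ∧ a < c + 2 * k := by omega
    have ha' : c ≤ a' ∧ a' < c + 2 * k := by omega
    have n₁ : ¬ a ≤ 1 := by omega
    have n₂ : ¬ a' ≤ 1 := by omega
    simp only [n₁, n₂, ha.1, ha'.1, false_and, true_and, false_or]
    generalize 2 * k = N at *
    constructor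
    · rintro ⟨h₀, h⟩
      refine ⟨by omega, ?_⟩
      rcases h with (h | h | h) | (h | h | h) | (h | h | h) | (h | h | h) <;> omega
    · rintro ⟨h₀, h⟩
      refine ⟨by omega, ?_⟩
      rcases h with (h | h | h | h) | (h | h | h | h) <;> omega
  · have h₃ : ∃ b', wheelLabel k i b o a' = .inr b' := by
      obtain rfl | rfl : a' = 0 ∨ a' = 1 := by omega
      · exact ⟨_, rfl⟩
      · exact ⟨_, rfl⟩
    obtain ⟨b', h₃⟩ := h₃
    rw [wheelLabel_cycle h₁, h₃]
    exact ⟨fun _ => by omega, fun _ => trivial⟩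
  · have h₃ : ∃ b', wheelLabel k i b o a = .inr b' := by
      obtain rfl | rfl : a = 0 ∨ a = 1 := by omega
      · exact ⟨_, rfl⟩
      · exact ⟨_, rfl⟩
    obtain ⟨b', h₃⟩ := h₃
    rw [wheelLabel_cycle h₂, h₃]
    exact ⟨fun _ => by omega, fun _ => trivial⟩
  · have h₃ : ∀ a : ℕ, ¬ 2 ≤ a → ∃ b', wheelLabel k i b o a = .inr b' := by
      intro a ha
      obtain rfl | rfl : a = 0 ∨ a = 1 := by omega
      · exact ⟨_, rfl⟩
      · exact ⟨_, rfl⟩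
    obtain ⟨b', h₄⟩ := h₃ a h₁
    obtain ⟨b'', h₅⟩ := h₃ a' h₂
    rw [h₄, h₅]
    exact ⟨fun h => h.elim, fun h => by omega⟩

theorem nonempty_relGraph_iso_extendedWheel (hc : 2 ≤ c) (hk : 2 ≤ k) :
    Nonempty (relGraph (wheelDom c (2 * k)) (wheelRel c (2 * k)) ≃g extendedWheel k) :=
  nonempty_relGraph_iso _ (wheelLabel k 0 true c) (fun _ _ => wheelLabel_inj (by omega))
    (wheelLabel_surj hc (by omega)) (fun _ _ => wheelLabel_adj hc hk)

end WheelLabel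

/-! Graphs that an SR-reduction turns into an extended wheel graph. -/

/-- The inverse SR-reduction at the pole `0` of the extended wheel graph; the new vertex is `2`. -/
def srExpansion (N n₂ n₃ n₅ n₆ a b : ℕ) : Prop :=
  (wheelRel 3 N a b ∧ ¬ (a = 0 ∧ (b = 5 ∨ b = n₂ ∨ b = n₆))) ∨ (a = n₃ ∧ b = n₅) ∨
    (a = 2 ∧ (b = 0 ∨ b = 5 ∨ b = n₂ ∨ b = n₃ ∨ b = n₅ ∨ b = n₆))

/-- The other end of an uncrossed edge at `a`, together with the four common neighbours of its ends.
The bound excludes vertices of degree four when a reduction is undone. -/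
theorem IsKiteDrawing.exists_five_neighbors {V : Type u} {F : Type v} {G : SimpleGraph V}
    {K : F → ZMod 4 → V} (h : IsKiteDrawing G K) {a b : V} (hab : G.Adj a b) :
    ∃ l : List V, l.Nodup ∧ l.length = 5 ∧ ∀ z ∈ l, G.Adj a z := by
  obtain ⟨c, i, rfl, -⟩ := (h.adj_iff a b).1 hab
  obtain ⟨l, hl, hlen, hz⟩ := h.exists_common_neighbors c i
  refine ⟨K c (i + 1) :: l, List.nodup_cons.2 ⟨fun hm => ?_, hl⟩, by simp [hlen], ?_⟩
  · exact (hz _ hm).2.ne rfl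
  · intro z hm
    rcases List.mem_cons.1 hm with rfl | hm
    · exact h.adj_side c i
    · exact (hz z hm).1

/-- Cycle vertices of the extended wheel graph have at most six neighbours. -/
theorem extendedWheel_neighbors (k : ℕ) (j : ZMod (2 * k)) (y : ZMod (2 * k) ⊕ Bool)
    (h : (extendedWheel k).Adj (.inl j) y) :
    y ∈ [.inl (j + 1), .inl (j - 1), .inl (j + 2), .inl (j - 2), .inr true, .inr false] := by
  rcases y with i | b
  · obtain ⟨-, h⟩ := h
    simp only [List.mem_cons, Sum.inl.injEq, reduceCtorEq, List.not_mem_nil, or_false]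
    rcases h with rfl | rfl | rfl | rfl <;> simp
  · cases b <;> simp

/-- The reduction can be undone: the deleted edge `x₃x₅` was present and the three added edges were
absent, so away from `x` the graph `G` is recovered from its reduction. -/
theorem IsSRSite.srGraph_adj {V : Type u} {G : SimpleGraph V} {x x₁ x₂ x₃ x₄ x₅ x₆ : V}
    (h : IsSRSite G x x₁ x₂ x₃ x₄ x₅ x₆) (a b : ({x}ᶜ : Set V)) :
    G.Adj a b ↔ ((srGraph G x x₁ x₂ x₃ x₄ x₅ x₆).Adj a b ∧
        ¬ (a.1 = x₄ ∧ (b.1 = x₁ ∨ b.1 = x₂ ∨ b.1 = x₆)) ∧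
        ¬ (b.1 = x₄ ∧ (a.1 = x₁ ∨ a.1 = x₂ ∨ a.1 = x₆))) ∨
      (a.1 = x₃ ∧ b.1 = x₅) ∨ (a.1 = x₅ ∧ b.1 = x₃) := by
  obtain ⟨a, ha⟩ := a
  obtain ⟨b, hb⟩ := b
  have h₁ := h.adj₃₅
  have h₂ := h.not_adj₁₄
  have h₃ := h.not_adj₂₄
  have h₄ := h.not_adj₆₄
  simp only [srGraph, SimpleGraph.comap_adj, Function.Embedding.subtype_apply,
    SimpleGraph.sup_adj, SimpleGraph.deleteEdges_adj, SimpleGraph.fromEdgeSet_adj,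
    Set.mem_singleton_iff, Set.mem_insert_iff, Sym2.eq_iff]
  have h₅ := h₁.symm
  have h₂' := fun e : G.Adj x₄ x₁ => h₂ e.symm
  have h₃' := fun e : G.Adj x₄ x₂ => h₃ e.symm
  have h₄' := fun e : G.Adj x₄ x₆ => h₄ e.symm
  constructor
  · intro hab
    by_cases h35 : (a = x₃ ∧ b = x₅) ∨ (a = x₅ ∧ b = x₃)
    · exact Or.inr h35
    · refine Or.inl ⟨Or.inl ⟨hab, h35⟩, ?_, ?_⟩
      · rintro ⟨rfl, rfl | rfl | rfl⟩ <;> contradiction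
      · rintro ⟨rfl, rfl | rfl | rfl⟩ <;> contradiction
  · rintro (⟨⟨hab, -⟩ | ⟨hab, -⟩, h₆, h₇⟩ | ⟨rfl, rfl⟩ | ⟨rfl, rfl⟩)
    · exact hab
    · exfalso; tauto
    · exact h₁
    · exact h₅

/-- A cycle vertex of the wheel has at most six neighbours. If `x₄` were one, undoing the reduction
would take away `x₁`, `x₂`, `x₆` and add only `x`, leaving degree at most four. So `x₄` is a pole,
and `x₁`, `x₂`, `x₆`, being joined to it in the wheel, lie on the cycle. -/
theorem IsSRSite.exists_labelling {V : Type u} {G : SimpleGraph V} {x x₁ x₂ x₃ x₄ x₅ x₆ : V} {k : ℕ}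
    (hk : 2 ≤ k) (hG : HasKiteDrawing G) (h : IsSRSite G x x₁ x₂ x₃ x₄ x₅ x₆)
    (φ : extendedWheel k ≃g srGraph G x x₁ x₂ x₃ x₄ x₅ x₆) :
    ∃ g : ℕ → V, (∀ a b, a < 2 * k + 3 → b < 2 * k + 3 → g a = g b → a = b) ∧
      (∀ v, ∃ a, a < 2 * k + 3 ∧ g a = v) ∧
      g 2 = x ∧ g 0 = x₄ ∧ g 5 = x₁ ∧
      (∀ a b, wheelDom 3 (2 * k) a → wheelDom 3 (2 * k) b → (G.Adj (g a) (g b) ↔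
        ((a ≠ b ∧ (wheelRel 3 (2 * k) a b ∨ wheelRel 3 (2 * k) b a)) ∧
          ¬ (g a = x₄ ∧ (g b = x₁ ∨ g b = x₂ ∨ g b = x₆)) ∧
          ¬ (g b = x₄ ∧ (g a = x₁ ∨ g a = x₂ ∨ g a = x₆))) ∨
        (g a = x₃ ∧ g b = x₅) ∨ (g a = x₅ ∧ g b = x₃))) ∧
      (∀ a, wheelDom 3 (2 * k) a → (g a = x₁ ∨ g a = x₂ ∨ g a = x₆) → 3 ≤ a) ∧
      ∀ a b, wheelDom 3 (2 * k) a → wheelDom 3 (2 * k) b → g a = x₃ → g b = x₅ →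
        ¬ (wheelRel 3 (2 * k) a b ∨ wheelRel 3 (2 * k) b a) := by
  classical
  have hφ := fun y y' : ZMod (2 * k) ⊕ Bool => φ.map_adj_iff (v := y) (w := y')
  let f : ZMod (2 * k) ⊕ Bool → V := fun y => (φ y).1
  have hf : Function.Injective f := fun y y' e => φ.injective (Subtype.ext e)
  have hfx : ∀ y, f y ≠ x := fun y => (φ y).2
  have hfs : ∀ v, v ≠ x → ∃ y, f y = v := by
    intro v hv
    obtain ⟨y, hy⟩ := φ.surjective ⟨v, hv⟩
    exact ⟨y, congrArg Subtype.val hy⟩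
  have hadj : ∀ y y', G.Adj (f y) (f y') ↔ ((extendedWheel k).Adj y y' ∧
        ¬ (f y = x₄ ∧ (f y' = x₁ ∨ f y' = x₂ ∨ f y' = x₆)) ∧
        ¬ (f y' = x₄ ∧ (f y = x₁ ∨ f y = x₂ ∨ f y = x₆))) ∨
      (f y = x₃ ∧ f y' = x₅) ∨ (f y = x₅ ∧ f y' = x₃) := by
    intro y y'
    rw [← hφ]
    exact h.srGraph_adj (φ y) (φ y')
  have hnx : ∀ w, (w = x₁ ∨ w = x₂ ∨ w = x₃ ∨ w = x₄ ∨ w = x₅ ∨ w = x₆) → w ≠ x := fun w hw =>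
    ((h.adj_iff w).2 hw).ne'
  have hn := h.nodup
  simp only [List.nodup_cons, List.mem_cons, List.not_mem_nil, or_false, not_or] at hn
  obtain ⟨⟨n12, n13, n14, n15, n16⟩, ⟨n23, n24, n25, n26⟩, ⟨n34, n35, n36⟩, ⟨n45, n46⟩, n56, -⟩ :=
    hn
  obtain ⟨y₁, h₁⟩ := hfs x₁ (hnx _ (by tauto))
  obtain ⟨y₂, h₂⟩ := hfs x₂ (hnx _ (by tauto))
  obtain ⟨y₄, h₄⟩ := hfs x₄ (hnx _ (by tauto))
  obtain ⟨y₆, h₆⟩ := hfs x₆ (hnx _ (by tauto))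
  have wheel_of : ∀ y, (f y = x₁ ∨ f y = x₂ ∨ f y = x₆) → (extendedWheel k).Adj y₄ y := by
    intro y hy
    rw [← hφ]
    refine Or.inr ⟨?_, ?_⟩
    · change s(f y₄, f y) ∈ _
      rw [h₄]
      rcases hy with hy | hy | hy <;> simp [hy]
    · change f y₄ ≠ f y
      rw [h₄]
      rcases hy with hy | hy | hy <;> rw [hy]
      · exact Ne.symm n14
      · exact Ne.symm n24
      · exact n46
  have not_wheel : ∀ y y', f y = x₃ → f y' = x₅ → ¬ (extendedWheel k).Adj y y' := by
    intro y y' hy hy' hH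
    rw [← hφ] at hH
    rcases hH with hH | ⟨hH, -⟩
    · refine (SimpleGraph.deleteEdges_adj.1 hH).2 ?_
      change s(f y, f y') ∈ _
      rw [hy, hy']
      rfl
    · change s(f y, f y') ∈ _ at hH
      rw [hy, hy'] at hH
      simp only [Set.mem_insert_iff, Set.mem_singleton_iff, Sym2.eq_iff] at hH
      tauto
  obtain ⟨hV, hconn, m, K, hK, hm, h1⟩ := hG
  -- `x₄` is a pole, otherwise its degree would be four
  obtain ⟨b, rfl⟩ : ∃ b, y₄ = .inr b := by
    rcases y₄ with j | b
    · exfalso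
      obtain ⟨l, hl, hlen, hz⟩ := hK.exists_five_neighbors h.adj₄₅
      let L : List V := List.map f
        [.inl (j + 1), .inl (j - 1), .inl (j + 2), .inl (j - 2), .inr true, .inr false]
      have mL : ∀ y, (extendedWheel k).Adj (.inl j) y → f y ∈ L := fun y hy =>
        List.mem_map_of_mem (extendedWheel_neighbors k j _ hy)
      have m₁ : x₁ ∈ L := h₁ ▸ mL y₁ (wheel_of _ (by tauto))
      have m₂ : x₂ ∈ L.erase x₁ :=
        (List.mem_erase_of_ne (Ne.symm n12)).2 (h₂ ▸ mL y₂ (wheel_of _ (by tauto)))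
      have m₆ : x₆ ∈ (L.erase x₁).erase x₂ := (List.mem_erase_of_ne (Ne.symm n26)).2
        ((List.mem_erase_of_ne (Ne.symm n16)).2 (h₆ ▸ mL y₆ (wheel_of _ (by tauto))))
      have hsub : l.Subperm (x :: ((L.erase x₁).erase x₂).erase x₆) := by
        refine hl.subperm fun z hzl => ?_
        by_cases hzx : z = x
        · exact hzx ▸ List.mem_cons_self
        · obtain ⟨y, rfl⟩ := hfs z hzx
          have hy := hz _ hzl
          rw [← h₄, hadj] at hy
          have : (extendedWheel k).Adj (.inl j) y ∧ ¬ (f y = x₁ ∨ f y = x₂ ∨ f y = x₆) := by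
            rcases hy with ⟨hy, hy', -⟩ | ⟨hy, -⟩ | ⟨hy, -⟩
            · exact ⟨hy, fun e => hy' ⟨h₄, e⟩⟩
            · exact absurd (h₄.symm.trans hy).symm n34
            · exact absurd (h₄.symm.trans hy) n45
          obtain ⟨hy, hy'⟩ := this
          exact List.mem_cons_of_mem _ ((List.mem_erase_of_ne (by tauto)).2
            ((List.mem_erase_of_ne (by tauto)).2 ((List.mem_erase_of_ne (by tauto)).2 (mL y hy))))
      have := hsub.length_le
      rw [hlen, List.length_cons, List.length_erase_of_mem m₆, List.length_erase_of_mem m₂,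
        List.length_erase_of_mem m₁] at this
      simp [L] at this
    · exact ⟨b, rfl⟩
  obtain ⟨i, rfl⟩ : ∃ i, y₁ = .inl i := by
    have := wheel_of y₁ (by tauto)
    rcases y₁ with i | b'
    · exact ⟨i, rfl⟩
    · exact this.elim
  have dom : ∀ a, wheelDom 3 (2 * k) a → a ≠ 2 := by
    unfold wheelDom
    intro a ha
    omega
  have dom' : ∀ a, a < 2 * k + 3 → a ≠ 2 → wheelDom 3 (2 * k) a := by
    unfold wheelDom
    intro a ha
    omega
  -- Poles are `0` and `1`, the removed vertex is `2`, and the cycle starts at `3`. Giving `x₁` the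
  -- number `5` makes its cycle neighbours `3`, `4`, `6`, `7`, without wrap-around.
  refine ⟨fun a => if a = 2 then x else f (wheelLabel k i b 5 a), ?_, ?_, ?_, ?_, ?_, ?_, ?_, ?_⟩
  · intro a a' ha ha' e
    by_cases h₁ : a = 2 <;> by_cases h₂ : a' = 2
    · rw [h₁, h₂]
    · simp only [h₁, h₂, if_true, if_false] at e
      exact absurd e.symm (hfx _)
    · simp only [h₁, h₂, if_true, if_false] at e
      exact absurd e (hfx _)
    · simp only [h₁, h₂, if_false] at e
      exact wheelLabel_inj (by omega) (dom' a ha h₁) (dom' a' ha' h₂) (hf e)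
  · intro v
    by_cases hv : v = x
    · exact ⟨2, by omega, by simp [hv]⟩
    · obtain ⟨y, rfl⟩ := hfs v hv
      obtain ⟨a, ha, rfl⟩ := wheelLabel_surj (i := i) (b := b) (o := 5) (c := 3) (by omega)
        (by omega : 1 ≤ k) y
      refine ⟨a, ?_, if_neg (dom a ha)⟩
      unfold wheelDom at ha
      omega
  · rfl
  · exact h₄
  · simp only [show (5 : ℕ) ≠ 2 by omega, if_false]
    rw [wheelLabel_cycle (by omega), add_sub_cancel_right, h₁]
  · intro a a' ha ha'
    simp only [dom a ha, dom a' ha', if_false]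
    rw [hadj, wheelLabel_adj (by omega) hk ha ha']
  · intro a ha e
    simp only [dom a ha, if_false] at e
    have h0 : wheelDom 3 (2 * k) 0 := Or.inl (by omega)
    have := (wheelLabel_adj (i := i) (b := b) (o := 5) (by omega) hk h0 ha).1 (wheel_of _ e)
    unfold wheelRel at this
    omega
  · intro a a' ha ha' e e' hw
    simp only [dom a ha, dom a' ha', if_false] at e e'
    refine not_wheel _ _ e e' ((wheelLabel_adj (by omega) hk ha ha').2 ⟨?_, hw⟩)
    rintro rfl
    exact n35 (e.symm.trans e')

/-- The cycle vertices near the number `5`. -/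
theorem wheelRel_near {N n : ℕ} (hN : 10 ≤ N) (h₁ : 3 ≤ n ∧ n < N + 3)
    (h : 5 ≠ n ∧ (wheelRel 3 N 5 n ∨ wheelRel 3 N n 5)) : n = 3 ∨ n = 4 ∨ n = 6 ∨ n = 7 := by
  unfold wheelRel at h
  rcases h.2 with (h | ⟨-, -, h | h | h | h⟩) | (h | ⟨-, -, h | h | h | h⟩) <;> omega

theorem wheelRel_iff_of_near {N a b : ℕ} (hN : 10 ≤ N) (ha : a = 3 ∨ a = 4 ∨ a = 6 ∨ a = 7)
    (hb : b = 3 ∨ b = 4 ∨ b = 6 ∨ b = 7) : wheelRel 3 N a b ↔ b = a + 1 ∨ b = a + 2 := by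
  have h₁ : ¬ a ≤ 1 := by omega
  have h₂ : 3 ≤ a := by omega
  have h₃ : 3 ≤ b := by omega
  have h₄ : ¬ a + N = b + 1 := by omega
  have h₅ : ¬ a + N = b + 2 := by omega
  simp [wheelRel, h₁, h₂, h₃, h₄, h₅]

/-- The adjacencies in question form the path `3, 4, 6, 7`. The non-adjacent pair `n₃`, `n₅` is `{3,
7}`, `{3, 6}` or `{4, 7}`, in either order, and each choice determines `n₂` and `n₆`. -/
theorem near_cases {n₂ n₃ n₅ n₆ : ℕ} (c₂ : n₂ = 3 ∨ n₂ = 4 ∨ n₂ = 6 ∨ n₂ = 7)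
    (c₃ : n₃ = 3 ∨ n₃ = 4 ∨ n₃ = 6 ∨ n₃ = 7) (c₅ : n₅ = 3 ∨ n₅ = 4 ∨ n₅ = 6 ∨ n₅ = 7)
    (c₆ : n₆ = 3 ∨ n₆ = 4 ∨ n₆ = 6 ∨ n₆ = 7)
    (w₂₃ : (n₃ = n₂ + 1 ∨ n₃ = n₂ + 2) ∨ (n₂ = n₃ + 1 ∨ n₂ = n₃ + 2))
    (w₅₆ : (n₆ = n₅ + 1 ∨ n₆ = n₅ + 2) ∨ (n₅ = n₆ + 1 ∨ n₅ = n₆ + 2))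
    (w₃₅ : ¬ ((n₅ = n₃ + 1 ∨ n₅ = n₃ + 2) ∨ (n₃ = n₅ + 1 ∨ n₃ = n₅ + 2)))
    (ne : n₂ ≠ n₃ ∧ n₂ ≠ n₅ ∧ n₂ ≠ n₆ ∧ n₃ ≠ n₅ ∧ n₃ ≠ n₆ ∧ n₅ ≠ n₆) :
      (n₂ = 4 ∧ n₃ = 3 ∧ n₅ = 7 ∧ n₆ = 6) ∨ (n₂ = 4 ∧ n₃ = 3 ∧ n₅ = 6 ∧ n₆ = 7) ∨
        (n₂ = 3 ∧ n₃ = 4 ∧ n₅ = 7 ∧ n₆ = 6) ∨ (n₂ = 6 ∧ n₃ = 7 ∧ n₅ = 3 ∧ n₆ = 4) ∨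
        (n₂ = 7 ∧ n₃ = 6 ∧ n₅ = 3 ∧ n₆ = 4) ∨ (n₂ = 6 ∧ n₃ = 7 ∧ n₅ = 4 ∧ n₆ = 3) := by
  obtain ⟨h₁, h₂, h₃, h₄, h₅, h₆⟩ := ne
  rcases c₃ with rfl | rfl | rfl | rfl <;> rcases c₅ with rfl | rfl | rfl | rfl <;>
    simp at w₃₅ h₄ <;>
    rcases c₂ with rfl | rfl | rfl | rfl <;> simp at h₁ h₂ w₂₃ <;>
    rcases c₆ with rfl | rfl | rfl | rfl <;> simp at h₃ h₅ h₆ w₅₆ ⊢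

theorem srExpansion_cases {N n₂ n₃ n₅ n₆ : ℕ} (hN : 10 ≤ N) (b₂ : 3 ≤ n₂ ∧ n₂ < N + 3)
    (b₃ : 3 ≤ n₃ ∧ n₃ < N + 3) (b₅ : 3 ≤ n₅ ∧ n₅ < N + 3) (b₆ : 3 ≤ n₆ ∧ n₆ < N + 3)
    (w₂ : 5 ≠ n₂ ∧ (wheelRel 3 N 5 n₂ ∨ wheelRel 3 N n₂ 5))
    (w₃ : 5 ≠ n₃ ∧ (wheelRel 3 N 5 n₃ ∨ wheelRel 3 N n₃ 5))
    (w₅ : 5 ≠ n₅ ∧ (wheelRel 3 N 5 n₅ ∨ wheelRel 3 N n₅ 5))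
    (w₆ : 5 ≠ n₆ ∧ (wheelRel 3 N 5 n₆ ∨ wheelRel 3 N n₆ 5))
    (w₂₃ : wheelRel 3 N n₂ n₃ ∨ wheelRel 3 N n₃ n₂) (w₅₆ : wheelRel 3 N n₅ n₆ ∨ wheelRel 3 N n₆ n₅)
    (w₃₅ : ¬ (wheelRel 3 N n₃ n₅ ∨ wheelRel 3 N n₅ n₃))
    (ne : n₂ ≠ n₃ ∧ n₂ ≠ n₅ ∧ n₂ ≠ n₆ ∧ n₃ ≠ n₅ ∧ n₃ ≠ n₆ ∧ n₅ ≠ n₆) :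
    (n₂ = 4 ∧ n₃ = 3 ∧ n₅ = 7 ∧ n₆ = 6) ∨ (n₂ = 4 ∧ n₃ = 3 ∧ n₅ = 6 ∧ n₆ = 7) ∨
      (n₂ = 3 ∧ n₃ = 4 ∧ n₅ = 7 ∧ n₆ = 6) ∨ (n₂ = 6 ∧ n₃ = 7 ∧ n₅ = 3 ∧ n₆ = 4) ∨
      (n₂ = 7 ∧ n₃ = 6 ∧ n₅ = 3 ∧ n₆ = 4) ∨ (n₂ = 6 ∧ n₃ = 7 ∧ n₅ = 4 ∧ n₆ = 3) := by
  have c₂ := wheelRel_near hN b₂ w₂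
  have c₃ := wheelRel_near hN b₃ w₃
  have c₅ := wheelRel_near hN b₅ w₅
  have c₆ := wheelRel_near hN b₆ w₆
  rw [wheelRel_iff_of_near hN c₂ c₃, wheelRel_iff_of_near hN c₃ c₂] at w₂₃
  rw [wheelRel_iff_of_near hN c₅ c₆, wheelRel_iff_of_near hN c₆ c₅] at w₅₆
  rw [wheelRel_iff_of_near hN c₃ c₅, wheelRel_iff_of_near hN c₅ c₃] at w₃₅
  exact near_cases c₂ c₃ c₅ c₆ w₂₃ w₅₆ w₃₅ ne

/-- A graph with a kite drawing that an SR-reduction turns into an extended wheel graph is given by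
an inverse SR-reduction at a pole. -/
theorem IsSRSite.exists_srExpansion {V : Type u} {G : SimpleGraph V} {x x₁ x₂ x₃ x₄ x₅ x₆ : V}
    {k : ℕ} (hk : 5 ≤ k) (hG : HasKiteDrawing G) (h : IsSRSite G x x₁ x₂ x₃ x₄ x₅ x₆)
    (φ : extendedWheel k ≃g srGraph G x x₁ x₂ x₃ x₄ x₅ x₆) :
    ∃ n₂ n₃ n₅ n₆, Nonempty (relGraph (· < 2 * k + 3) (srExpansion (2 * k) n₂ n₃ n₅ n₆) ≃g G) ∧
      ((n₂ = 4 ∧ n₃ = 3 ∧ n₅ = 7 ∧ n₆ = 6) ∨ (n₂ = 4 ∧ n₃ = 3 ∧ n₅ = 6 ∧ n₆ = 7) ∨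
        (n₂ = 3 ∧ n₃ = 4 ∧ n₅ = 7 ∧ n₆ = 6) ∨ (n₂ = 6 ∧ n₃ = 7 ∧ n₅ = 3 ∧ n₆ = 4) ∨
        (n₂ = 7 ∧ n₃ = 6 ∧ n₅ = 3 ∧ n₆ = 4) ∨ (n₂ = 6 ∧ n₃ = 7 ∧ n₅ = 4 ∧ n₆ = 3)) := by
  obtain ⟨g, inj, surj, g2, g0, g5, hadj, hge, hnot⟩ := h.exists_labelling (by omega) hG φ
  have hn := h.nodup
  simp only [List.nodup_cons, List.mem_cons, List.not_mem_nil, or_false, not_or] at hn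
  obtain ⟨⟨n12, n13, n14, n15, n16⟩, ⟨n23, n24, n25, n26⟩, ⟨n34, n35, n36⟩, ⟨n45, n46⟩, n56, -⟩ :=
    hn
  have dom : ∀ a, wheelDom 3 (2 * k) a ↔ a < 2 * k + 3 ∧ a ≠ 2 := by
    unfold wheelDom
    intro a
    omega
  have hnum : ∀ w, G.Adj x w → ∃ n, (n < 2 * k + 3 ∧ n ≠ 2) ∧ g n = w ∧
      ∀ a, a < 2 * k + 3 → (g a = w ↔ a = n) := by
    intro w hw
    obtain ⟨n, hn, rfl⟩ := surj w
    refine ⟨n, ⟨hn, ?_⟩, rfl, fun a ha => ⟨fun e => inj _ _ ha hn e, fun e => e ▸ rfl⟩⟩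
    rintro rfl
    rw [g2] at hw
    exact hw.ne rfl
  obtain ⟨n₂, d₂, e₂, i₂⟩ := hnum x₂ ((h.adj_iff _).2 (by simp))
  obtain ⟨n₃, d₃, e₃, i₃⟩ := hnum x₃ ((h.adj_iff _).2 (by simp))
  obtain ⟨n₅, d₅, e₅, i₅⟩ := hnum x₅ ((h.adj_iff _).2 (by simp))
  obtain ⟨n₆, d₆, e₆, i₆⟩ := hnum x₆ ((h.adj_iff _).2 (by simp))
  have i₁ : ∀ a, a < 2 * k + 3 → (g a = x₁ ↔ a = 5) := fun a ha =>
    ⟨fun e => inj _ _ ha (by omega) (e.trans g5.symm), fun e => e ▸ g5⟩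
  have i₄ : ∀ a, a < 2 * k + 3 → (g a = x₄ ↔ a = 0) := fun a ha =>
    ⟨fun e => inj _ _ ha (by omega) (e.trans g0.symm), fun e => e ▸ g0⟩
  have wheel : ∀ a b, (a < 2 * k + 3 ∧ a ≠ 2) → (b < 2 * k + 3 ∧ b ≠ 2) → G.Adj (g a) (g b) →
      ¬ (g a = x₃ ∧ g b = x₅) → ¬ (g a = x₅ ∧ g b = x₃) →
      a ≠ b ∧ (wheelRel 3 (2 * k) a b ∨ wheelRel 3 (2 * k) b a) := by
    intro a b ha hb hab h₁ h₂
    have := (hadj a b ((dom a).2 ha) ((dom b).2 hb)).1 hab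
    clear * - this h₁ h₂
    tauto
  have d1 : 5 < 2 * k + 3 ∧ 5 ≠ 2 := by omega
  have w12 := wheel 5 n₂ d1 d₂ (by rw [g5, e₂]; exact h.adj₁₂) (fun e => n13 (g5.symm.trans e.1))
    (fun e => n15 (g5.symm.trans e.1))
  have w13 := wheel 5 n₃ d1 d₃ (by rw [g5, e₃]; exact h.adj₁₃) (fun e => n13 (g5.symm.trans e.1))
    (fun e => n15 (g5.symm.trans e.1))
  have w15 := wheel 5 n₅ d1 d₅ (by rw [g5, e₅]; exact h.adj₅₁.symm)
    (fun e => n13 (g5.symm.trans e.1))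
    (fun e => n15 (g5.symm.trans e.1))
  have w16 := wheel 5 n₆ d1 d₆ (by rw [g5, e₆]; exact h.adj₆₁.symm)
    (fun e => n13 (g5.symm.trans e.1))
    (fun e => n15 (g5.symm.trans e.1))
  have w23 := wheel n₂ n₃ d₂ d₃ (by rw [e₂, e₃]; exact h.adj₂₃) (fun e => n23 (e₂.symm.trans e.1))
    (fun e => n25 (e₂.symm.trans e.1))
  have w56 := wheel n₅ n₆ d₅ d₆ (by rw [e₅, e₆]; exact h.adj₅₆) (fun e => n35 (e.1.symm.trans e₅))
    (fun e => n36 (e.2.symm.trans e₆))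
  have w34 := wheel n₃ 0 d₃ (by omega) (by rw [e₃, g0]; exact h.adj₃₄)
    (fun e => n45 (g0.symm.trans e.2)) (fun e => n35 (e₃.symm.trans e.1))
  have w45 := wheel n₅ 0 d₅ (by omega) (by rw [e₅, g0]; exact h.adj₄₅.symm)
    (fun e => n35 (e.1.symm.trans e₅)) (fun e => n34 (e.2.symm.trans g0))
  have b₂ := hge n₂ ((dom _).2 d₂) (Or.inr (Or.inl e₂))
  have b₆ := hge n₆ ((dom _).2 d₆) (Or.inr (Or.inr e₆))
  have w35 := hnot n₃ n₅ ((dom _).2 d₃) ((dom _).2 d₅) e₃ e₅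
  have b₃ : 3 ≤ n₃ := by unfold wheelRel at w34; omega
  have b₅ : 3 ≤ n₅ := by unfold wheelRel at w45; omega
  have ne : ∀ {a b v w}, g a = v → g b = w → v ≠ w → a ≠ b := by
    rintro a b _ _ rfl rfl hvw rfl
    exact hvw rfl
  have n₂₃ := ne e₂ e₃ n23
  have n₂₅ := ne e₂ e₅ n25
  have n₂₆ := ne e₂ e₆ n26
  have n₃₅ := ne e₃ e₅ n35
  have n₃₆ := ne e₃ e₆ n36
  have n₅₆ := ne e₅ e₆ n56
  refine ⟨n₂, n₃, n₅, n₆, ?_, ?_⟩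
  · refine nonempty_relGraph_iso G g (fun a b ha hb => inj a b ha hb) surj fun a b ha hb => ?_
    have hx : ∀ a, a < 2 * k + 3 → (G.Adj x (g a) ↔
        a = 5 ∨ a = n₂ ∨ a = n₃ ∨ a = 0 ∨ a = n₅ ∨ a = n₆) := by
      intro a ha
      rw [h.adj_iff, i₁ a ha, i₂ a ha, i₃ a ha, i₄ a ha, i₅ a ha, i₆ a ha]
    have hw2 : ¬ wheelRel 3 (2 * k) 2 2 := by unfold wheelRel; omega
    by_cases ha2 : a = 2
    · subst ha2
      rw [g2, hx b hb]
      have r₁ : ¬ wheelRel 3 (2 * k) 2 b := by unfold wheelRel; omega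
      have r₂ : ¬ wheelRel 3 (2 * k) b 2 := by unfold wheelRel; omega
      simp only [srExpansion, r₁, r₂, false_and, false_or]
      clear * - b₂ b₃ b₅ b₆
      grind
    · by_cases hb2 : b = 2
      · subst hb2
        rw [g2, G.adj_comm, hx a ha]
        have r₁ : ¬ wheelRel 3 (2 * k) 2 a := by unfold wheelRel; omega
        have r₂ : ¬ wheelRel 3 (2 * k) a 2 := by unfold wheelRel; omega
        simp only [srExpansion, r₁, r₂, false_and, false_or]
        clear * - b₂ b₃ b₅ b₆
        grind
      · rw [hadj a b ((dom a).2 ⟨ha, ha2⟩) ((dom b).2 ⟨hb, hb2⟩), i₁ a ha, i₂ a ha, i₃ a ha, i₄ a ha,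
          i₅ a ha, i₆ a ha, i₁ b hb, i₂ b hb, i₃ b hb, i₄ b hb, i₅ b hb, i₆ b hb]
        have r₁ : a = 0 → ¬ wheelRel 3 (2 * k) b a := by unfold wheelRel; omega
        have r₂ : b = 0 → ¬ wheelRel 3 (2 * k) a b := by unfold wheelRel; omega
        simp only [srExpansion, ha2, hb2, false_and, or_false]
        generalize wheelRel 3 (2 * k) a b = A at *
        generalize wheelRel 3 (2 * k) b a = B at *
        clear * - r₁ r₂ n₃₅
        grind
  · exact srExpansion_cases (by omega) ⟨b₂, d₂.1⟩ ⟨b₃, d₃.1⟩ ⟨b₅, d₅.1⟩ ⟨b₆, d₆.1⟩ w12 w13 w15 w16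
      w23.2 w56.2 w35 ⟨n₂₃, n₂₅, n₂₆, n₃₅, n₃₆, n₅₆⟩

/-- In a kite drawing, some neighbour `b` of a vertex `a` of degree six, apart from two given ones,
has four common neighbours with `a`. -/
theorem not_hasKiteDrawing_relGraph {P : ℕ → Prop} {R : ℕ → ℕ → Prop} {a s t : ℕ} (ha : P a)
    (N : List ℕ) (hN : N.Nodup) (hlen : 5 ≤ N.length)
    (nbr : ∀ z ∈ N, P z ∧ a ≠ z ∧ (R a z ∨ R z a))
    (weak : ∀ b, P b → b ≠ s → b ≠ t → a ≠ b → (R a b ∨ R b a) → ∃ p q r, ∀ z, P z →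
      (a ≠ z ∧ (R a z ∨ R z a)) → (b ≠ z ∧ (R b z ∨ R z b)) → z = p ∨ z = q ∨ z = r) :
    ¬ HasKiteDrawing (relGraph P R) := by
  rintro ⟨-, -, m, K, hK, -, -⟩
  -- Uncrossed edges at `a` can lead only to `s` and `t`, which bounds the degree by four, against
  -- at least five listed neighbours. The filter covers the case that `s` or `t` is not a vertex.
  have h := hK.neighbors_length_le (a := ⟨a, ha⟩) (l := [s, t].filterMap fun z =>
    open Classical in if hz : P z then some (⟨z, hz⟩ : {a // P a}) else none)
    (N := N.attach.map fun z => ⟨z.1, (nbr _ z.2).1⟩) ?_ ?_ ?_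
  · have h' := List.length_filterMap_le (fun z => open Classical in
      if hz : P z then some (⟨z, hz⟩ : {a // P a}) else none) [s, t]
    simp only [List.length_map, List.length_attach, List.length_cons, List.length_nil] at h h'
    omega
  · refine List.Nodup.map ?_ (List.nodup_attach.2 hN)
    exact fun z w e => Subtype.ext (congrArg (fun y : {a // P a} => y.1) e)
  · intro z hz
    obtain ⟨w, -, rfl⟩ := List.mem_map.1 hz
    exact (nbr _ w.2).2
  · intro c i hc
    by_contra hm
    have hadj := hK.adj_side c i
    rw [hc] at hadj
    obtain ⟨b, hb⟩ : ∃ b, b = K c (i + 1) := ⟨_, rfl⟩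
    rw [← hb] at hm hadj
    have hs : b.1 ≠ s := by
      rintro rfl
      exact hm (List.mem_filterMap.2 ⟨b.1, by simp, by simp [b.2]⟩)
    have ht : b.1 ≠ t := by
      rintro rfl
      exact hm (List.mem_filterMap.2 ⟨b.1, by simp, by simp [b.2]⟩)
    obtain ⟨p, q, r, hpqr⟩ := weak b b.2 hs ht hadj.1 hadj.2
    refine hK.side_ne_of_common_subset (a := ⟨a, ha⟩) (b := b)
      (l := [p, q, r].filterMap fun z =>
        open Classical in if hz : P z then some (⟨z, hz⟩ : {a // P a}) else none)
      (List.length_filterMap_le _ _) ?_ c i hc hb.symm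
    intro z h₁ h₂
    refine List.mem_filterMap.2 ⟨z.1, ?_, by simp [z.2]⟩
    simpa using hpqr z z.2 h₁ h₂

/-- The crossed star has a reflection that fixes `x₁` and `x₄` and exchanges `x₂` with `x₆` and `x₃`
with `x₅`. -/
theorem srExpansion_swap {N n₂ n₃ n₅ n₆ a b : ℕ} (h : srExpansion N n₂ n₃ n₅ n₆ a b) :
    srExpansion N n₆ n₅ n₃ n₂ a b ∨ srExpansion N n₆ n₅ n₃ n₂ b a := by
  rcases h with ⟨h, h'⟩ | ⟨h, h'⟩ | ⟨h, h'⟩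
  · exact Or.inl (Or.inl ⟨h, fun e => h' ⟨e.1, by omega⟩⟩)
  · exact Or.inr (Or.inr (Or.inl ⟨h', h⟩))
  · exact Or.inl (Or.inr (Or.inr ⟨h, by omega⟩))

theorem nonempty_srExpansion_swap (N n₂ n₃ n₅ n₆ : ℕ) (P : ℕ → Prop) :
    Nonempty (relGraph P (srExpansion N n₂ n₃ n₅ n₆) ≃g relGraph P (srExpansion N n₆ n₅ n₃ n₂)) := by
  refine nonempty_relGraph_iso_relGraph id (fun _ h => h) (fun _ _ _ _ h => h)
    (fun w hw => ⟨w, hw, rfl⟩) fun a b _ _ => and_congr_right fun _ => ⟨?_, ?_⟩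
  all_goals
    rintro (h | h)
    · exact srExpansion_swap h
    · exact (srExpansion_swap h).symm

/-- The neighbours of the cycle vertex `n` in a graph which has the adjacency of the wheel graph
at this vertex. -/
theorem wheelRel_cases {N n z : ℕ} (hn : 3 ≤ n) (h : wheelRel 3 N n z ∨ wheelRel 3 N z n) :
    z ≤ 1 ∨ 3 ≤ z ∧ (z = n + 1 ∨ z = n + 2 ∨ n = z + 1 ∨ n = z + 2 ∨ n + N = z + 1 ∨
      n + N = z + 2 ∨ z + N = n + 1 ∨ z + N = n + 2) := by
  unfold wheelRel at h
  rcases h with (h | ⟨_, _, h | h | h | h⟩) | (h | ⟨_, _, h | h | h | h⟩) <;> omega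

theorem srExpansion_neighbor_cases {N n₂ n₃ n₅ n₆ n z : ℕ} (hn : 3 ≤ n)
    (h : srExpansion N n₂ n₃ n₅ n₆ n z ∨ srExpansion N n₂ n₃ n₅ n₆ z n) :
    ((z ≤ 1 ∨ 3 ≤ z ∧ (z = n + 1 ∨ z = n + 2 ∨ n = z + 1 ∨ n = z + 2 ∨ n + N = z + 1 ∨
      n + N = z + 2 ∨ z + N = n + 1 ∨ z + N = n + 2)) ∧ ¬ (z = 0 ∧ (n = 5 ∨ n = n₂ ∨ n = n₆))) ∨
      (n = n₃ ∧ z = n₅) ∨ (n = n₅ ∧ z = n₃) ∨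
      (z = 2 ∧ (n = 5 ∨ n = n₂ ∨ n = n₃ ∨ n = n₅ ∨ n = n₆)) := by
  rcases h with (⟨h, h'⟩ | h | h) | (⟨h, h'⟩ | h | h)
  · refine Or.inl ⟨wheelRel_cases hn (Or.inl h), ?_⟩
    rintro ⟨rfl, -⟩
    unfold wheelRel at h
    omega
  · exact Or.inr (Or.inl h)
  · omega
  · exact Or.inl ⟨wheelRel_cases hn (Or.inr h), h'⟩
  · exact Or.inr (Or.inr (Or.inl h.symm))
  · exact Or.inr (Or.inr (Or.inr ⟨h.1, by omega⟩))

theorem srExpansion_two {N n₂ n₃ n₅ n₆ z : ℕ} (hn : 3 ≤ n₃ ∧ 3 ≤ n₅)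
    (h : srExpansion N n₂ n₃ n₅ n₆ 2 z ∨ srExpansion N n₂ n₃ n₅ n₆ z 2) :
    z = 0 ∨ z = 5 ∨ z = n₂ ∨ z = n₃ ∨ z = n₅ ∨ z = n₆ := by
  unfold srExpansion wheelRel at h
  omega

/-- Vertex `7` has lost its edge to the pole `0` and has the neighbours `5`, `6`, `8`, `9`, `1`,
`2`. It shares at most three neighbours with each of them except `6` and `1`, so too few of its
edges can be uncrossed. -/
theorem not_hasKiteDrawing_srExpansion₁ {N : ℕ} (hN : 10 ≤ N) :
    ¬ HasKiteDrawing (relGraph (· < N + 3) (srExpansion N 4 3 6 7)) := by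
  refine not_hasKiteDrawing_relGraph (a := 7) (s := 6) (t := 1) (by omega) [5, 6, 8, 9, 1, 2]
    (by decide) (by decide) ?_ ?_
  · intro z hz
    simp only [List.mem_cons, List.not_mem_nil, or_false] at hz
    unfold srExpansion wheelRel
    rcases hz with rfl | rfl | rfl | rfl | rfl | rfl <;> omega
  · intro b hb hs ht hab h
    have nb : ∀ z, z < N + 3 → 7 ≠ z → (srExpansion N 4 3 6 7 7 z ∨ srExpansion N 4 3 6 7 z 7) →
        z = 5 ∨ z = 6 ∨ z = 8 ∨ z = 9 ∨ z = 1 ∨ z = 2 := by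
      intro z hz h7 h
      have := srExpansion_neighbor_cases (by omega) h
      clear h
      omega
    have h' := nb b hb hab h
    obtain rfl | rfl | rfl | rfl : b = 5 ∨ b = 8 ∨ b = 9 ∨ b = 2 := by omega
    · refine ⟨6, 1, 2, fun z hz h₁ h₂ => ?_⟩
      have h₁ := nb z hz h₁.1 h₁.2
      have h₂ := srExpansion_neighbor_cases (by omega) h₂.2
      omega
    · refine ⟨6, 9, 1, fun z hz h₁ h₂ => ?_⟩
      have h₃ := nb z hz h₁.1 h₁.2
      have h₄ := srExpansion_neighbor_cases (by omega) h₂.2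
      omega
    · refine ⟨8, 1, 1, fun z hz h₁ h₂ => ?_⟩
      have h₃ := nb z hz h₁.1 h₁.2
      have h₄ := srExpansion_neighbor_cases (by omega) h₂.2
      omega
    · refine ⟨5, 6, 6, fun z hz h₁ h₂ => ?_⟩
      have h₃ := nb z hz h₁.1 h₁.2
      have h₄ := srExpansion_two (by omega) h₂.2
      omega

/-- The mirror image about `5` of the previous position: vertex `3` takes the part of `7`, with
exceptions `4` and `1`. Its neighbours `N + 1` and `N + 2` arise by wrap-around. -/
theorem not_hasKiteDrawing_srExpansion₂ {N : ℕ} (hN : 10 ≤ N) :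
    ¬ HasKiteDrawing (relGraph (· < N + 3) (srExpansion N 3 4 7 6)) := by
  refine not_hasKiteDrawing_relGraph (a := 3) (s := 4) (t := 1) (by omega)
    [5, 4, N + 2, N + 1, 1, 2] ?_ (by simp) ?_ ?_
  · simp only [List.nodup_cons, List.mem_cons, List.not_mem_nil, or_false, not_or]
    refine ⟨?_, ?_, ?_, ?_, ?_, ?_⟩ <;> simp <;> omega
  · intro z hz
    simp only [List.mem_cons, List.not_mem_nil, or_false] at hz
    unfold srExpansion wheelRel
    rcases hz with rfl | rfl | rfl | rfl | rfl | rfl <;> refine ⟨by omega, by omega, ?_⟩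
    · exact Or.inl (by omega)
    · exact Or.inl (by omega)
    · exact Or.inl (Or.inl ⟨Or.inr ⟨by omega, by omega, by omega⟩, by omega⟩)
    · exact Or.inl (Or.inl ⟨Or.inr ⟨by omega, by omega, by omega⟩, by omega⟩)
    · exact Or.inr (by omega)
    · exact Or.inr (by omega)
  · intro b hb hs ht hab h
    have nb : ∀ z, z < N + 3 → 3 ≠ z → (srExpansion N 3 4 7 6 3 z ∨ srExpansion N 3 4 7 6 z 3) →
        z = 5 ∨ z = 4 ∨ z = N + 2 ∨ z = N + 1 ∨ z = 1 ∨ z = 2 := by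
      intro z hz h7 h
      have := srExpansion_neighbor_cases (by omega) h
      clear h
      omega
    have h' := nb b hb hab h
    obtain rfl | rfl | rfl | rfl : b = 5 ∨ b = N + 2 ∨ b = N + 1 ∨ b = 2 := by omega
    · refine ⟨4, 1, 2, fun z hz h₁ h₂ => ?_⟩
      have h₁ := nb z hz h₁.1 h₁.2
      have h₂ := srExpansion_neighbor_cases (by omega) h₂.2
      omega
    · refine ⟨4, N + 1, 1, fun z hz h₁ h₂ => ?_⟩
      have h₃ := nb z hz h₁.1 h₁.2
      have h₄ := srExpansion_neighbor_cases (by omega) h₂.2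
      omega
    · refine ⟨N + 2, 1, 1, fun z hz h₁ h₂ => ?_⟩
      have h₃ := nb z hz h₁.1 h₁.2
      have h₄ := srExpansion_neighbor_cases (by omega) h₂.2
      omega
    · refine ⟨5, 4, 4, fun z hz h₁ h₂ => ?_⟩
      have h₃ := nb z hz h₁.1 h₁.2
      have h₄ := srExpansion_two (by omega) h₂.2
      omega

/-- A graph with a kite drawing that an SR-reduction turns into an extended wheel graph is unique up
to isomorphism. -/
theorem IsSRSite.nonempty_srExpansion_iso {V : Type u} {G : SimpleGraph V}
    {x x₁ x₂ x₃ x₄ x₅ x₆ : V} {k : ℕ} (hk : 5 ≤ k) (hG : HasKiteDrawing G)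
    (h : IsSRSite G x x₁ x₂ x₃ x₄ x₅ x₆)
    (φ : extendedWheel k ≃g srGraph G x x₁ x₂ x₃ x₄ x₅ x₆) :
    Nonempty (relGraph (· < 2 * k + 3) (srExpansion (2 * k) 4 3 7 6) ≃g G) := by
  obtain ⟨n₂, n₃, n₅, n₆, ⟨e⟩, hn⟩ := h.exists_srExpansion hk hG φ
  obtain ⟨e'⟩ := nonempty_srExpansion_swap (2 * k) n₆ n₅ n₃ n₂ (· < 2 * k + 3)
  have e'' := e'.trans e
  have h₁ := not_hasKiteDrawing_srExpansion₁ (N := 2 * k) (by omega)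
  have h₂ := not_hasKiteDrawing_srExpansion₂ (N := 2 * k) (by omega)
  rcases hn with ⟨rfl, rfl, rfl, rfl⟩ | ⟨rfl, rfl, rfl, rfl⟩ | ⟨rfl, rfl, rfl, rfl⟩ |
    ⟨rfl, rfl, rfl, rfl⟩ | ⟨rfl, rfl, rfl, rfl⟩ | ⟨rfl, rfl, rfl, rfl⟩
  · exact ⟨e⟩
  · exact (h₁ (hG.congr e.symm)).elim
  · exact (h₂ (hG.congr e.symm)).elim
  · exact ⟨e''⟩
  · exact (h₁ (hG.congr e''.symm)).elim
  · exact (h₂ (hG.congr e''.symm)).elim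

/-! Shortening the cycle by two SR-reductions. -/

/-- The increasing map that omits the numbers `s` and `s + 1`. -/
def skipTwo (s a : ℕ) : ℕ := if a < s then a else a + 2

theorem skipTwo_cases (s a : ℕ) : (a < s ∧ skipTwo s a = a) ∨ (s ≤ a ∧ skipTwo s a = a + 2) := by
  unfold skipTwo
  split <;> omega

theorem skipTwo_eq_iff {s a n : ℕ} :
    skipTwo s a = n ↔ (n < s ∧ a = n) ∨ (s + 2 ≤ n ∧ a + 2 = n) := by
  have := skipTwo_cases s a
  omega

theorem skipTwo_injective (s : ℕ) : Function.Injective (skipTwo s) := by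
  intro a b h
  have := skipTwo_cases s a
  have := skipTwo_cases s b
  omega

/-- Inserting two vertices before `s` destroys exactly the cycle adjacencies across the gap: those
of the pairs `s - 2, s` and `s - 1, s` and `s - 1, s + 1`. The bounds on `s` keep the gap away from
the wrap-around. -/
theorem wheelRel_skipTwo {c N s a b : ℕ} (hc : 2 ≤ c) (hs : c + 2 ≤ s) (hN : s + 3 ≤ c + N)
    (hb : b < c + N) :
    wheelRel c (N + 2) (skipTwo s a) (skipTwo s b) ↔ wheelRel c N a b ∧
      ¬ ((a + 2 = s ∧ b = s) ∨ (a + 1 = s ∧ b = s) ∨ (a + 1 = s ∧ b = s + 1)) := by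
  rcases skipTwo_cases s a with ⟨h₁, e₁⟩ | ⟨h₁, e₁⟩ <;>
    rcases skipTwo_cases s b with ⟨h₂, e₂⟩ | ⟨h₂, e₂⟩ <;> rw [e₁, e₂] <;> unfold wheelRel <;>
    clear e₁ e₂
  · omega
  · constructor
    · rintro (h | ⟨_, _, h | h | h | h⟩)
      · exact ⟨Or.inl (by omega), by omega⟩
      all_goals omega
    · rintro ⟨h | ⟨_, _, h | h | h | h⟩, h'⟩ <;> omega
  · omega
  · omega

/-- The SR-reduction that merges the cycle vertices `8` and `6`. -/
theorem isSRSite_srExpansion {N : ℕ} (hN : 10 ≤ N) :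
    IsSRSite (relGraph (· < N + 3) (srExpansion N 4 3 7 6)) ⟨8, by omega⟩ ⟨9, by omega⟩
      ⟨10, by omega⟩ ⟨1, by omega⟩ ⟨6, by omega⟩ ⟨7, by omega⟩ ⟨0, by omega⟩ := by
  refine isSRSite_relGraph _ _ _ _ _ _ _ (by simp) ?_ ?_ ?_
  · intro w hw
    dsimp only
    constructor
    · rintro ⟨h₁, h₂⟩
      have := srExpansion_neighbor_cases (by omega) h₂
      omega
    · unfold srExpansion wheelRel
      rintro (rfl | rfl | rfl | rfl | rfl | rfl) <;> omega
  · dsimp only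
    unfold srExpansion wheelRel
    rintro a b (⟨rfl, rfl⟩ | ⟨rfl, rfl⟩ | ⟨rfl, rfl⟩ | ⟨rfl, rfl⟩ | ⟨rfl, rfl⟩ | ⟨rfl, rfl⟩ |
      ⟨rfl, rfl⟩ | ⟨rfl, rfl⟩ | ⟨rfl, rfl⟩) <;> omega
  -- Vertex `6` is `x₆` of the expansion and so is not joined to the pole `0`; this absence makes
  -- the merge possible. Vertices `9` and `10` are more than two steps away from it.
  · dsimp only
    unfold srExpansion wheelRel
    rintro a (rfl | rfl | rfl) <;> constructor <;> omega

/-- The SR-reduction that follows, which merges the cycle vertices `7` and `9`. -/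
theorem isSRSite_srRel_srExpansion {N : ℕ} (hN : 10 ≤ N) :
    IsSRSite (relGraph (fun a => a < N + 3 ∧ a ≠ 8) (srRel (srExpansion N 4 3 7 6) 9 10 1 6 7 0))
      ⟨7, by omega⟩ ⟨2, by omega⟩ ⟨5, by omega⟩ ⟨6, by omega⟩ ⟨9, by omega⟩ ⟨0, by omega⟩
      ⟨3, by omega⟩ := by
  refine isSRSite_relGraph _ _ _ _ _ _ _ (by simp) ?_ ?_ ?_
  · rintro w ⟨hw, hw8⟩
    dsimp only
    constructor
    · rintro ⟨h₁, h₂⟩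
      have h₃ : (srExpansion N 4 3 7 6 7 w ∨ srExpansion N 4 3 7 6 w 7) ∧ w ≠ 1 := by
        unfold srRel at h₂
        clear * - h₂
        grind
      have := srExpansion_neighbor_cases (by omega) h₃.1
      omega
    · unfold srRel srExpansion wheelRel
      rintro (rfl | rfl | rfl | rfl | rfl | rfl) <;> omega
  · dsimp only
    unfold srRel srExpansion wheelRel
    rintro a b (⟨rfl, rfl⟩ | ⟨rfl, rfl⟩ | ⟨rfl, rfl⟩ | ⟨rfl, rfl⟩ | ⟨rfl, rfl⟩ | ⟨rfl, rfl⟩ |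
      ⟨rfl, rfl⟩ | ⟨rfl, rfl⟩ | ⟨rfl, rfl⟩) <;> omega
  -- Here `N ≥ 10` matters: `3` and `9` must not be adjacent, and on a cycle of length eight they
  -- would be at distance two.
  · dsimp only
    unfold srRel srExpansion wheelRel
    rintro a (rfl | rfl | rfl) <;> constructor <;> omega

/-- Merging `8` into `6` joins `6` to `9`, `10` and `0`. Merging `7` into `9` removes the edge from
`6` to `0` again and passes the neighbours `2`, `3` and `5` of `7` on to `9`. Now `9` follows `6` on
the cycle and plays the part of `7`, so omitting `7` and `8` from the numbering restores the
original form. -/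
theorem nonempty_srExpansion_iso_srRel {N : ℕ} (hN : 8 ≤ N) :
    Nonempty (relGraph (· < N + 3) (srExpansion N 4 3 7 6) ≃g
      relGraph (fun a => (a < N + 2 + 3 ∧ a ≠ 8) ∧ a ≠ 7)
        (srRel (srRel (srExpansion (N + 2) 4 3 7 6) 9 10 1 6 7 0) 2 5 6 9 0 3)) := by
  refine nonempty_relGraph_iso_relGraph (skipTwo 7) ?_ (fun _ _ _ _ h => skipTwo_injective 7 h) ?_ ?_
  · intro a ha
    have := skipTwo_cases 7 a
    omega
  · intro w hw
    by_cases h : w < 7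
    · exact ⟨w, by omega, by rw [skipTwo_eq_iff]; omega⟩
    · exact ⟨w - 2, by omega, by rw [skipTwo_eq_iff]; omega⟩
  · intro a b ha hb
    rw [(skipTwo_injective 7).ne_iff]
    have w₁ := wheelRel_skipTwo (c := 3) (N := N) (s := 7) (by omega) (by omega) (by omega)
      (a := a) (b := b) (by omega)
    have w₂ := wheelRel_skipTwo (c := 3) (N := N) (s := 7) (by omega) (by omega) (by omega)
      (a := b) (b := a) (by omega)
    -- The adjacencies lost across the gap are those restored by the merges. From here on `wheelRel`
    -- is used only through the facts listed, so that the equivalence becomes propositional.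
    have z₁ : ((a = 5 ∧ b = 7) ∨ (a = 6 ∧ b = 7) ∨ (a = 6 ∧ b = 8)) → wheelRel 3 N a b := by
      unfold wheelRel; omega
    have z₂ : ((b = 5 ∧ a = 7) ∨ (b = 6 ∧ a = 7) ∨ (b = 6 ∧ a = 8)) → wheelRel 3 N b a := by
      unfold wheelRel; omega
    have z₃ : a ≤ 1 ∧ 3 ≤ b → wheelRel 3 N a b := by unfold wheelRel; omega
    have z₄ : b ≤ 1 ∧ 3 ≤ a → wheelRel 3 N b a := by unfold wheelRel; omega
    have y₁ : wheelRel 3 N a b → ¬ b ≤ 2 ∧ a ≠ 2 := by unfold wheelRel; omega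
    have y₂ : wheelRel 3 N b a → ¬ a ≤ 2 ∧ b ≠ 2 := by unfold wheelRel; omega
    have e := fun t n => @skipTwo_eq_iff 7 t n
    simp only [srRel, srExpansion, w₁, w₂, e]
    clear w₁ w₂ e
    norm_num
    generalize wheelRel 3 N a b = A at *
    generalize wheelRel 3 N b a = B at *
    clear ha hb
    grind (splits := 30)

/-- The SR-reduction that leads back to the extended wheel graph. -/
theorem isSRSite_srExpansion_two {N : ℕ} (hN : 8 ≤ N) :
    IsSRSite (relGraph (· < N + 3) (srExpansion N 4 3 7 6)) ⟨2, by omega⟩ ⟨5, by omega⟩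
      ⟨4, by omega⟩ ⟨3, by omega⟩ ⟨0, by omega⟩ ⟨7, by omega⟩ ⟨6, by omega⟩ := by
  refine isSRSite_relGraph _ _ _ _ _ _ _ (by simp) ?_ ?_ ?_
  · intro w hw
    dsimp only
    constructor
    · rintro ⟨h₁, h₂⟩
      have := srExpansion_two (by omega) h₂
      omega
    · unfold srExpansion
      rintro (rfl | rfl | rfl | rfl | rfl | rfl) <;> omega
  · dsimp only
    unfold srExpansion wheelRel
    rintro a b (⟨rfl, rfl⟩ | ⟨rfl, rfl⟩ | ⟨rfl, rfl⟩ | ⟨rfl, rfl⟩ | ⟨rfl, rfl⟩ | ⟨rfl, rfl⟩ |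
      ⟨rfl, rfl⟩ | ⟨rfl, rfl⟩ | ⟨rfl, rfl⟩) <;> omega
  · dsimp only
    unfold srExpansion wheelRel
    rintro a (rfl | rfl | rfl) <;> constructor <;> omega

theorem nonempty_wheelRel_iso_srRel {N : ℕ} (hN : 8 ≤ N) :
    Nonempty (relGraph (wheelDom 3 N) (wheelRel 3 N) ≃g
      relGraph (fun a => a < N + 3 ∧ a ≠ 2) (srRel (srExpansion N 4 3 7 6) 5 4 3 0 7 6)) := by
  refine nonempty_relGraph_iso_relGraph id ?_ (fun _ _ _ _ h => h) ?_ ?_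
  · unfold wheelDom
    intro a ha
    simp only [id]
    omega
  · unfold wheelDom
    intro w hw
    exact ⟨w, by omega, rfl⟩
  · unfold wheelDom
    intro a b ha hb
    -- The reduction deletes the edge between `3` and `7`, which must not belong to the wheel; at
    -- distance four this needs `N ≥ 8`.
    have z₀ : ¬ ((a = 3 ∧ b = 7) ∨ (a = 7 ∧ b = 3)) ∨ ¬ (wheelRel 3 N a b ∨ wheelRel 3 N b a) := by
      unfold wheelRel; omega
    have z₃ : a ≤ 1 ∧ 3 ≤ b → wheelRel 3 N a b := by unfold wheelRel; omega
    have z₄ : b ≤ 1 ∧ 3 ≤ a → wheelRel 3 N b a := by unfold wheelRel; omega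
    have ha' : a ≠ 2 := by omega
    have hb' : b ≠ 2 := by omega
    simp only [srRel, srExpansion, id, ha', hb', false_and, or_false]
    generalize wheelRel 3 N a b = A at *
    generalize wheelRel 3 N b a = B at *
    clear ha hb
    grind (splits := 30)

theorem extendedWheel_exists_adj {k : ℕ} (hk : 1 ≤ k) (y : ZMod (2 * k) ⊕ Bool) :
    ∃ a b, a ≠ b ∧ (extendedWheel k).Adj y a ∧ (extendedWheel k).Adj y b := by
  rcases y with i | b
  · exact ⟨.inr true, .inr false, by simp, trivial, trivial⟩
  · have : Fact (1 < 2 * k) := ⟨by omega⟩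
    exact ⟨.inl 0, .inl 1, by simp, trivial, trivial⟩

/-- This supplies the degree condition that excludes faces of length two. Only `x₁`, `x₂`, `x₄`,
`x₆` can lose wheel neighbours when the reduction is undone, and for them the site itself provides
two. -/
theorem IsSRSite.exists_adj {V : Type u} {G : SimpleGraph V} {x x₁ x₂ x₃ x₄ x₅ x₆ : V} {k : ℕ}
    (hk : 1 ≤ k) (h : IsSRSite G x x₁ x₂ x₃ x₄ x₅ x₆)
    (φ : extendedWheel k ≃g srGraph G x x₁ x₂ x₃ x₄ x₅ x₆) (v : V) :
    ∃ a b, a ≠ b ∧ G.Adj v a ∧ G.Adj v b := by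
  have hn := h.nodup
  simp only [List.nodup_cons, List.mem_cons, List.not_mem_nil, or_false, not_or] at hn
  obtain ⟨⟨n12, n13, n14, n15, n16⟩, ⟨n23, n24, n25, n26⟩, ⟨n34, n35, n36⟩, ⟨n45, n46⟩, n56, -⟩ :=
    hn
  by_cases h0 : v = x
  · exact ⟨x₁, x₂, n12, by simp [h0, h.adj_iff], by simp [h0, h.adj_iff]⟩
  by_cases h1 : v = x₁
  · exact ⟨x₂, x₆, n26, h1 ▸ h.adj₁₂, h1 ▸ h.adj₆₁.symm⟩
  by_cases h2 : v = x₂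
  · exact ⟨x₁, x₃, n13, h2 ▸ h.adj₁₂.symm, h2 ▸ h.adj₂₃⟩
  by_cases h4 : v = x₄
  · exact ⟨x₃, x₅, n35, h4 ▸ h.adj₃₄.symm, h4 ▸ h.adj₄₅⟩
  by_cases h6 : v = x₆
  · exact ⟨x₁, x₅, n15, h6 ▸ h.adj₆₁, h6 ▸ h.adj₅₆.symm⟩
  obtain ⟨y, hy⟩ := φ.surjective ⟨v, h0⟩
  obtain ⟨a, b, hab, ha, hb⟩ := extendedWheel_exists_adj hk y
  have key : ∀ c, (extendedWheel k).Adj y c → G.Adj v (φ c) := by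
    intro c hc
    rw [← φ.map_adj_iff, hy] at hc
    refine (h.srGraph_adj ⟨v, h0⟩ (φ c)).2 (Or.inl ⟨hc, ?_⟩)
    tauto
  exact ⟨φ a, φ b, fun e => hab (φ.injective (Subtype.ext e)), key a ha, key b hb⟩

/-- By uniqueness the two reductions need only be found in the numbered model. The kite drawing
carried along shows that the graphs reached are optimal 1-planar. -/
theorem IsSXW.exists_srReduces {V : Type u} {G : SimpleGraph V} {k : ℕ} (hk : 5 ≤ k)
    (hG : IsSXW k G) :
    ∃ (W₁ W₂ : Type u) (G₁ : SimpleGraph W₁) (G₂ : SimpleGraph W₂),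
      SRReduces G G₁ ∧ SRReduces G₁ G₂ ∧ IsSXW (k - 1) G₂ := by
  obtain ⟨hopt, -, x, x₁, x₂, x₃, x₄, x₅, x₆, hs, ⟨φ⟩⟩ := hG
  have hK := hopt.hasKiteDrawing (hs.exists_adj (by omega) φ)
  obtain ⟨ψ⟩ := hs.nonempty_srExpansion_iso hk hK φ
  obtain ⟨W₁, G₁, hr₁, hK₁, ⟨ψ₁⟩⟩ := _root_.exists_srReduces hK ψ
    (isSRSite_srExpansion (N := 2 * k) (by omega))
  obtain ⟨W₂, G₂, hr₂, hK₂, ⟨ψ₂⟩⟩ := _root_.exists_srReduces hK₁ ψ₁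
    (isSRSite_srRel_srExpansion (N := 2 * k) (by omega))
  refine ⟨W₁, W₂, G₁, G₂, hr₁, hr₂, hK₂.isOptimalOnePlanar, hK₂.isOptimalOnePlanar, ?_⟩
  obtain ⟨k, rfl⟩ : ∃ l, k = l + 1 := ⟨k - 1, by omega⟩
  obtain ⟨θ⟩ := nonempty_srExpansion_iso_srRel (N := 2 * k) (by omega)
  have ψ₃ := θ.trans ψ₂
  have hs₃ := isSRSite_srExpansion_two (N := 2 * k) (by omega)
  obtain ⟨e₁⟩ := nonempty_srGraph_iso ψ₃ ⟨2, by omega⟩ ⟨5, by omega⟩ ⟨4, by omega⟩ ⟨3, by omega⟩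
    ⟨0, by omega⟩ ⟨7, by omega⟩ ⟨6, by omega⟩
  obtain ⟨e₂⟩ := nonempty_srGraph_relGraph_iso (P := (· < 2 * k + 3))
    (R := srExpansion (2 * k) 4 3 7 6) ⟨2, by omega⟩ ⟨5, by omega⟩ ⟨4, by omega⟩ ⟨3, by omega⟩
    ⟨0, by omega⟩ ⟨7, by omega⟩ ⟨6, by omega⟩
  obtain ⟨e₃⟩ := nonempty_wheelRel_iso_srRel (N := 2 * k) (by omega)
  obtain ⟨e₄⟩ := nonempty_relGraph_iso_extendedWheel (c := 3) (k := k) (by omega) (by omega)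
  exact ⟨_, _, _, _, _, _, _, hs₃.map ψ₃, ⟨e₄.symm.trans (e₃.trans (e₂.trans e₁))⟩⟩

/-! Graphs that a CR-reduction turns into an extended wheel graph. -/

section IsCRSite

variable {V : Type u} {G : SimpleGraph V} {x₁ x₂ x₃ x₄ v₁ v₂ v₃ v₄ : V}

/-- The rotational symmetry of the crossed cube; it allows a pole on the outer cycle to be taken as
`v₁`, and all four new vertices to be treated like `x₁`. -/
theorem IsCRSite.rotate (h : IsCRSite G x₁ x₂ x₃ x₄ v₁ v₂ v₃ v₄) :
    IsCRSite G x₂ x₃ x₄ x₁ v₂ v₃ v₄ v₁ where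
  nodup := by
    have := h.nodup
    simp only [List.nodup_cons, List.mem_cons, List.not_mem_nil, or_false, not_or] at this ⊢
    grind
  nbr₁ := by rw [h.nbr₂]; ext; simp only [Set.mem_insert_iff, Set.mem_singleton_iff]; tauto
  nbr₂ := by rw [h.nbr₃]; ext; simp only [Set.mem_insert_iff, Set.mem_singleton_iff]; tauto
  nbr₃ := by rw [h.nbr₄]; ext; simp only [Set.mem_insert_iff, Set.mem_singleton_iff]; tauto
  nbr₄ := h.nbr₁
  adj₁₂ := h.adj₂₃
  adj₂₃ := h.adj₃₄
  adj₃₄ := h.adj₄₁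
  adj₄₁ := h.adj₁₂
  not_adj₁₃ := h.not_adj₂₄
  not_adj₂₄ e := h.not_adj₁₃ e.symm

theorem IsCRSite.adj_iff (h : IsCRSite G x₁ x₂ x₃ x₄ v₁ v₂ v₃ v₄) (w : V) :
    G.Adj x₁ w ↔ w = x₂ ∨ w = x₃ ∨ w = x₄ ∨ w = v₁ ∨ w = v₂ ∨ w = v₄ := by
  rw [← SimpleGraph.mem_neighborSet, h.nbr₁]
  simp

theorem IsCRSite.map {W : Type v} {G' : SimpleGraph W} (h : IsCRSite G x₁ x₂ x₃ x₄ v₁ v₂ v₃ v₄)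
    (φ : G ≃g G') :
    IsCRSite G' (φ x₁) (φ x₂) (φ x₃) (φ x₄) (φ v₁) (φ v₂) (φ v₃) (φ v₄) where
  nodup := h.nodup.map φ.injective
  nbr₁ := by
    ext w
    obtain ⟨w, rfl⟩ := φ.surjective w
    rw [SimpleGraph.mem_neighborSet, φ.map_adj_iff, ← SimpleGraph.mem_neighborSet, h.nbr₁]
    simp
  nbr₂ := by
    ext w
    obtain ⟨w, rfl⟩ := φ.surjective w
    rw [SimpleGraph.mem_neighborSet, φ.map_adj_iff, ← SimpleGraph.mem_neighborSet, h.nbr₂]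
    simp
  nbr₃ := by
    ext w
    obtain ⟨w, rfl⟩ := φ.surjective w
    rw [SimpleGraph.mem_neighborSet, φ.map_adj_iff, ← SimpleGraph.mem_neighborSet, h.nbr₃]
    simp
  nbr₄ := by
    ext w
    obtain ⟨w, rfl⟩ := φ.surjective w
    rw [SimpleGraph.mem_neighborSet, φ.map_adj_iff, ← SimpleGraph.mem_neighborSet, h.nbr₄]
    simp
  adj₁₂ := φ.map_adj_iff.2 h.adj₁₂
  adj₂₃ := φ.map_adj_iff.2 h.adj₂₃
  adj₃₄ := φ.map_adj_iff.2 h.adj₃₄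
  adj₄₁ := φ.map_adj_iff.2 h.adj₄₁
  not_adj₁₃ e := h.not_adj₁₃ (φ.map_adj_iff.1 e)
  not_adj₂₄ e := h.not_adj₂₄ (φ.map_adj_iff.1 e)

theorem nonempty_crGraph_iso {W : Type v} {G' : SimpleGraph W} (φ : G ≃g G')
    (x₁ x₂ x₃ x₄ v₁ v₂ v₃ v₄ : V) :
    Nonempty (crGraph G x₁ x₂ x₃ x₄ v₁ v₂ v₃ v₄ ≃g
      crGraph G' (φ x₁) (φ x₂) (φ x₃) (φ x₄) (φ v₁) (φ v₂) (φ v₃) (φ v₄)) := by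
  refine ⟨⟨φ.toEquiv.subtypeEquiv fun a => ?_, fun {a b} => ?_⟩⟩
  · simp
  · obtain ⟨a, ha⟩ := a
    obtain ⟨b, hb⟩ := b
    simp only [crGraph, SimpleGraph.comap_adj, Function.Embedding.subtype_apply,
      SimpleGraph.sup_adj, SimpleGraph.fromEdgeSet_adj,
      Equiv.subtypeEquiv_apply, Set.mem_singleton_iff, Set.mem_insert_iff, Sym2.eq_iff]
    rw [show φ.toEquiv a = φ a from rfl, show φ.toEquiv b = φ b from rfl, φ.map_adj_iff]
    simp only [ne_eq, φ.injective.eq_iff]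

theorem IsCRSite.crGraph_adj (h : IsCRSite G x₁ x₂ x₃ x₄ v₁ v₂ v₃ v₄)
    (a b : ({x₁, x₂, x₃, x₄}ᶜ : Set V)) :
    (crGraph G x₁ x₂ x₃ x₄ v₁ v₂ v₃ v₄).Adj a b ↔ G.Adj a b ∨ (a.1 = v₁ ∧ b.1 = v₃) ∨
      (a.1 = v₃ ∧ b.1 = v₁) ∨ (a.1 = v₂ ∧ b.1 = v₄) ∨ (a.1 = v₄ ∧ b.1 = v₂) := by
  obtain ⟨a, ha⟩ := a
  obtain ⟨b, hb⟩ := b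
  have hn := h.nodup
  simp only [List.nodup_cons, List.mem_cons, List.not_mem_nil, or_false, not_or] at hn
  have h₁ : v₁ ≠ v₃ := by tauto
  have h₂ : v₂ ≠ v₄ := by tauto
  simp only [crGraph, SimpleGraph.comap_adj, Function.Embedding.subtype_apply,
    SimpleGraph.sup_adj, SimpleGraph.fromEdgeSet_adj,
    Set.mem_singleton_iff, Set.mem_insert_iff, Sym2.eq_iff]
  refine or_congr Iff.rfl ⟨?_, ?_⟩
  · tauto
  · rintro (⟨rfl, rfl⟩ | ⟨rfl, rfl⟩ | ⟨rfl, rfl⟩ | ⟨rfl, rfl⟩)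
    · exact ⟨by tauto, h₁⟩
    · exact ⟨by tauto, h₁.symm⟩
    · exact ⟨by tauto, h₂⟩
    · exact ⟨by tauto, h₂.symm⟩

end IsCRSite

/-- `f` identifies the extended wheel graph with the result of the CR-reduction. -/
structure IsCRLabelling {V : Type u} {k : ℕ} (G : SimpleGraph V) (f : ZMod (2 * k) ⊕ Bool → V)
    (x₁ x₂ x₃ x₄ v₁ v₂ v₃ v₄ : V) : Prop where
  site : IsCRSite G x₁ x₂ x₃ x₄ v₁ v₂ v₃ v₄
  inj : Function.Injective f
  range : ∀ v, (∃ y, f y = v) ↔ v ≠ x₁ ∧ v ≠ x₂ ∧ v ≠ x₃ ∧ v ≠ x₄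
  adj : ∀ y y', (extendedWheel k).Adj y y' ↔ G.Adj (f y) (f y') ∨ (f y = v₁ ∧ f y' = v₃) ∨
    (f y = v₃ ∧ f y' = v₁) ∨ (f y = v₂ ∧ f y' = v₄) ∨ (f y = v₄ ∧ f y' = v₂)

theorem IsCRLabelling.rotate {V : Type u} {k : ℕ} {G : SimpleGraph V}
    {f : ZMod (2 * k) ⊕ Bool → V} {x₁ x₂ x₃ x₄ v₁ v₂ v₃ v₄ : V}
    (h : IsCRLabelling G f x₁ x₂ x₃ x₄ v₁ v₂ v₃ v₄) :
    IsCRLabelling G f x₂ x₃ x₄ x₁ v₂ v₃ v₄ v₁ where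
  site := h.site.rotate
  inj := h.inj
  range v := by rw [h.range]; tauto
  adj y y' := by rw [h.adj]; tauto

theorem IsCRSite.exists_isCRLabelling {V : Type u} {k : ℕ} {G : SimpleGraph V}
    {x₁ x₂ x₃ x₄ v₁ v₂ v₃ v₄ : V} (h : IsCRSite G x₁ x₂ x₃ x₄ v₁ v₂ v₃ v₄)
    (φ : extendedWheel k ≃g crGraph G x₁ x₂ x₃ x₄ v₁ v₂ v₃ v₄) :
    ∃ f : ZMod (2 * k) ⊕ Bool → V, IsCRLabelling G f x₁ x₂ x₃ x₄ v₁ v₂ v₃ v₄ := by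
  refine ⟨fun y => (φ y).1, h, fun y y' e => φ.injective (Subtype.ext e), fun v => ⟨?_, ?_⟩,
    fun y y' => by rw [← h.crGraph_adj, φ.map_adj_iff]⟩
  · rintro ⟨y, rfl⟩
    have := (φ y).2
    simp only [Set.mem_compl_iff, Set.mem_insert_iff, Set.mem_singleton_iff, not_or] at this
    exact this
  · intro hv
    obtain ⟨y, hy⟩ := φ.surjective ⟨v, by simpa using hv⟩
    exact ⟨y, congrArg Subtype.val hy⟩

theorem IsCRLabelling.exists_adj {V : Type u} {k : ℕ} {G : SimpleGraph V}
    {f : ZMod (2 * k) ⊕ Bool → V} {x₁ x₂ x₃ x₄ v₁ v₂ v₃ v₄ : V} (hk : 1 ≤ k)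
    (h : IsCRLabelling G f x₁ x₂ x₃ x₄ v₁ v₂ v₃ v₄) (v : V) :
    ∃ a b, a ≠ b ∧ G.Adj v a ∧ G.Adj v b := by
  have s₁ := h.site
  have s₂ := s₁.rotate
  have s₃ := s₂.rotate
  have s₄ := s₃.rotate
  have hn := s₁.nodup
  simp only [List.nodup_cons, List.mem_cons, List.not_mem_nil, or_false, not_or] at hn
  by_cases e₁ : v = x₁
  · exact ⟨x₂, x₃, by tauto, by simp [e₁, s₁.adj_iff], by simp [e₁, s₁.adj_iff]⟩
  by_cases e₂ : v = x₂
  · exact ⟨x₁, x₃, by tauto, by simp [e₂, s₂.adj_iff], by simp [e₂, s₂.adj_iff]⟩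
  by_cases e₃ : v = x₃
  · exact ⟨x₁, x₂, by tauto, by simp [e₃, s₃.adj_iff], by simp [e₃, s₃.adj_iff]⟩
  by_cases e₄ : v = x₄
  · exact ⟨x₁, x₂, by tauto, by simp [e₄, s₄.adj_iff], by simp [e₄, s₄.adj_iff]⟩
  by_cases e₅ : v = v₁
  · exact ⟨v₂, v₄, by tauto, e₅ ▸ s₁.adj₁₂, e₅ ▸ s₁.adj₄₁.symm⟩
  by_cases e₆ : v = v₂
  · exact ⟨v₁, v₃, by tauto, e₆ ▸ s₁.adj₁₂.symm, e₆ ▸ s₁.adj₂₃⟩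
  by_cases e₇ : v = v₃
  · exact ⟨v₂, v₄, by tauto, e₇ ▸ s₁.adj₂₃.symm, e₇ ▸ s₁.adj₃₄⟩
  by_cases e₈ : v = v₄
  · exact ⟨v₁, v₃, by tauto, e₈ ▸ s₁.adj₄₁, e₈ ▸ s₁.adj₃₄.symm⟩
  obtain ⟨y, rfl⟩ := (h.range v).2 ⟨e₁, e₂, e₃, e₄⟩
  obtain ⟨a, b, hab, ha, hb⟩ := extendedWheel_exists_adj hk y
  have key : ∀ c, (extendedWheel k).Adj y c → G.Adj (f y) (f c) := by
    intro c hc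
    rw [h.adj] at hc
    tauto
  exact ⟨f a, f b, fun e => hab (h.inj e), key a ha, key b hb⟩

/-- The inverse CR-reduction at the pole `0` and the cycle vertices `m₂`, `8`, `m₄` of the extended
wheel graph; the new vertices are `2`, `3`, `4` and `5`. -/
def crExpansion (N m₂ m₄ a b : ℕ) : Prop :=
  (wheelRel 6 N a b ∧ ¬ (a = 0 ∧ b = 8) ∧ ¬ (a = m₂ ∧ b = m₄) ∧ ¬ (a = m₄ ∧ b = m₂)) ∨
    ((2 ≤ a ∧ a ≤ 5) ∧ 2 ≤ b ∧ b ≤ 5) ∨ (a = 2 ∧ (b = 0 ∨ b = m₂ ∨ b = m₄)) ∨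
    (a = 3 ∧ (b = 0 ∨ b = m₂ ∨ b = 8)) ∨ (a = 4 ∧ (b = 8 ∨ b = m₂ ∨ b = m₄)) ∨
    (a = 5 ∧ (b = 0 ∨ b = 8 ∨ b = m₄))

/-- The cycle vertices near the number `8`. -/
theorem wheelRel_near_eight {N n : ℕ} (hN : 8 ≤ N) (h₁ : 6 ≤ n ∧ n < N + 6)
    (h : 8 ≠ n ∧ (wheelRel 6 N 8 n ∨ wheelRel 6 N n 8)) : n = 6 ∨ n = 7 ∨ n = 9 ∨ n = 10 := by
  unfold wheelRel at h
  rcases h.2 with (h | ⟨-, -, h | h | h | h⟩) | (h | ⟨-, -, h | h | h | h⟩) <;> omega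

theorem wheelRel_iff_of_near_eight {N a b : ℕ} (hN : 8 ≤ N)
    (ha : a = 6 ∨ a = 7 ∨ a = 9 ∨ a = 10) (hb : b = 6 ∨ b = 7 ∨ b = 9 ∨ b = 10) :
    wheelRel 6 N a b ↔ b = a + 1 ∨ b = a + 2 := by
  have h₁ : ¬ a ≤ 1 := by omega
  have h₂ : 6 ≤ a := by omega
  have h₃ : 6 ≤ b := by omega
  have h₄ : ¬ a + N = b + 1 := by omega
  have h₅ : ¬ a + N = b + 2 := by omega
  simp [wheelRel, h₁, h₂, h₃, h₄, h₅]

/-- The cycle neighbours of `8` induce the path `6, 7, 9, 10`, and the six cases are its edges in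
both directions. For `N ≥ 8` the ends `6` and `10` are not adjacent. -/
theorem wheelRel_near_eight_pair {N m n : ℕ} (hN : 8 ≤ N) (hm : 6 ≤ m ∧ m < N + 6)
    (hn : 6 ≤ n ∧ n < N + 6) (wm : 8 ≠ m ∧ (wheelRel 6 N 8 m ∨ wheelRel 6 N m 8))
    (wn : 8 ≠ n ∧ (wheelRel 6 N 8 n ∨ wheelRel 6 N n 8))
    (w : m ≠ n ∧ (wheelRel 6 N m n ∨ wheelRel 6 N n m)) :
    (m = 7 ∧ n = 9) ∨ (m = 9 ∧ n = 7) ∨ (m = 6 ∧ n = 7) ∨ (m = 7 ∧ n = 6) ∨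
      (m = 9 ∧ n = 10) ∨ (m = 10 ∧ n = 9) := by
  have c₁ := wheelRel_near_eight hN hm wm
  have c₂ := wheelRel_near_eight hN hn wn
  rw [wheelRel_iff_of_near_eight hN c₁ c₂, wheelRel_iff_of_near_eight hN c₂ c₁] at w
  clear wm wn
  rcases c₁ with rfl | rfl | rfl | rfl <;> rcases c₂ with rfl | rfl | rfl | rfl <;> simp at w ⊢

/-- A path contains no triangle; hence no four cycle vertices of the wheel are pairwise adjacent. -/
theorem near_eight_triple {m n l : ℕ}
    (c₁ : (m = 7 ∧ n = 9) ∨ (m = 9 ∧ n = 7) ∨ (m = 6 ∧ n = 7) ∨ (m = 7 ∧ n = 6) ∨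
      (m = 9 ∧ n = 10) ∨ (m = 10 ∧ n = 9))
    (c₂ : (m = 7 ∧ l = 9) ∨ (m = 9 ∧ l = 7) ∨ (m = 6 ∧ l = 7) ∨ (m = 7 ∧ l = 6) ∨
      (m = 9 ∧ l = 10) ∨ (m = 10 ∧ l = 9))
    (c₃ : (n = 7 ∧ l = 9) ∨ (n = 9 ∧ l = 7) ∨ (n = 6 ∧ l = 7) ∨ (n = 7 ∧ l = 6) ∨
      (n = 9 ∧ l = 10) ∨ (n = 10 ∧ l = 9)) : False := by
  rcases c₁ with ⟨rfl, rfl⟩ | ⟨rfl, rfl⟩ | ⟨rfl, rfl⟩ | ⟨rfl, rfl⟩ | ⟨rfl, rfl⟩ | ⟨rfl, rfl⟩ <;>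
    simp at c₂ c₃ <;> omega

theorem IsCRSite.ne_new {V : Type u} {G : SimpleGraph V} {x₁ x₂ x₃ x₄ v₁ v₂ v₃ v₄ : V}
    (h : IsCRSite G x₁ x₂ x₃ x₄ v₁ v₂ v₃ v₄) :
    (v₁ ≠ x₁ ∧ v₁ ≠ x₂ ∧ v₁ ≠ x₃ ∧ v₁ ≠ x₄) ∧ (v₂ ≠ x₁ ∧ v₂ ≠ x₂ ∧ v₂ ≠ x₃ ∧ v₂ ≠ x₄) ∧
      (v₃ ≠ x₁ ∧ v₃ ≠ x₂ ∧ v₃ ≠ x₃ ∧ v₃ ≠ x₄) ∧ (v₄ ≠ x₁ ∧ v₄ ≠ x₂ ∧ v₄ ≠ x₃ ∧ v₄ ≠ x₄) := by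
  have hn := h.nodup
  simp only [List.nodup_cons, List.mem_cons, List.not_mem_nil, or_false, not_or] at hn
  obtain ⟨⟨-, -, -, a₁, a₂, a₃, a₄⟩, ⟨-, -, b₁, b₂, b₃, b₄⟩, ⟨-, c₁, c₂, c₃, c₄⟩,
    ⟨d₁, d₂, d₃, d₄⟩, -⟩ := hn
  exact ⟨⟨Ne.symm a₁, Ne.symm b₁, Ne.symm c₁, Ne.symm d₁⟩,
    ⟨Ne.symm a₂, Ne.symm b₂, Ne.symm c₂, Ne.symm d₂⟩,
    ⟨Ne.symm a₃, Ne.symm b₃, Ne.symm c₃, Ne.symm d₃⟩,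
    ⟨Ne.symm a₄, Ne.symm b₄, Ne.symm c₄, Ne.symm d₄⟩⟩

/-- One of the four vertices of the new kite is a pole. -/
theorem IsCRLabelling.exists_pole {V : Type u} {k : ℕ} {G : SimpleGraph V}
    {f : ZMod (2 * k) ⊕ Bool → V} {x₁ x₂ x₃ x₄ v₁ v₂ v₃ v₄ : V} (hk : 4 ≤ k)
    (h : IsCRLabelling G f x₁ x₂ x₃ x₄ v₁ v₂ v₃ v₄) :
    ∃ b, f (.inr b) = v₁ ∨ f (.inr b) = v₂ ∨ f (.inr b) = v₃ ∨ f (.inr b) = v₄ := by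
  obtain ⟨hv₁, hv₂, hv₃, hv₄⟩ := h.site.ne_new
  obtain ⟨y₁, e₁⟩ := (h.range v₁).2 hv₁
  obtain ⟨y₂, e₂⟩ := (h.range v₂).2 hv₂
  obtain ⟨y₃, e₃⟩ := (h.range v₃).2 hv₃
  obtain ⟨y₄, e₄⟩ := (h.range v₄).2 hv₄
  rcases y₁ with i | b
  swap
  · exact ⟨b, Or.inl e₁⟩
  -- If `v₁` is a cycle vertex, it receives the number `8`. After the reduction `v₁, …, v₄` are
  -- pairwise adjacent, so without a pole the other three would form a triangle among the cycle
  -- neighbours of `8`.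
  obtain ⟨a₂, d₂, rfl⟩ := wheelLabel_surj (i := i) (b := true) (o := 8) (c := 6) (by omega)
    (by omega : 1 ≤ k) y₂
  obtain ⟨a₃, d₃, rfl⟩ := wheelLabel_surj (i := i) (b := true) (o := 8) (c := 6) (by omega)
    (by omega : 1 ≤ k) y₃
  obtain ⟨a₄, d₄, rfl⟩ := wheelLabel_surj (i := i) (b := true) (o := 8) (c := 6) (by omega)
    (by omega : 1 ≤ k) y₄
  by_contra hno
  have big : ∀ a v, wheelDom 6 (2 * k) a → f (wheelLabel k i true 8 a) = v →
      (v = v₁ ∨ v = v₂ ∨ v = v₃ ∨ v = v₄) → 6 ≤ a ∧ a < 2 * k + 6 := by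
    intro a v ha e hv
    by_contra hlt
    unfold wheelDom at ha
    obtain rfl | rfl : a = 0 ∨ a = 1 := by omega
    · exact hno ⟨true, by rw [← wheelLabel_zero (i := i) (o := 8), e]; exact hv⟩
    · exact hno ⟨false, by
        rw [show false = !true from rfl, ← wheelLabel_one (i := i) (o := 8), e]; exact hv⟩
  have d₁ : wheelDom 6 (2 * k) 8 := by unfold wheelDom; omega
  have e₁' : f (wheelLabel k i true 8 8) = v₁ := by
    rw [wheelLabel_cycle (by omega), add_sub_cancel_right, e₁]
  have w : ∀ a a', wheelDom 6 (2 * k) a → wheelDom 6 (2 * k) a' →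
      (G.Adj (f (wheelLabel k i true 8 a)) (f (wheelLabel k i true 8 a')) ∨
        (f (wheelLabel k i true 8 a) = v₁ ∧ f (wheelLabel k i true 8 a') = v₃) ∨
        (f (wheelLabel k i true 8 a) = v₂ ∧ f (wheelLabel k i true 8 a') = v₄)) →
      a ≠ a' ∧ (wheelRel 6 (2 * k) a a' ∨ wheelRel 6 (2 * k) a' a) := by
    intro a a' ha ha' hw
    rw [← wheelLabel_adj (by omega) (by omega) ha ha', h.adj]
    exact hw.imp_right (Or.imp_right fun e => Or.inr (Or.inl e))
  have w₁₂ := w 8 a₂ d₁ d₂ (by rw [e₁', e₂]; exact Or.inl h.site.adj₁₂)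
  have w₁₃ := w 8 a₃ d₁ d₃ (by rw [e₁', e₃]; exact Or.inr (Or.inl ⟨rfl, rfl⟩))
  have w₁₄ := w 8 a₄ d₁ d₄ (by rw [e₁', e₄]; exact Or.inl h.site.adj₄₁.symm)
  have w₂₃ := w a₂ a₃ d₂ d₃ (by rw [e₂, e₃]; exact Or.inl h.site.adj₂₃)
  have w₂₄ := w a₂ a₄ d₂ d₄ (by rw [e₂, e₄]; exact Or.inr (Or.inr ⟨rfl, rfl⟩))
  have w₃₄ := w a₃ a₄ d₃ d₄ (by rw [e₃, e₄]; exact Or.inl h.site.adj₃₄)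
  have b₂ := big a₂ v₂ d₂ e₂ (Or.inr (Or.inl rfl))
  have b₃ := big a₃ v₃ d₃ e₃ (Or.inr (Or.inr (Or.inl rfl)))
  have b₄ := big a₄ v₄ d₄ e₄ (Or.inr (Or.inr (Or.inr rfl)))
  have c₁ := wheelRel_near_eight_pair (by omega) b₂ b₃ w₁₂ w₁₃ w₂₃
  have c₂ := wheelRel_near_eight_pair (by omega) b₂ b₄ w₁₂ w₁₄ w₂₄
  have c₃ := wheelRel_near_eight_pair (by omega) b₃ b₄ w₁₃ w₁₄ w₃₄
  exact near_eight_triple c₁ c₂ c₃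

theorem IsCRSite.adj_iff_crExpansion {V : Type u} {k : ℕ} {G : SimpleGraph V}
    {x₁ x₂ x₃ x₄ v₁ v₂ v₃ v₄ : V}
    (hk : 4 ≤ k) (h : IsCRSite G x₁ x₂ x₃ x₄ v₁ v₂ v₃ v₄) {g : ℕ → V} {m₂ m₄ : ℕ}
    (b₂ : 6 ≤ m₂ ∧ m₂ < 2 * k + 6) (b₄ : 6 ≤ m₄ ∧ m₄ < 2 * k + 6)
    (inj : ∀ a b, a < 2 * k + 6 → b < 2 * k + 6 → g a = g b → a = b)
    (g2 : g 2 = x₁) (g3 : g 3 = x₂) (g4 : g 4 = x₃) (g5 : g 5 = x₄)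
    (e₁ : g 0 = v₁) (e₂ : g m₂ = v₂) (e₃ : g 8 = v₃) (e₄ : g m₄ = v₄)
    {a b : ℕ} (hb : b < 2 * k + 6) (h₁ : 2 ≤ a) (h₂ : a ≤ 5) :
    G.Adj (g a) (g b) ↔
      a ≠ b ∧ (crExpansion (2 * k) m₂ m₄ a b ∨ crExpansion (2 * k) m₂ m₄ b a) := by
  have idx : ∀ {n v}, n < 2 * k + 6 → g n = v → ∀ a, a < 2 * k + 6 → (g a = v ↔ a = n) :=
    fun {n v} hn e a ha => ⟨fun e' => inj _ _ ha hn (e'.trans e.symm), fun e' => e' ▸ e⟩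
  have i₁ := idx (by omega) g2
  have i₂ := idx (by omega) g3
  have i₃ := idx (by omega) g4
  have i₄ := idx (by omega) g5
  have j₁ := idx (by omega) e₁
  have j₂ := idx b₂.2 e₂
  have j₃ := idx (by omega) e₃
  have j₄ := idx b₄.2 e₄
  have s₁ := h
  have s₂ := s₁.rotate
  have s₃ := s₂.rotate
  have s₄ := s₃.rotate
  have t₁ : ∀ b, b < 2 * k + 6 → (G.Adj (g 2) (g b) ↔
      b = 3 ∨ b = 4 ∨ b = 5 ∨ b = 0 ∨ b = m₂ ∨ b = m₄) := fun b hb => by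
    rw [g2, s₁.adj_iff, i₂ b hb, i₃ b hb, i₄ b hb, j₁ b hb, j₂ b hb, j₄ b hb]
  have t₂ : ∀ b, b < 2 * k + 6 → (G.Adj (g 3) (g b) ↔
      b = 4 ∨ b = 5 ∨ b = 2 ∨ b = m₂ ∨ b = 8 ∨ b = 0) := fun b hb => by
    rw [g3, s₂.adj_iff, i₁ b hb, i₃ b hb, i₄ b hb, j₁ b hb, j₂ b hb, j₃ b hb]
  have t₃ : ∀ b, b < 2 * k + 6 → (G.Adj (g 4) (g b) ↔
      b = 5 ∨ b = 2 ∨ b = 3 ∨ b = 8 ∨ b = m₄ ∨ b = m₂) := fun b hb => by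
    rw [g4, s₃.adj_iff, i₁ b hb, i₂ b hb, i₄ b hb, j₃ b hb, j₂ b hb, j₄ b hb]
  have t₄ : ∀ b, b < 2 * k + 6 → (G.Adj (g 5) (g b) ↔
      b = 2 ∨ b = 3 ∨ b = 4 ∨ b = m₄ ∨ b = 0 ∨ b = 8) := fun b hb => by
    rw [g5, s₄.adj_iff, i₁ b hb, i₂ b hb, i₃ b hb, j₁ b hb, j₃ b hb, j₄ b hb]
  have r₁ : ¬ wheelRel 6 (2 * k) a b := by unfold wheelRel; omega
  have r₂ : ¬ wheelRel 6 (2 * k) b a := by unfold wheelRel; omega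
  obtain rfl | rfl | rfl | rfl : a = 2 ∨ a = 3 ∨ a = 4 ∨ a = 5 := by omega
  · rw [t₁ b hb]
    simp only [crExpansion, r₁, r₂]
    clear * - b₂ b₄
    grind
  · rw [t₂ b hb]
    simp only [crExpansion, r₁, r₂]
    clear * - b₂ b₄
    grind
  · rw [t₃ b hb]
    simp only [crExpansion, r₁, r₂]
    clear * - b₂ b₄
    grind
  · rw [t₄ b hb]
    simp only [crExpansion, r₁, r₂]
    clear * - b₂ b₄
    grind


theorem IsCRSite.nonempty_crExpansion_iso {V : Type u} {k : ℕ} {G : SimpleGraph V}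
    {x₁ x₂ x₃ x₄ v₁ v₂ v₃ v₄ : V}
    (hk : 4 ≤ k) (h : IsCRSite G x₁ x₂ x₃ x₄ v₁ v₂ v₃ v₄) {g : ℕ → V} {m₂ m₄ : ℕ}
    (b₂ : 6 ≤ m₂ ∧ m₂ < 2 * k + 6) (b₄ : 6 ≤ m₄ ∧ m₄ < 2 * k + 6)
    (inj : ∀ a b, a < 2 * k + 6 → b < 2 * k + 6 → g a = g b → a = b)
    (surj : ∀ v, ∃ a, a < 2 * k + 6 ∧ g a = v)
    (g2 : g 2 = x₁) (g3 : g 3 = x₂) (g4 : g 4 = x₃) (g5 : g 5 = x₄)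
    (e₁ : g 0 = v₁) (e₂ : g m₂ = v₂) (e₃ : g 8 = v₃) (e₄ : g m₄ = v₄)
    (hadj : ∀ a b, wheelDom 6 (2 * k) a → wheelDom 6 (2 * k) b →
      (a ≠ b ∧ (wheelRel 6 (2 * k) a b ∨ wheelRel 6 (2 * k) b a) ↔
        G.Adj (g a) (g b) ∨ (g a = v₁ ∧ g b = v₃) ∨
    (g a = v₃ ∧ g b = v₁) ∨ (g a = v₂ ∧ g b = v₄) ∨ (g a = v₄ ∧ g b = v₂))) :
    Nonempty (relGraph (· < 2 * k + 6) (crExpansion (2 * k) m₂ m₄) ≃g G) := by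
  have idx : ∀ {n v}, n < 2 * k + 6 → g n = v → ∀ a, a < 2 * k + 6 → (g a = v ↔ a = n) :=
    fun {n v} hn e a ha => ⟨fun e' => inj _ _ ha hn (e'.trans e.symm), fun e' => e' ▸ e⟩
  have j₁ := idx (by omega) e₁
  have j₂ := idx b₂.2 e₂
  have j₃ := idx (by omega) e₃
  have j₄ := idx b₄.2 e₄
  have n₁₃ := h.not_adj₁₃
  have n₂₄ := h.not_adj₂₄
  have dom : ∀ a, a < 2 * k + 6 → ¬ (2 ≤ a ∧ a ≤ 5) → wheelDom 6 (2 * k) a := by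
    unfold wheelDom
    intro a ha
    omega
  have new := fun a b hb h₁ h₂ =>
    h.adj_iff_crExpansion hk b₂ b₄ inj g2 g3 g4 g5 e₁ e₂ e₃ e₄ (a := a) (b := b) hb h₁ h₂
  refine nonempty_relGraph_iso G g inj surj fun a b ha hb => ?_
  by_cases h₁ : 2 ≤ a ∧ a ≤ 5
  · exact new a b hb h₁.1 h₁.2
  by_cases h₂ : 2 ≤ b ∧ b ≤ 5
  · rw [G.adj_comm, new b a ha h₂.1 h₂.2, ne_comm, or_comm]
  have key := hadj a b (dom a ha h₁) (dom b hb h₂)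
  -- The diagonals `v₁v₃` and `v₂v₄` are absent from `G`, so removing them from the wheel recovers
  -- `G` among the old vertices.
  have n₁ : ¬ (g a = v₁ ∧ g b = v₃ ∧ G.Adj (g a) (g b)) := by
    rintro ⟨e, e', h⟩
    exact n₁₃ (e ▸ e' ▸ h)
  have n₂ : ¬ (g a = v₃ ∧ g b = v₁ ∧ G.Adj (g a) (g b)) := by
    rintro ⟨e, e', h⟩
    exact n₁₃ (e ▸ e' ▸ h.symm)
  have n₃ : ¬ (g a = v₂ ∧ g b = v₄ ∧ G.Adj (g a) (g b)) := by
    rintro ⟨e, e', h⟩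
    exact n₂₄ (e ▸ e' ▸ h)
  have n₄ : ¬ (g a = v₄ ∧ g b = v₂ ∧ G.Adj (g a) (g b)) := by
    rintro ⟨e, e', h⟩
    exact n₂₄ (e ▸ e' ▸ h.symm)
  rw [j₁ a ha, j₂ a ha, j₃ a ha, j₄ a ha, j₁ b hb, j₂ b hb, j₃ b hb, j₄ b hb] at key
  rw [j₁ a ha, j₃ b hb] at n₁
  rw [j₃ a ha, j₁ b hb] at n₂
  rw [j₂ a ha, j₄ b hb] at n₃
  rw [j₄ a ha, j₂ b hb] at n₄
  -- `wheelRel` is directed away from the poles, which is why `crExpansion` excludes the pair `0, 8`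
  -- in one order only.
  have r₁ : a = 8 ∧ b = 0 → ¬ wheelRel 6 (2 * k) a b := by unfold wheelRel; omega
  have r₂ : b = 8 ∧ a = 0 → ¬ wheelRel 6 (2 * k) b a := by unfold wheelRel; omega
  have q₁ : ∀ n, 2 ≤ n → n ≤ 5 → a ≠ n := by clear * - h₁; intro n _ _; omega
  have q₂ : ∀ n, 2 ≤ n → n ≤ 5 → b ≠ n := by clear * - h₂; intro n _ _; omega
  simp only [crExpansion, h₁, h₂, q₁ 2 (by omega) (by omega), q₁ 3 (by omega) (by omega),
    q₁ 4 (by omega) (by omega), q₁ 5 (by omega) (by omega), q₂ 2 (by omega) (by omega),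
    q₂ 3 (by omega) (by omega), q₂ 4 (by omega) (by omega), q₂ 5 (by omega) (by omega), false_and,
    or_false]
  constructor
  · intro hC
    obtain ⟨hne, hw⟩ := key.2 (Or.inl hC)
    refine ⟨hne, ?_⟩
    rcases hw with hw | hw
    · exact Or.inl ⟨hw, fun e => n₁ ⟨e.1, e.2, hC⟩, fun e => n₃ ⟨e.1, e.2, hC⟩,
        fun e => n₄ ⟨e.1, e.2, hC⟩⟩
    · exact Or.inr ⟨hw, fun e => n₂ ⟨e.2, e.1, hC⟩, fun e => n₄ ⟨e.2, e.1, hC⟩,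
        fun e => n₃ ⟨e.2, e.1, hC⟩⟩
  · rintro ⟨hne, ⟨hw, p₁, p₂, p₃⟩ | ⟨hw, p₁, p₂, p₃⟩⟩
    · rcases key.1 ⟨hne, Or.inl hw⟩ with hC | e | e | e | e
      · exact hC
      · exact absurd e p₁
      · exact absurd hw (r₁ e)
      · exact absurd e p₂
      · exact absurd e p₃
    · rcases key.1 ⟨hne, Or.inr hw⟩ with hC | e | e | e | e
      · exact hC
      · exact absurd hw (r₂ e.symm)
      · exact absurd e.symm p₁
      · exact absurd e.symm p₃
      · exact absurd e.symm p₂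

/-- In the wheel the pole `v₁` is adjacent to `v₂`, `v₃` and `v₄`, so these lie on the cycle; they
are pairwise adjacent, and with `v₃` numbered `8` the other two form an edge among its cycle
neighbours. -/
theorem IsCRLabelling.exists_crExpansion_of_pole {V : Type u} {k : ℕ} {G : SimpleGraph V}
    {f : ZMod (2 * k) ⊕ Bool → V} {x₁ x₂ x₃ x₄ v₁ v₂ v₃ v₄ : V} (hk : 4 ≤ k)
    (h : IsCRLabelling G f x₁ x₂ x₃ x₄ v₁ v₂ v₃ v₄) {p : Bool} (hp : f (.inr p) = v₁) :
    ∃ m₂ m₄, Nonempty (relGraph (· < 2 * k + 6) (crExpansion (2 * k) m₂ m₄) ≃g G) ∧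
      ((m₂ = 7 ∧ m₄ = 9) ∨ (m₂ = 9 ∧ m₄ = 7) ∨ (m₂ = 6 ∧ m₄ = 7) ∨ (m₂ = 7 ∧ m₄ = 6) ∨
        (m₂ = 9 ∧ m₄ = 10) ∨ (m₂ = 10 ∧ m₄ = 9)) := by
  obtain ⟨-, hv₂, hv₃, hv₄⟩ := h.site.ne_new
  obtain ⟨y₂, e₂⟩ := (h.range v₂).2 hv₂
  obtain ⟨y₃, e₃⟩ := (h.range v₃).2 hv₃
  obtain ⟨y₄, e₄⟩ := (h.range v₄).2 hv₄
  obtain ⟨i, rfl⟩ : ∃ i, y₃ = .inl i := by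
    have : (extendedWheel k).Adj (.inr p) y₃ := (h.adj _ _).2 (Or.inr (Or.inl ⟨hp, e₃⟩))
    rcases y₃ with i | b'
    · exact ⟨i, rfl⟩
    · exact this.elim
  obtain ⟨m₂, d₂, rfl⟩ := wheelLabel_surj (i := i) (b := p) (o := 8) (c := 6) (by omega)
    (by omega : 1 ≤ k) y₂
  obtain ⟨m₄, d₄, rfl⟩ := wheelLabel_surj (i := i) (b := p) (o := 8) (c := 6) (by omega)
    (by omega : 1 ≤ k) y₄
  have d₀ : wheelDom 6 (2 * k) 0 := by unfold wheelDom; omega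
  have d₃ : wheelDom 6 (2 * k) 8 := by unfold wheelDom; omega
  have e₀ : f (wheelLabel k i p 8 0) = v₁ := hp
  have e₃' : f (wheelLabel k i p 8 8) = v₃ := by
    rw [wheelLabel_cycle (by omega), add_sub_cancel_right, e₃]
  have w : ∀ a a', wheelDom 6 (2 * k) a → wheelDom 6 (2 * k) a' →
      (G.Adj (f (wheelLabel k i p 8 a)) (f (wheelLabel k i p 8 a')) ∨
        (f (wheelLabel k i p 8 a) = v₂ ∧ f (wheelLabel k i p 8 a') = v₄)) →
      a ≠ a' ∧ (wheelRel 6 (2 * k) a a' ∨ wheelRel 6 (2 * k) a' a) := by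
    intro a a' ha ha' hw
    rw [← wheelLabel_adj (by omega) (by omega) ha ha', h.adj]
    exact hw.imp_right fun e => Or.inr (Or.inr (Or.inl e))
  have w₃₂ := w 8 m₂ d₃ d₂ (by rw [e₂, e₃']; exact Or.inl h.site.adj₂₃.symm)
  have w₃₄ := w 8 m₄ d₃ d₄ (by rw [e₃', e₄]; exact Or.inl h.site.adj₃₄)
  have w₂₄ := w m₂ m₄ d₂ d₄ (by rw [e₂, e₄]; exact Or.inr ⟨rfl, rfl⟩)
  have w₀₂ := w 0 m₂ d₀ d₂ (by rw [e₀, e₂]; exact Or.inl h.site.adj₁₂)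
  have w₀₄ := w 0 m₄ d₀ d₄ (by rw [e₀, e₄]; exact Or.inl h.site.adj₄₁.symm)
  have b₂ : 6 ≤ m₂ ∧ m₂ < 2 * k + 6 := by unfold wheelDom wheelRel at *; omega
  have b₄ : 6 ≤ m₄ ∧ m₄ < 2 * k + 6 := by unfold wheelDom wheelRel at *; omega
  refine ⟨m₂, m₄, ?_, wheelRel_near_eight_pair (by omega) b₂ b₄ w₃₂ w₃₄ w₂₄⟩
  clear w₃₂ w₃₄ w₂₄ w₀₂ w₀₄ w
  obtain ⟨g, hg⟩ : ∃ g : ℕ → V, g = fun a => if a = 2 then x₁ else if a = 3 then x₂ else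
    if a = 4 then x₃ else if a = 5 then x₄ else f (wheelLabel k i p 8 a) := ⟨_, rfl⟩
  have g2 : g 2 = x₁ := by simp [hg]
  have g3 : g 3 = x₂ := by simp [hg]
  have g4 : g 4 = x₃ := by simp [hg]
  have g5 : g 5 = x₄ := by simp [hg]
  have gw : ∀ a, wheelDom 6 (2 * k) a → g a = f (wheelLabel k i p 8 a) := by
    unfold wheelDom
    intro a ha
    simp only [hg]
    rw [if_neg (by omega), if_neg (by omega), if_neg (by omega), if_neg (by omega)]
  have hf : ∀ y, f y ≠ x₁ ∧ f y ≠ x₂ ∧ f y ≠ x₃ ∧ f y ≠ x₄ := fun y => (h.range _).1 ⟨y, rfl⟩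
  have dom : ∀ a, a < 2 * k + 6 → a = 2 ∨ a = 3 ∨ a = 4 ∨ a = 5 ∨ wheelDom 6 (2 * k) a := by
    unfold wheelDom
    intro a ha
    omega
  have hn := h.site.nodup
  simp only [List.nodup_cons, List.mem_cons, List.not_mem_nil, or_false, not_or] at hn
  have inj : ∀ a b, a < 2 * k + 6 → b < 2 * k + 6 → g a = g b → a = b := by
    intro a b ha hb e
    rcases dom a ha with rfl | rfl | rfl | rfl | ha <;>
      rcases dom b hb with rfl | rfl | rfl | rfl | hb
    all_goals try rw [gw _ ha] at e
    all_goals try rw [gw _ hb] at e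
    all_goals try simp only [g2, g3, g4, g5] at e
    all_goals first
      | rfl
      | exact wheelLabel_inj (by omega) ha hb (h.inj e)
      | (exfalso; clear * - hn e; tauto)
      | (exfalso; have := hf (wheelLabel k i p 8 a); clear * - this e; tauto)
      | (exfalso; have := hf (wheelLabel k i p 8 b); clear * - this e; tauto)
  have surj : ∀ v, ∃ a, a < 2 * k + 6 ∧ g a = v := by
    intro v
    by_cases hv : v ≠ x₁ ∧ v ≠ x₂ ∧ v ≠ x₃ ∧ v ≠ x₄
    · obtain ⟨y, rfl⟩ := (h.range v).2 hv
      obtain ⟨a, ha, rfl⟩ := wheelLabel_surj (i := i) (b := p) (o := 8) (c := 6) (by omega)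
        (by omega : 1 ≤ k) y
      refine ⟨a, ?_, gw a ha⟩
      unfold wheelDom at ha
      omega
    · obtain rfl | rfl | rfl | rfl : v = x₁ ∨ v = x₂ ∨ v = x₃ ∨ v = x₄ := by
        clear * - hv; tauto
      · exact ⟨2, by omega, g2⟩
      · exact ⟨3, by omega, g3⟩
      · exact ⟨4, by omega, g4⟩
      · exact ⟨5, by omega, g5⟩
  have hadj : ∀ a b, wheelDom 6 (2 * k) a → wheelDom 6 (2 * k) b →
      (a ≠ b ∧ (wheelRel 6 (2 * k) a b ∨ wheelRel 6 (2 * k) b a) ↔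
        G.Adj (g a) (g b) ∨ (g a = v₁ ∧ g b = v₃) ∨
    (g a = v₃ ∧ g b = v₁) ∨ (g a = v₂ ∧ g b = v₄) ∨ (g a = v₄ ∧ g b = v₂)) := by
    intro a b ha hb
    rw [gw a ha, gw b hb, ← h.adj, wheelLabel_adj (by omega) (by omega) ha hb]
  exact h.site.nonempty_crExpansion_iso hk b₂ b₄ inj surj g2 g3 g4 g5 ((gw 0 d₀).trans e₀)
    ((gw m₂ d₂).trans e₂) ((gw 8 d₃).trans e₃') ((gw m₄ d₄).trans e₄) hadj

/-- The transposition of `3` and `5`. -/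
def swapThreeFive (a : ℕ) : ℕ := if a = 3 then 5 else if a = 5 then 3 else a

theorem swapThreeFive_cases (a : ℕ) : (a = 3 ∧ swapThreeFive a = 5) ∨
    (a = 5 ∧ swapThreeFive a = 3) ∨ (a ≠ 3 ∧ a ≠ 5 ∧ swapThreeFive a = a) := by
  unfold swapThreeFive
  split_ifs <;> omega

theorem swapThreeFive_involutive : Function.Involutive swapThreeFive := by
  intro a
  have := swapThreeFive_cases a
  have := swapThreeFive_cases (swapThreeFive a)
  omega

/-- The reflection of the crossed cube that fixes `v₁` and `v₃` exchanges `v₂` with `v₄` and also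
`x₂` with `x₄`, whose numbers are `3` and `5`. -/
theorem crExpansion_swap {N m₂ m₄ a b : ℕ} (h₂ : 6 ≤ m₂) (h₄ : 6 ≤ m₄)
    (h : crExpansion N m₂ m₄ a b) :
    crExpansion N m₄ m₂ (swapThreeFive a) (swapThreeFive b) := by
  have ha := swapThreeFive_cases a
  have hb := swapThreeFive_cases b
  rcases h with ⟨h, h'⟩ | h | h | h | h | h
  · have : swapThreeFive a = a ∧ swapThreeFive b = b := by
      unfold wheelRel at h
      clear h'
      omega
    rw [this.1, this.2]
    exact Or.inl ⟨h, h'.1, h'.2.2, h'.2.1⟩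
  · exact Or.inr (Or.inl (by omega))
  · exact Or.inr (Or.inr (Or.inl (by omega)))
  · exact Or.inr (Or.inr (Or.inr (Or.inr (Or.inr (by omega)))))
  · exact Or.inr (Or.inr (Or.inr (Or.inr (Or.inl (by omega)))))
  · exact Or.inr (Or.inr (Or.inr (Or.inl (by omega))))

theorem nonempty_crExpansion_swap {N m₂ m₄ : ℕ} (h₂ : 6 ≤ m₂) (h₄ : 6 ≤ m₄) :
    Nonempty (relGraph (· < N + 6) (crExpansion N m₂ m₄) ≃g
      relGraph (· < N + 6) (crExpansion N m₄ m₂)) := by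
  refine nonempty_relGraph_iso_relGraph swapThreeFive ?_
    (fun _ _ _ _ h => swapThreeFive_involutive.injective h) ?_ ?_
  · intro a ha
    have := swapThreeFive_cases a
    omega
  · intro w hw
    refine ⟨swapThreeFive w, ?_, swapThreeFive_involutive w⟩
    have := swapThreeFive_cases w
    omega
  · intro a b _ _
    rw [swapThreeFive_involutive.injective.ne_iff]
    refine and_congr_right fun _ => ⟨fun h => ?_, fun h => ?_⟩
    · have h' := h.imp (crExpansion_swap h₄ h₂) (crExpansion_swap h₄ h₂)
      rwa [swapThreeFive_involutive, swapThreeFive_involutive] at h'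
    · exact h.imp (crExpansion_swap h₂ h₄) (crExpansion_swap h₂ h₄)

theorem crExpansion_neighbor_cases {N m₂ m₄ n z : ℕ} (hn : 6 ≤ n)
    (h : crExpansion N m₂ m₄ n z ∨ crExpansion N m₂ m₄ z n) :
    ((z ≤ 1 ∨ 6 ≤ z ∧ (z = n + 1 ∨ z = n + 2 ∨ n = z + 1 ∨ n = z + 2 ∨ n + N = z + 1 ∨
      n + N = z + 2 ∨ z + N = n + 1 ∨ z + N = n + 2)) ∧ ¬ (n = 8 ∧ z = 0) ∧ ¬ (n = m₂ ∧ z = m₄) ∧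
        ¬ (n = m₄ ∧ z = m₂)) ∨
      (z = 2 ∧ (n = m₂ ∨ n = m₄)) ∨ (z = 3 ∧ (n = m₂ ∨ n = 8)) ∨
      (z = 4 ∧ (n = 8 ∨ n = m₂ ∨ n = m₄)) ∨ (z = 5 ∧ (n = 8 ∨ n = m₄)) := by
  have wr : ∀ {a b}, wheelRel 6 N a b → (a ≤ 1 ∧ 6 ≤ b) ∨ (6 ≤ a ∧ 6 ≤ b ∧ (b = a + 1 ∨ b = a + 2 ∨
    a + N = b + 1 ∨ a + N = b + 2)) := id
  rcases h with (⟨h, h'⟩ | h | h | h | h | h) | (⟨h, h'⟩ | h | h | h | h | h)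
  · refine Or.inl ⟨?_, ?_, h'.2⟩
    · rcases wr h with h | ⟨_, _, h | h | h | h⟩ <;> clear h' <;> omega
    · have := wr h
      clear h'
      omega
  · omega
  · omega
  · omega
  · omega
  · omega
  · refine Or.inl ⟨?_, fun e => h'.1 ⟨e.2, e.1⟩, fun e => h'.2.2 ⟨e.2, e.1⟩,
      fun e => h'.2.1 ⟨e.2, e.1⟩⟩
    rcases wr h with h | ⟨_, _, h | h | h | h⟩ <;> clear h' <;> omega
  · omega
  · omega
  · omega
  · omega
  · omega

theorem crExpansion_zero {N m₂ m₄ z : ℕ} (h₂ : 6 ≤ m₂) (h₄ : 6 ≤ m₄)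
    (h : crExpansion N m₂ m₄ 0 z ∨ crExpansion N m₂ m₄ z 0) : 2 ≤ z ∧ z ≠ 8 := by
  have wr : ∀ {a b}, wheelRel 6 N a b → (a ≤ 1 ∧ 6 ≤ b) ∨ (6 ≤ a ∧ 6 ≤ b) :=
    fun h => h.imp_right fun h => ⟨h.1, h.2.1⟩
  rcases h with (⟨h, h'⟩ | h | h | h | h | h) | (⟨h, h'⟩ | h | h | h | h | h)
  · have := wr h
    omega
  · omega
  · omega
  · omega
  · omega
  · omega
  · have := wr h
    omega
  · omega
  · omega
  · omega
  · omega
  · omega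

theorem crExpansion_of_wheelRel {N m₂ m₄ a b : ℕ} (h : wheelRel 6 N a b)
    (h' : ¬ (a = 0 ∧ b = 8) ∧ ¬ (a = m₂ ∧ b = m₄) ∧ ¬ (a = m₄ ∧ b = m₂)) :
    crExpansion N m₂ m₄ a b := Or.inl ⟨h, h'⟩

/-- Vertex `9` keeps its six wheel neighbours `7`, `8`, `10`, `11`, `0`, `1`, but `8` is no longer
joined to `0`. As a result `9` can share four neighbours only with `10` and `1`. -/
theorem not_hasKiteDrawing_crExpansion₁ {N : ℕ} (hN : 8 ≤ N) :
    ¬ HasKiteDrawing (relGraph (· < N + 6) (crExpansion N 6 7)) := by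
  refine not_hasKiteDrawing_relGraph (a := 9) (s := 10) (t := 1) (by omega) [7, 8, 10, 11, 0, 1]
    (by decide) (by decide) ?_ ?_
  · intro z hz
    simp only [List.mem_cons, List.not_mem_nil, or_false] at hz
    have h₁ := fun h => @crExpansion_of_wheelRel N 6 7 9 z h
    have h₂ := fun h => @crExpansion_of_wheelRel N 6 7 z 9 h
    refine ⟨by omega, by omega, ?_⟩
    by_cases hz' : z = 10 ∨ z = 11
    · exact Or.inl (h₁ (by unfold wheelRel; omega) (by omega))
    · exact Or.inr (h₂ (by unfold wheelRel; omega) (by omega))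
  · intro b hb hs ht hab h
    have nb : ∀ z, z < N + 6 → 9 ≠ z → (crExpansion N 6 7 9 z ∨ crExpansion N 6 7 z 9) →
        z = 7 ∨ z = 8 ∨ z = 10 ∨ z = 11 ∨ z = 0 ∨ z = 1 := by
      intro z hz h7 h
      have := crExpansion_neighbor_cases (by omega) h
      clear h
      omega
    have h' := nb b hb hab h
    obtain rfl | rfl | rfl | rfl : b = 8 ∨ b = 11 ∨ b = 7 ∨ b = 0 := by omega
    · refine ⟨7, 10, 1, fun z hz h₁ h₂ => ?_⟩
      have h₃ := nb z hz h₁.1 h₁.2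
      have h₄ := crExpansion_neighbor_cases (by omega) h₂.2
      omega
    · refine ⟨10, 0, 1, fun z hz h₁ h₂ => ?_⟩
      have h₃ := nb z hz h₁.1 h₁.2
      have h₄ := crExpansion_neighbor_cases (by omega) h₂.2
      omega
    · refine ⟨8, 0, 1, fun z hz h₁ h₂ => ?_⟩
      have h₃ := nb z hz h₁.1 h₁.2
      have h₄ := crExpansion_neighbor_cases (by omega) h₂.2
      omega
    · refine ⟨7, 10, 11, fun z hz h₁ h₂ => ?_⟩
      have h₃ := nb z hz h₁.1 h₁.2
      have h₄ := crExpansion_zero (by omega) (by omega) h₂.2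
      omega

/-- Up to the reflection of the crossed cube, the mirror image about `8` of the previous position:
vertex `7` takes the part of `9`, with exceptions `6` and `1`. -/
theorem not_hasKiteDrawing_crExpansion₂ {N : ℕ} (hN : 8 ≤ N) :
    ¬ HasKiteDrawing (relGraph (· < N + 6) (crExpansion N 9 10)) := by
  refine not_hasKiteDrawing_relGraph (a := 7) (s := 6) (t := 1) (by omega)
    [N + 5, 6, 8, 9, 0, 1] ?_ (by simp) ?_ ?_
  · simp only [List.nodup_cons, List.mem_cons, List.not_mem_nil, or_false, not_or]
    refine ⟨?_, ?_, ?_, ?_, ?_, ?_⟩ <;> simp <;> omega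
  · intro z hz
    simp only [List.mem_cons, List.not_mem_nil, or_false] at hz
    have h₁ := fun h => @crExpansion_of_wheelRel N 9 10 7 z h
    have h₂ := fun h => @crExpansion_of_wheelRel N 9 10 z 7 h
    refine ⟨by omega, by omega, ?_⟩
    by_cases hz' : z = 8 ∨ z = 9 ∨ z = N + 5
    · exact Or.inl (h₁ (by unfold wheelRel; omega) (by omega))
    · exact Or.inr (h₂ (by unfold wheelRel; omega) (by omega))
  · intro b hb hs ht hab h
    have nb : ∀ z, z < N + 6 → 7 ≠ z → (crExpansion N 9 10 7 z ∨ crExpansion N 9 10 z 7) →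
        z = N + 5 ∨ z = 6 ∨ z = 8 ∨ z = 9 ∨ z = 0 ∨ z = 1 := by
      intro z hz h7 h
      have := crExpansion_neighbor_cases (by omega) h
      clear h
      omega
    have h' := nb b hb hab h
    obtain rfl | rfl | rfl | rfl : b = 8 ∨ b = N + 5 ∨ b = 9 ∨ b = 0 := by omega
    · refine ⟨9, 6, 1, fun z hz h₁ h₂ => ?_⟩
      have h₃ := nb z hz h₁.1 h₁.2
      have h₄ := crExpansion_neighbor_cases (by omega) h₂.2
      omega
    · refine ⟨6, 0, 1, fun z hz h₁ h₂ => ?_⟩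
      have h₃ := nb z hz h₁.1 h₁.2
      have h₄ := crExpansion_neighbor_cases (by omega) h₂.2
      omega
    · refine ⟨8, 0, 1, fun z hz h₁ h₂ => ?_⟩
      have h₃ := nb z hz h₁.1 h₁.2
      have h₄ := crExpansion_neighbor_cases (by omega) h₂.2
      omega
    · refine ⟨9, 6, N + 5, fun z hz h₁ h₂ => ?_⟩
      have h₃ := nb z hz h₁.1 h₁.2
      have h₄ := crExpansion_zero (by omega) (by omega) h₂.2
      omega

theorem IsCRLabelling.nonempty_crExpansion_iso_of_pole {V : Type u} {k : ℕ} {G : SimpleGraph V}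
    {f : ZMod (2 * k) ⊕ Bool → V} {x₁ x₂ x₃ x₄ v₁ v₂ v₃ v₄ : V} (hk : 4 ≤ k)
    (hG : HasKiteDrawing G) (h : IsCRLabelling G f x₁ x₂ x₃ x₄ v₁ v₂ v₃ v₄) {p : Bool}
    (hp : f (.inr p) = v₁) :
    Nonempty (relGraph (· < 2 * k + 6) (crExpansion (2 * k) 7 9) ≃g G) := by
  obtain ⟨m₂, m₄, ⟨e⟩, hm⟩ := h.exists_crExpansion_of_pole hk hp
  obtain ⟨e'⟩ := nonempty_crExpansion_swap (N := 2 * k) (m₂ := m₄) (m₄ := m₂) (by omega) (by omega)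
  have e'' := e'.trans e
  have h₁ := not_hasKiteDrawing_crExpansion₁ (N := 2 * k) (by omega)
  have h₂ := not_hasKiteDrawing_crExpansion₂ (N := 2 * k) (by omega)
  rcases hm with ⟨rfl, rfl⟩ | ⟨rfl, rfl⟩ | ⟨rfl, rfl⟩ | ⟨rfl, rfl⟩ | ⟨rfl, rfl⟩ | ⟨rfl, rfl⟩
  · exact ⟨e⟩
  · exact ⟨e''⟩
  · exact (h₁ (hG.congr e.symm)).elim
  · exact (h₁ (hG.congr e''.symm)).elim
  · exact (h₂ (hG.congr e.symm)).elim
  · exact (h₂ (hG.congr e''.symm)).elim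

/-- A graph with a kite drawing that a CR-reduction turns into an extended wheel graph is unique up
to isomorphism. -/
theorem IsCRLabelling.nonempty_crExpansion_iso {V : Type u} {k : ℕ} {G : SimpleGraph V}
    {f : ZMod (2 * k) ⊕ Bool → V} {x₁ x₂ x₃ x₄ v₁ v₂ v₃ v₄ : V} (hk : 4 ≤ k)
    (hG : HasKiteDrawing G) (h : IsCRLabelling G f x₁ x₂ x₃ x₄ v₁ v₂ v₃ v₄) :
    Nonempty (relGraph (· < 2 * k + 6) (crExpansion (2 * k) 7 9) ≃g G) := by
  obtain ⟨p, hp | hp | hp | hp⟩ := h.exists_pole hk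
  · exact h.nonempty_crExpansion_iso_of_pole hk hG hp
  · exact h.rotate.nonempty_crExpansion_iso_of_pole hk hG hp
  · exact h.rotate.rotate.nonempty_crExpansion_iso_of_pole hk hG hp
  · exact h.rotate.rotate.rotate.nonempty_crExpansion_iso_of_pole hk hG hp

/-! ### Shortening the cycle in the presence of a crossed cube. -/

/-- The SR-reduction that merges the cycle vertices `10` and `8`. -/
theorem isSRSite_crExpansion {N : ℕ} (hN : 8 ≤ N) :
    IsSRSite (relGraph (· < N + 6) (crExpansion N 7 9)) ⟨10, by omega⟩ ⟨11, by omega⟩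
      ⟨12, by omega⟩ ⟨1, by omega⟩ ⟨8, by omega⟩ ⟨9, by omega⟩ ⟨0, by omega⟩ := by
  refine isSRSite_relGraph _ _ _ _ _ _ _ (by simp) ?_ ?_ ?_
  · intro w hw
    dsimp only
    constructor
    · rintro ⟨h₁, h₂⟩
      have := crExpansion_neighbor_cases (by omega) h₂
      omega
    · intro h
      have hr : wheelRel 6 N 10 w ∨ wheelRel 6 N w 10 := by
        unfold wheelRel
        clear hw
        omega
      exact ⟨by omega, hr.imp (fun h => crExpansion_of_wheelRel h (by omega))
        fun h => crExpansion_of_wheelRel h (by omega)⟩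
  · dsimp only
    intro a b h
    have hr : wheelRel 6 N a b ∨ wheelRel 6 N b a := by
      unfold wheelRel
      rcases h with ⟨rfl, rfl⟩ | ⟨rfl, rfl⟩ | ⟨rfl, rfl⟩ | ⟨rfl, rfl⟩ | ⟨rfl, rfl⟩ | ⟨rfl, rfl⟩ |
        ⟨rfl, rfl⟩ | ⟨rfl, rfl⟩ | ⟨rfl, rfl⟩ <;> omega
    exact ⟨by omega, hr.imp (fun h => crExpansion_of_wheelRel h (by omega))
      fun h => crExpansion_of_wheelRel h (by omega)⟩
  -- Vertex `8` is `v₃`, opposite to the pole `v₁ = 0` on the outer cycle, and the edge between them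
  -- is one of the two missing diagonals.
  · dsimp only
    have key : ∀ a, (a = 11 ∨ a = 12 ∨ a = 0) →
        ¬ (crExpansion N 7 9 8 a ∨ crExpansion N 7 9 a 8) := by
      intro a ha h
      have := crExpansion_neighbor_cases (by omega) h
      omega
    exact fun a ha => ⟨fun h => key a ha (Or.inr h), fun h => key a ha (Or.inl h)⟩

/-- The SR-reduction that follows, which merges the cycle vertices `9` and `11`. -/
theorem isSRSite_srRel_crExpansion {N : ℕ} (hN : 8 ≤ N) :
    IsSRSite (relGraph (fun a => a < N + 6 ∧ a ≠ 10) (srRel (crExpansion N 7 9) 11 12 1 8 9 0))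
      ⟨9, by omega⟩ ⟨5, by omega⟩ ⟨4, by omega⟩ ⟨8, by omega⟩ ⟨11, by omega⟩ ⟨0, by omega⟩
      ⟨2, by omega⟩ := by
  refine isSRSite_relGraph _ _ _ _ _ _ _ (by simp) ?_ ?_ ?_
  · rintro w ⟨hw, hw8⟩
    dsimp only
    constructor
    · rintro ⟨h₁, h₂⟩
      have h₃ : (crExpansion N 7 9 9 w ∨ crExpansion N 7 9 w 9) ∧ w ≠ 1 := by
        unfold srRel at h₂
        clear * - h₂
        grind
      have := crExpansion_neighbor_cases (by omega) h₃.1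
      omega
    · unfold srRel crExpansion wheelRel
      rintro (rfl | rfl | rfl | rfl | rfl | rfl) <;> omega
  · dsimp only
    unfold srRel crExpansion wheelRel
    rintro a b (⟨rfl, rfl⟩ | ⟨rfl, rfl⟩ | ⟨rfl, rfl⟩ | ⟨rfl, rfl⟩ | ⟨rfl, rfl⟩ | ⟨rfl, rfl⟩ |
      ⟨rfl, rfl⟩ | ⟨rfl, rfl⟩ | ⟨rfl, rfl⟩) <;> omega
  · dsimp only
    unfold srRel crExpansion wheelRel
    rintro a (rfl | rfl | rfl) <;> constructor <;> omega

/-- Merging `10` into `8` joins `8` to `11`, `12` and `0`. Merging `9` into `11` removes the edge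
from `8` to `0` again and passes the new vertices `2`, `4`, `5` on to `11`. Thus `11` replaces `9`
as `v₄`, and the cycle has lost two vertices. -/
theorem nonempty_crExpansion_iso_srRel {N : ℕ} (hN : 6 ≤ N) :
    Nonempty (relGraph (· < N + 6) (crExpansion N 7 9) ≃g
      relGraph (fun a => (a < N + 2 + 6 ∧ a ≠ 10) ∧ a ≠ 9)
        (srRel (srRel (crExpansion (N + 2) 7 9) 11 12 1 8 9 0) 5 4 8 11 0 2)) := by
  refine nonempty_relGraph_iso_relGraph (skipTwo 9) ?_ (fun _ _ _ _ h => skipTwo_injective 9 h) ?_ ?_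
  · intro a ha
    have := skipTwo_cases 9 a
    omega
  · intro w hw
    by_cases h : w < 9
    · exact ⟨w, by omega, by rw [skipTwo_eq_iff]; omega⟩
    · exact ⟨w - 2, by omega, by rw [skipTwo_eq_iff]; omega⟩
  · intro a b ha hb
    rw [(skipTwo_injective 9).ne_iff]
    have w₁ := wheelRel_skipTwo (c := 6) (N := N) (s := 9) (by omega) (by omega) (by omega)
      (a := a) (b := b) (by omega)
    have w₂ := wheelRel_skipTwo (c := 6) (N := N) (s := 9) (by omega) (by omega) (by omega)
      (a := b) (b := a) (by omega)
    have z₁ : ((a = 7 ∧ b = 9) ∨ (a = 8 ∧ b = 9) ∨ (a = 8 ∧ b = 10)) → wheelRel 6 N a b := by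
      unfold wheelRel; omega
    have z₂ : ((b = 7 ∧ a = 9) ∨ (b = 8 ∧ a = 9) ∨ (b = 8 ∧ a = 10)) → wheelRel 6 N b a := by
      unfold wheelRel; omega
    have y₁ : wheelRel 6 N a b → 6 ≤ b ∧ (a ≤ 1 ∨ 6 ≤ a) := by unfold wheelRel; omega
    have y₂ : wheelRel 6 N b a → 6 ≤ a ∧ (b ≤ 1 ∨ 6 ≤ b) := by unfold wheelRel; omega
    have x₁ : wheelRel 6 N a b → ¬ (a = 9 ∧ b = 7) := by unfold wheelRel; omega
    have x₂ : wheelRel 6 N b a → ¬ (b = 9 ∧ a = 7) := by unfold wheelRel; omega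
    have e := fun t n => @skipTwo_eq_iff 9 t n
    have l₁ : (2 ≤ skipTwo 9 a ∧ skipTwo 9 a ≤ 5) ↔ 2 ≤ a ∧ a ≤ 5 := by
      have := skipTwo_cases 9 a
      omega
    have l₂ : (2 ≤ skipTwo 9 b ∧ skipTwo 9 b ≤ 5) ↔ 2 ≤ b ∧ b ≤ 5 := by
      have := skipTwo_cases 9 b
      omega
    simp only [srRel, crExpansion, w₁, w₂, e, l₁, l₂]
    clear w₁ w₂ e l₁ l₂
    norm_num
    generalize wheelRel 6 N a b = A at *
    generalize wheelRel 6 N b a = B at *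
    clear ha hb
    grind (splits := 40)

/-- The CR-reduction that leads back to the extended wheel graph. -/
theorem isCRSite_crExpansion {N : ℕ} (hN : 6 ≤ N) :
    IsCRSite (relGraph (· < N + 6) (crExpansion N 7 9)) ⟨2, by omega⟩ ⟨3, by omega⟩ ⟨4, by omega⟩
      ⟨5, by omega⟩ ⟨0, by omega⟩ ⟨7, by omega⟩ ⟨8, by omega⟩ ⟨9, by omega⟩ where
  nodup := by simp
  nbr₁ := by
    ext ⟨w, hw⟩
    simp only [SimpleGraph.mem_neighborSet, relGraph_adj, Set.mem_insert_iff,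
      Set.mem_singleton_iff, Subtype.mk.injEq, crExpansion, wheelRel]
    grind
  nbr₂ := by
    ext ⟨w, hw⟩
    simp only [SimpleGraph.mem_neighborSet, relGraph_adj, Set.mem_insert_iff,
      Set.mem_singleton_iff, Subtype.mk.injEq, crExpansion, wheelRel]
    grind
  nbr₃ := by
    ext ⟨w, hw⟩
    simp only [SimpleGraph.mem_neighborSet, relGraph_adj, Set.mem_insert_iff,
      Set.mem_singleton_iff, Subtype.mk.injEq, crExpansion, wheelRel]
    grind
  nbr₄ := by
    ext ⟨w, hw⟩
    simp only [SimpleGraph.mem_neighborSet, relGraph_adj, Set.mem_insert_iff,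
      Set.mem_singleton_iff, Subtype.mk.injEq, crExpansion, wheelRel]
    grind
  adj₁₂ := by simp [relGraph_adj, crExpansion, wheelRel]
  adj₂₃ := by simp [relGraph_adj, crExpansion, wheelRel]
  adj₃₄ := by simp [relGraph_adj, crExpansion, wheelRel]
  adj₄₁ := by simp [relGraph_adj, crExpansion, wheelRel]
  not_adj₁₃ := by simp [relGraph_adj, crExpansion, wheelRel]
  not_adj₂₄ := by
    simp [relGraph_adj, crExpansion, wheelRel]

theorem nonempty_wheelRel_iso_crGraph {N : ℕ} (hN : 6 ≤ N) :
    Nonempty (relGraph (wheelDom 6 N) (wheelRel 6 N) ≃g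
      crGraph (relGraph (· < N + 6) (crExpansion N 7 9)) ⟨2, by omega⟩ ⟨3, by omega⟩ ⟨4, by omega⟩
      ⟨5, by omega⟩ ⟨0, by omega⟩ ⟨7, by omega⟩ ⟨8, by omega⟩ ⟨9, by omega⟩) := by
  refine ⟨⟨Equiv.ofBijective (fun a => ⟨⟨a.1, ?_⟩, ?_⟩) ⟨fun a b e => ?_, fun w => ?_⟩,
    fun {a b} => ?_⟩⟩
  · have := a.2
    unfold wheelDom at this
    omega
  · have := a.2
    unfold wheelDom at this
    simp only [Set.mem_compl_iff, Set.mem_insert_iff, Set.mem_singleton_iff, Subtype.mk.injEq]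
    omega
  · exact Subtype.ext (congrArg (fun y => y.1.1) e)
  · obtain ⟨⟨w, hw⟩, hw'⟩ := w
    simp only [Set.mem_compl_iff, Set.mem_insert_iff, Set.mem_singleton_iff, Subtype.mk.injEq]
      at hw'
    exact ⟨⟨w, by unfold wheelDom; omega⟩, rfl⟩
  · obtain ⟨a, ha⟩ := a
    obtain ⟨b, hb⟩ := b
    have h₁ : ¬ (2 ≤ a ∧ a ≤ 5) := by unfold wheelDom at ha; omega
    have h₂ : ¬ (2 ≤ b ∧ b ≤ 5) := by unfold wheelDom at hb; omega
    have q₁ : ∀ n, 2 ≤ n → n ≤ 5 → a ≠ n := by clear * - h₁; intro n _ _; omega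
    have q₂ : ∀ n, 2 ≤ n → n ≤ 5 → b ≠ n := by clear * - h₂; intro n _ _; omega
    have z₁ : (a = 0 ∧ b = 8) ∨ (a = 7 ∧ b = 9) → wheelRel 6 N a b := by unfold wheelRel; omega
    have z₂ : (b = 0 ∧ a = 8) ∨ (b = 7 ∧ a = 9) → wheelRel 6 N b a := by unfold wheelRel; omega
    have key : (a ≠ b ∧ (crExpansion N 7 9 a b ∨ crExpansion N 7 9 b a)) ∨ (a = 0 ∧ b = 8) ∨
        (a = 8 ∧ b = 0) ∨ (a = 7 ∧ b = 9) ∨ (a = 9 ∧ b = 7) ↔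
        a ≠ b ∧ (wheelRel 6 N a b ∨ wheelRel 6 N b a) := by
      simp only [crExpansion, h₁, h₂, q₁ 2 (by omega) (by omega), q₁ 3 (by omega) (by omega),
        q₁ 4 (by omega) (by omega), q₁ 5 (by omega) (by omega), q₂ 2 (by omega) (by omega),
        q₂ 3 (by omega) (by omega), q₂ 4 (by omega) (by omega), q₂ 5 (by omega) (by omega),
        false_and, or_false]
      generalize wheelRel 6 N a b = A at *
      generalize wheelRel 6 N b a = B at *
      clear * - z₁ z₂
      grind (splits := 30)
    refine ((isCRSite_crExpansion hN).crGraph_adj _ _).trans ?_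
    simp only [Subtype.ext_iff]
    exact key

/-- As for the crossed star, uniqueness reduces the claim to the model. Here `k = 4` is allowed
because the second merge is blocked only by edges from `11` to new vertices, of which there are
none. -/
theorem IsCXW.exists_srReduces {V : Type u} {G : SimpleGraph V} {k : ℕ} (hk : 4 ≤ k)
    (hG : IsCXW k G) :
    ∃ (W₁ W₂ : Type u) (G₁ : SimpleGraph W₁) (G₂ : SimpleGraph W₂),
      SRReduces G G₁ ∧ SRReduces G₁ G₂ ∧ IsCXW (k - 1) G₂ := by
  obtain ⟨hopt, -, x₁, x₂, x₃, x₄, v₁, v₂, v₃, v₄, hs, ⟨φ⟩⟩ := hG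
  obtain ⟨f, hf⟩ := hs.exists_isCRLabelling φ
  have hK := hopt.hasKiteDrawing (hf.exists_adj (by omega))
  obtain ⟨ψ⟩ := hf.nonempty_crExpansion_iso hk hK
  obtain ⟨W₁, G₁, hr₁, hK₁, ⟨ψ₁⟩⟩ := _root_.exists_srReduces hK ψ
    (isSRSite_crExpansion (N := 2 * k) (by omega))
  obtain ⟨W₂, G₂, hr₂, hK₂, ⟨ψ₂⟩⟩ := _root_.exists_srReduces hK₁ ψ₁
    (isSRSite_srRel_crExpansion (N := 2 * k) (by omega))
  refine ⟨W₁, W₂, G₁, G₂, hr₁, hr₂, hK₂.isOptimalOnePlanar, hK₂.isOptimalOnePlanar, ?_⟩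
  obtain ⟨k, rfl⟩ : ∃ l, k = l + 1 := ⟨k - 1, by omega⟩
  obtain ⟨θ⟩ := nonempty_crExpansion_iso_srRel (N := 2 * k) (by omega)
  have ψ₃ := θ.trans ψ₂
  obtain ⟨e₁⟩ := nonempty_crGraph_iso ψ₃ ⟨2, by omega⟩ ⟨3, by omega⟩ ⟨4, by omega⟩
    ⟨5, by omega⟩ ⟨0, by omega⟩ ⟨7, by omega⟩ ⟨8, by omega⟩ ⟨9, by omega⟩
  obtain ⟨e₂⟩ := nonempty_wheelRel_iso_crGraph (N := 2 * k) (by omega)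
  obtain ⟨e₃⟩ := nonempty_relGraph_iso_extendedWheel (c := 6) (k := k) (by omega) (by omega)
  exact ⟨_, _, _, _, _, _, _, _, (isCRSite_crExpansion (N := 2 * k) (by omega)).map ψ₃,
    ⟨e₃.symm.trans (e₂.trans e₁)⟩⟩

/-! ### The main theorem. -/

theorem mainTheorem11 {V : Type u} (G : SimpleGraph V) (k : ℕ) :
    (5 ≤ k → IsSXW k G →
      Reduces G (extendedWheel k) ∧
      ∃ (W₁ W₂ : Type u) (G₁ : SimpleGraph W₁) (G₂ : SimpleGraph W₂),
        SRReduces G G₁ ∧ SRReduces G₁ G₂ ∧ ReducesMany G G₂ ∧ IsSXW (k - 1) G₂) ∧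
    (4 ≤ k → IsCXW k G →
      Reduces G (extendedWheel k) ∧
      ∃ (W₁ W₂ : Type u) (G₁ : SimpleGraph W₁) (G₂ : SimpleGraph W₂),
        SRReduces G G₁ ∧ SRReduces G₁ G₂ ∧ ReducesMany G G₂ ∧ IsCXW (k - 1) G₂) := by
  refine ⟨fun hk hG => ⟨Or.inl hG.2, ?_⟩, fun hk hG => ⟨Or.inr hG.2, ?_⟩⟩
  · obtain ⟨W₁, W₂, G₁, G₂, h₁, h₂, h₃⟩ := hG.exists_srReduces hk
    exact ⟨W₁, W₂, G₁, G₂, h₁, h₂, (ReducesMany.refl.tail (Or.inl h₁)).tail (Or.inl h₂), h₃⟩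
  · obtain ⟨W₁, W₂, G₁, G₂, h₁, h₂, h₃⟩ := hG.exists_srReduces hk
    exact ⟨W₁, W₂, G₁, G₂, h₁, h₂, (ReducesMany.refl.tail (Or.inl h₁)).tail (Or.inl h₂), h₃⟩
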